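/- **Setting.** Let $\mathcal H$ be a complex Hilbert space and $A:\mathrm{dom}(A)\subseteq\mathcal H\to\mathcal H$ a (possibly unbounded) selfadjoint operator with spectrum $\Sigma(A)$ and resolvent $R(z)=(z-A)^{-1}$. Let $\Lambda\subset\mathbb R$ be a nonempty finite set of eigenvalues of $A$ of finite multiplicity and let $E$ be the span of all eigenvectors of $A$ belonging to elements of $\Lambda$. Let $A=U_A|A|$ be the polar decomposition of $A$ and let $a(x,y)=(U_A|A|^{1/2}x,|A|^{1/2}y)_{\mathcal H}$ on $\mathrm{dom}(a)=\mathrm{dom}(|A|^{1/2})$. For a finite-dimensional subspace $F\subseteq\mathrm{dom}(a)$ of $\mathcal H$, let $A_F:F\to F$ be given by $(A_Fx,y)_{\mathcal H}=a(x,y)$ for all $x,y\in F$. *Filter.* Let $r_N(\xi)=w_N+\sum_{k=0}^{N-1}w_k(z_k-\xi)^{-1}$ with $w_k,z_k\in\mathbb C$ and $z_k\notin\overline{\Sigma(A)}$. Assume there are $y\in\mathbb R$ and $\gamma,\delta>0$ such that $\Lambda\subseteq I=\{x\in\mathbb R:|x-y|\le\gamma\}$, $\Sigma(A)\setminus\Lambda\subseteq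 O=\{x\in\mathbb R:|x-y|\ge(1+\delta)\gamma\}$, $\inf_I|r_N|>0$ and $\sup_O|r_N|/\inf_I|r_N|<1$. *The space $\mathcal V$.* Let $\mathcal V\subseteq\mathcal H$ be a Hilbert space, continuously embedded in $\mathcal H$, with $E\subseteq\mathcal V$ and $R(z)\mathcal V\subseteq\mathcal V$ for every $z$ in the resolvent set of $A$. Assume that $\mathcal V\subseteq\mathrm{dom}(|A|^{1/2})$ and $\|u\|_{\mathcal V}=\||A|^{1/2}u\|_{\mathcal H}$ for all $u\in\mathcal V$. *Discretization.* For each $h$ in a set of positive mesh parameters, let $\mathcal V_h$ be a finite-dimensional subspace of $\mathcal V$ (so that $\mathcal V_h\subseteq\mathrm{dom}(a)$) and let $R_h(z_k):\mathcal H\to\mathcal V_h$ be linear. Assume that $R_h(z_k)$ and $R(z_k)$ are bounded on $\mathcal V$ and that $\lim_{h\to0}\|R_h(z_k)-R(z_k)\|_{\mathcal V}=0$ for each $k$. As operators on $\mathcal V$, put $S_N=w_N+\sum_k w_kR(z_k)$ and $S_N^h=w_N+\sum_k w_kR_h(z_k)$. Let $\Theta\subset\mathbb C$ be a positively oriented simple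 closed rectifiable curve that encloses $\{r_N(\lambda):\lambda\in\Lambda\}$ and no other element of the spectrum of $S_N$, and that lies strictly outside the circle centred at $0$ whose radius is the maximal modulus of those other elements ($0$ if there are none). Put $P_h=\frac1{2\pi\mathrm i}\oint_\Theta(z-S_N^h)^{-1}\,dz$, $E_h=\mathrm{ran}\,P_h$, and let $\Lambda_h=\Sigma(A_{E_h})$ be the set of Ritz values of $A$ on $E_h$. *Distances.* For subspaces $M,L$ of $X\in\{\mathcal V,\mathcal H\}$, $\mathrm{gap}_X(M,L)$ is the maximum of $\sup_{m\in M,\|m\|_X=1}\mathrm{dist}_X(m,L)$ and $\sup_{l\in L,\|l\|_X=1}\mathrm{dist}_X(l,M)$. For subsets of $\mathbb R$, $\mathrm{dist}$ is the Hausdorff distance, and $\|A_E\|$ is the operator norm of $A_E$ on $(E,\|\cdot\|_{\mathcal H})$. **Corollary.** There are positive constants $C_0$ and $h_0$ such that for all $h<h_0$: $\Theta$ lies in the resolvent set of $S_N^h$ (so that $E_h$ is well defined), $E_h$ is finite-dimensional, $\mathrm{gap}_{\mathcal V}(E,E_h)<1$, and $$\mathrm{dist}(\Lambda,\Lambda_h)\le(\Lambda_h^{\max})^2\,\mathrm{gap}_{\mathcal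 V}(E,E_h)^2+C_0\,\|A_E\|\,\mathrm{gap}_{\mathcal H}(E,E_h)^2,$$ where $\Lambda_h^{\max}=\sup_{0\ne e_h\in E_h}\||A|^{1/2}e_h\|_{\mathcal H}/\|e_h\|_{\mathcal H}$ satisfies $$(\Lambda_h^{\max})^2\le\Big(\frac1{1-\mathrm{gap}_{\mathcal V}(E,E_h)}\Big)^2\|A_E\|.$$ -/

import Mathlib

open Set Filter Topology
open scoped ENNReal InnerProductSpace

noncomputable section

namespace FilteredSubspace

variable {H : Type*} [NormedAddCommGroup H] [InnerProductSpace ℂ H]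

/-! ### Resolvent, spectrum and eigenspaces of an unbounded operator -/

/-- `R` is a bounded, everywhere defined inverse of `z - A : dom A → H`. -/
def IsResolventAt (A : H →ₗ.[ℂ] H) (z : ℂ) (R : H →L[ℂ] H) : Prop :=
  (∀ x : H, ∃ hx : R x ∈ A.domain, z • R x - A ⟨R x, hx⟩ = x) ∧
    ∀ x : A.domain, R (z • (x : H) - A x) = x

/-- The resolvent set of the unbounded operator `A`. -/
def resolventPts (A : H →ₗ.[ℂ] H) : Set ℂ := {z | ∃ R, IsResolventAt A z R}

/-- The spectrum `Σ(A)` of the unbounded operator `A`. -/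
def spec (A : H →ₗ.[ℂ] H) : Set ℂ := (resolventPts A)ᶜ

open Classical in
/-- The resolvent `R(z) = (z - A)⁻¹` (and `0` if `z` lies in the spectrum). -/
def resolventOp (A : H →ₗ.[ℂ] H) (z : ℂ) : H →L[ℂ] H :=
  if h : ∃ R, IsResolventAt A z R then h.choose else 0

/-- The eigenspace `ker (lam - A)`, as a subspace of `H`. -/
def eigSpace (A : H →ₗ.[ℂ] H) (lam : ℝ) : Submodule ℂ H :=
  (LinearMap.ker (A.toFun - (lam : ℂ) • A.domain.subtype)).map A.domain.subtype

/-- The span of all eigenvectors of `A` belonging to eigenvalues in `Lam`. -/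
def clusterSpace (A : H →ₗ.[ℂ] H) (Lam : Set ℝ) : Submodule ℂ H :=
  ⨆ lam ∈ Lam, eigSpace A lam

/-- `Lam` is a nonempty finite collection of eigenvalues of `A` of finite multiplicity. -/
structure IsEigenCluster (A : H →ₗ.[ℂ] H) (Lam : Set ℝ) : Prop where
  finite : Lam.Finite
  nonempty : Lam.Nonempty
  eigenvalue : ∀ lam ∈ Lam, eigSpace A lam ≠ ⊥
  finiteMult : ∀ lam ∈ Lam, FiniteDimensional ℂ (eigSpace A lam)

/-! ### Modulus, square root of the modulus, and polar factor of a self-adjoint operator -/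

section Polar

variable [CompleteSpace H]

/-- The densely defined operator `C K⁻¹`, with domain `ran K`. -/
def quotOp (C K : H →L[ℂ] H) : H →ₗ.[ℂ] H :=
  (C : H →ₗ[ℂ] H).compPMap (((K : H →ₗ[ℂ] H).toPMap ⊤).inverse)

/-- `(1 + A²)⁻¹`, obtained as `R(i)* R(i)`. -/
def cutoff (A : H →ₗ.[ℂ] H) : H →L[ℂ] H :=
  star (resolventOp A Complex.I) * resolventOp A Complex.I

/-- `A (1 + A²)⁻¹`, obtained as `-(R(i) + R(i)*) / 2`. -/
def damped (A : H →ₗ.[ℂ] H) : H →L[ℂ] H :=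
  -((2 : ℂ)⁻¹ • (resolventOp A Complex.I + star (resolventOp A Complex.I)))

/-- `|A| = (A² (1 + A²)⁻¹)^(1/2) ((1 + A²)^(-1/2))⁻¹`. -/
def absOp (A : H →ₗ.[ℂ] H) : H →ₗ.[ℂ] H :=
  quotOp (CFC.sqrt (1 - cutoff A)) (CFC.sqrt (cutoff A))

/-- `|A|^(1/2) = (A² (1 + A²)⁻¹)^(1/4) ((1 + A²)^(-1/4))⁻¹`. -/
def absSqrt (A : H →ₗ.[ℂ] H) : H →ₗ.[ℂ] H :=
  quotOp (CFC.sqrt (CFC.sqrt (1 - cutoff A))) (CFC.sqrt (CFC.sqrt (cutoff A)))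

/-- The polar factor `U_A = sgn A`: the projection onto the positive spectral subspace of `A`
minus the projection onto the negative one. -/
def polarFactor (A : H →ₗ.[ℂ] H) : H →L[ℂ] H :=
  (LinearMap.range ((damped A)⁺ : H →L[ℂ] H).toLinearMap).topologicalClosure.starProjection -
    (LinearMap.range ((damped A)⁻ : H →L[ℂ] H).toLinearMap).topologicalClosure.starProjection


/-! The next facts confirm that these are the objects of the polar decomposition `A = U_A |A|`. -/

lemma mem_graph_quotOp {C K : H →L[ℂ] H} (hK : Function.Injective K) {x y : H} :
    (x, y) ∈ (quotOp C K).graph ↔ ∃ u, K u = x ∧ C u = y := by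
  have hker : ((K : H →ₗ[ℂ] H).toPMap ⊤).toFun.ker = ⊥ := by
    rw [LinearMap.ker_eq_bot]
    intro a b hab
    exact Subtype.ext (hK hab)
  have hinv : ∀ a b : H, (a, b) ∈ ((K : H →ₗ[ℂ] H).toPMap ⊤).inverse.graph ↔ K b = a := by
    intro a b
    rw [LinearPMap.inverse_graph hker]
    simp only [Submodule.mem_map, LinearPMap.mem_graph_iff, Prod.exists]
    constructor
    · rintro ⟨p, q, ⟨w, rfl, rfl⟩, h⟩
      simp only [LinearEquiv.coe_coe, LinearEquiv.prodComm_apply, Prod.swap_prod_mk,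
        Prod.mk.injEq] at h
      rw [← h.1, ← h.2]; rfl
    · rintro rfl
      exact ⟨b, K b, ⟨⟨b, trivial⟩, rfl, rfl⟩, rfl⟩
  rw [LinearPMap.mem_graph_iff]
  constructor
  · rintro ⟨w, rfl, rfl⟩
    refine ⟨((K : H →ₗ[ℂ] H).toPMap ⊤).inverse w, ?_, rfl⟩
    rw [← hinv]
    exact LinearPMap.mem_graph ((K : H →ₗ[ℂ] H).toPMap ⊤).inverse w
  · rintro ⟨u, rfl, rfl⟩
    obtain ⟨w, hw1, hw2⟩ := (LinearPMap.mem_graph_iff _).1 ((hinv (K u) u).2 rfl)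
    refine ⟨w, hw1, ?_⟩
    change C (((K : H →ₗ[ℂ] H).toPMap ⊤).inverse w) = C u
    rw [hw2]

lemma quotOp_isSelfAdjoint {C K : H →L[ℂ] H} (hK : Function.Injective K)
    (hCs : IsSelfAdjoint C) (hKs : IsSelfAdjoint K) (hCK : Commute C K) (n : ℕ)
    (h1 : C ^ (n + 1) + K ^ (n + 1) = 1) : IsSelfAdjoint (quotOp C K) := by
  have hC : ∀ x y : H, inner ℂ (C x) y = inner ℂ x (C y) := hCs.isSymmetric
  have hKK : ∀ x y : H, inner ℂ (K x) y = inner ℂ x (K y) := hKs.isSymmetric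
  have hcom : ∀ x, C (K x) = K (C x) := fun x => congrArg (fun T : H →L[ℂ] H => T x) hCK.eq
  have hdom : ∀ u : H, K u ∈ (quotOp C K).domain := fun u =>
    LinearPMap.mem_domain_of_mem_graph ((mem_graph_quotOp hK).2 ⟨u, rfl, rfl⟩)
  have happ : ∀ u : H, quotOp C K ⟨K u, hdom u⟩ = C u := fun u =>
    ((LinearPMap.image_iff (hdom u)).2 ((mem_graph_quotOp hK).2 ⟨u, rfl, rfl⟩)).symm
  have hex : ∀ x : (quotOp C K).domain, ∃ u, K u = x ∧ quotOp C K x = C u := by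
    intro x
    obtain ⟨u, hu, hv⟩ := (mem_graph_quotOp hK).1 (LinearPMap.mem_graph (quotOp C K) x)
    exact ⟨u, hu, hv.symm⟩
  have hdense : Dense ((quotOp C K).domain : Set H) := by
    rw [Submodule.dense_iff_topologicalClosure_eq_top,
      Submodule.topologicalClosure_eq_top_iff, Submodule.eq_bot_iff]
    intro y hy
    rw [Submodule.mem_orthogonal] at hy
    apply hK
    rw [map_zero, ← inner_self_eq_zero (𝕜 := ℂ), ← hKK]
    exact hy _ (hdom _)
  rw [LinearPMap.isSelfAdjoint_def]
  symm
  have hle : quotOp C K ≤ LinearPMap.adjoint (quotOp C K) := by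
    apply LinearPMap.IsFormalAdjoint.le_adjoint hdense
    intro x y
    obtain ⟨u, hu, hu'⟩ := hex x
    obtain ⟨v, hv, hv'⟩ := hex y
    rw [hu', hv', ← hu, ← hv, hC, hKK, hcom]
  apply LinearPMap.eq_of_le_of_domain_eq hle
  · apply le_antisymm hle.1
    · intro y hy
      set w := LinearPMap.adjoint (quotOp C K) ⟨y, hy⟩ with hw
      have key : C y = K w := by
        apply ext_inner_right ℂ
        intro u
        have := LinearPMap.adjoint_isFormalAdjoint hdense ⟨y, hy⟩ ⟨K u, hdom u⟩
        rw [happ] at this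
        rw [hC, hKK]
        exact this.symm
      have hy' : y = K ((C ^ n) w + (K ^ n) y) := by
        have hcn : ∀ x, (C ^ n) (K x) = K ((C ^ n) x) := fun x =>
          congrArg (fun T : H →L[ℂ] H => T x) (hCK.pow_left n).eq
        have e := congrArg (fun T : H →L[ℂ] H => T y) h1
        rw [pow_succ C, pow_succ' K] at e
        change (C ^ n) (C y) + K ((K ^ n) y) = y at e
        rw [key, hcn] at e
        rw [map_add]
        exact e.symm
      rw [hy']
      exact hdom _

lemma quotOp_nonneg {C K : H →L[ℂ] H} (hK : Function.Injective K)
    (hC0 : 0 ≤ C) (hK0 : 0 ≤ K) (hCK : Commute C K) (x : (quotOp C K).domain) :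
    0 ≤ RCLike.re (inner ℂ (quotOp C K x) (x : H)) := by
  obtain ⟨u, hu, hv⟩ := (mem_graph_quotOp hK).1 (LinearPMap.mem_graph (quotOp C K) x)
  have hpos : 0 ≤ K * C := hCK.symm.mul_nonneg hK0 hC0
  have hKs : ∀ x y : H, inner ℂ (K x) y = inner ℂ x (K y) :=
    (IsSelfAdjoint.of_nonneg hK0).isSymmetric
  have := ((ContinuousLinearMap.nonneg_iff_isPositive _).1 hpos).re_inner_nonneg_left u
  rw [← hv, ← hu, ← hKs]
  exact this

/-- `± i` belongs to the resolvent set of a self-adjoint operator. -/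
lemma exists_resolventAt {A : H →ₗ.[ℂ] H} (hA : IsSelfAdjoint A) {z : ℂ}
    (hz : z = Complex.I ∨ z = -Complex.I) : ∃ R, IsResolventAt A z R := by
  have hd := hA.dense_domain
  have hsym : ∀ x y : A.domain, inner ℂ (A x) (y : H) = inner ℂ (x : H) (A y) := by
    have := LinearPMap.adjoint_isFormalAdjoint hd (T := A)
    rw [LinearPMap.isSelfAdjoint_def.1 hA] at this
    exact this
  have hzz : z * z = -1 := by rcases hz with rfl | rfl <;> simp
  have hzn : ‖z‖ = 1 := by rcases hz with rfl | rfl <;> simp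
  have hzc : (starRingEnd ℂ) z = -z := by rcases hz with rfl | rfl <;> simp
  have hnorm : ∀ x : A.domain, ‖z • (x : H) - A x‖ ^ 2 = ‖(x : H)‖ ^ 2 + ‖A x‖ ^ 2 := by
    intro x
    rw [norm_sub_sq (𝕜 := ℂ), norm_smul, hzn, one_mul, inner_smul_left, hzc]
    have him : (inner ℂ (x : H) (A x)).im = 0 := by
      have h1 := hsym x x
      have h2 := inner_conj_symm (𝕜 := ℂ) (x : H) (A x)
      rw [h1] at h2
      exact Complex.conj_eq_iff_im.1 h2
    have hre : RCLike.re (-z * inner ℂ (x : H) (A x)) = 0 := by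
      rcases hz with rfl | rfl <;> simp [him]
    rw [hre]; ring
  let φ : A.graph →L[ℂ] H :=
    (z • ContinuousLinearMap.fst ℂ H H - ContinuousLinearMap.snd ℂ H H).comp A.graph.subtypeL
  have hφ : ∀ p : A.graph, φ p = z • (p : H × H).1 - (p : H × H).2 := fun p => rfl
  have hclosed : IsClosed (A.graph : Set (H × H)) := hA.isClosed
  have : CompleteSpace A.graph := hclosed.completeSpace_coe
  have hbd : ∀ p : A.graph, ‖p‖ ≤ (1 : NNReal) * ‖φ p‖ := by
    rintro ⟨⟨a, b⟩, hp⟩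
    obtain ⟨x, hx, hy⟩ := (LinearPMap.mem_graph_iff _).1 hp
    simp only at hx hy
    have := hnorm x
    rw [hx, hy] at this
    rw [hφ]
    simp only [NNReal.coe_one, one_mul]
    change ‖(a, b)‖ ≤ _
    rw [Prod.norm_def]
    apply max_le
    · exact abs_le_of_sq_le_sq' (by nlinarith [sq_nonneg ‖b‖]) (norm_nonneg _) |>.2
    · exact abs_le_of_sq_le_sq' (by nlinarith [sq_nonneg ‖a‖]) (norm_nonneg _) |>.2
  have hanti : AntilipschitzWith 1 φ := φ.antilipschitz_of_bound hbd
  have hinj : LinearMap.ker (φ : A.graph →ₗ[ℂ] H) = ⊥ :=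
    LinearMap.ker_eq_bot.2 hanti.injective
  have hcl : IsClosed (Set.range φ) := hanti.isClosed_range φ.uniformContinuous
  have hsurj : LinearMap.range (φ : A.graph →ₗ[ℂ] H) = ⊤ := by
    have hcl' : IsClosed ((LinearMap.range (φ : A.graph →ₗ[ℂ] H) : Submodule ℂ H) : Set H) := hcl
    rw [← hcl'.submodule_topologicalClosure_eq, Submodule.topologicalClosure_eq_top_iff,
      Submodule.eq_bot_iff]
    intro y hy
    rw [Submodule.mem_orthogonal] at hy
    have h0 : ∀ x : A.domain, inner ℂ (z • (x : H) - A x) y = 0 := fun x =>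
      hy _ ⟨⟨_, LinearPMap.mem_graph A x⟩, rfl⟩
    have h1 : ∀ x : A.domain, inner ℂ ((starRingEnd ℂ) z • y) (x : H) = inner ℂ y (A x) := by
      intro x
      have := h0 x
      rw [inner_sub_left, inner_smul_left, sub_eq_zero] at this
      have h2 := congrArg (starRingEnd ℂ) this
      rw [map_mul, inner_conj_symm, inner_conj_symm, Complex.conj_conj] at h2
      rw [inner_smul_left, Complex.conj_conj, h2]
    have hyd : y ∈ (LinearPMap.adjoint A).domain :=
      LinearPMap.mem_adjoint_domain_of_exists y ⟨_, h1⟩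
    have hya := LinearPMap.adjoint_apply_eq hd ⟨y, hyd⟩ h1
    have hyd' : y ∈ A.domain := by
      rw [LinearPMap.isSelfAdjoint_def.1 hA] at hyd; exact hyd
    have hAy : A ⟨y, hyd'⟩ = -z • y := by
      have : (y, (starRingEnd ℂ) z • y) ∈ (LinearPMap.adjoint A).graph := by
        rw [← hya]; exact LinearPMap.mem_graph _ (⟨y, hyd⟩ : (LinearPMap.adjoint A).domain)
      rw [LinearPMap.isSelfAdjoint_def.1 hA, hzc] at this
      exact ((LinearPMap.image_iff hyd').2 this).symm
    have h3 := hsym ⟨y, hyd'⟩ ⟨y, hyd'⟩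
    rw [hAy, inner_smul_left, inner_smul_right, map_neg, hzc] at h3
    have hz0 : z ≠ 0 := by rintro rfl; simp at hzz
    have h4 : (2 * z) * inner ℂ y y = 0 := by linear_combination h3
    rcases mul_eq_zero.1 h4 with h | h
    · exact absurd h (mul_ne_zero two_ne_zero hz0)
    · exact inner_self_eq_zero.1 h
  let e := ContinuousLinearEquiv.ofBijective φ hinj hsurj
  have he : ∀ p, e p = φ p := fun p => rfl
  refine ⟨(ContinuousLinearMap.fst ℂ H H).comp
    (A.graph.subtypeL.comp (e.symm : H →L[ℂ] A.graph)), ?_, ?_⟩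
  · intro x
    have hp := (e.symm x).2
    obtain ⟨w, hw, hw'⟩ := (LinearPMap.mem_graph_iff _).1 hp
    have hwd : ((e.symm x : A.graph) : H × H).1 ∈ A.domain := by rw [← hw]; exact w.2
    refine ⟨hwd, ?_⟩
    have : φ (e.symm x) = x := by rw [← he]; simp
    rw [hφ] at this
    have h5 : A ⟨((e.symm x : A.graph) : H × H).1, hwd⟩ = ((e.symm x : A.graph) : H × H).2 := by
      rw [← hw']; congr 1; exact Subtype.ext hw.symm
    change z • ((e.symm x : A.graph) : H × H).1 - A ⟨((e.symm x : A.graph) : H × H).1, hwd⟩ = x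
    rw [h5, this]
  · intro x
    have : e ⟨_, LinearPMap.mem_graph A x⟩ = z • (x : H) - A x := rfl
    change ((e.symm (z • (x : H) - A x) : A.graph) : H × H).1 = x
    rw [← this]; simp

section Spec

variable {A : H →ₗ.[ℂ] H}

lemma resolventOp_spec {z : ℂ} (h : ∃ R, IsResolventAt A z R) :
    IsResolventAt A z (resolventOp A z) := by
  rw [resolventOp, dif_pos h]
  exact h.choose_spec

lemma resolvent_basic (hA : IsSelfAdjoint A) :
    Commute (resolventOp A Complex.I) (star (resolventOp A Complex.I)) ∧
    star (resolventOp A Complex.I) - resolventOp A Complex.I =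
      (2 * Complex.I) • cutoff A := by
  have hd := hA.dense_domain
  have hsym : ∀ x y : A.domain, inner ℂ (A x) (y : H) = inner ℂ (x : H) (A y) := by
    have := LinearPMap.adjoint_isFormalAdjoint hd (T := A)
    rw [LinearPMap.isSelfAdjoint_def.1 hA] at this
    exact this
  obtain ⟨S, hS⟩ := exists_resolventAt hA (z := -Complex.I) (Or.inr rfl)
  have hR := resolventOp_spec (exists_resolventAt hA (z := Complex.I) (Or.inl rfl))
  set R := resolventOp A Complex.I with hRdef
  have hstar : star R = S := by
    rw [ContinuousLinearMap.star_eq_adjoint, eq_comm, ContinuousLinearMap.eq_adjoint_iff]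
    intro v u
    obtain ⟨hx, hxe⟩ := hR.1 u
    obtain ⟨hy, hye⟩ := hS.1 v
    have h := hsym ⟨S v, hy⟩ ⟨R u, hx⟩
    have e1 : A ⟨R u, hx⟩ = Complex.I • R u - u := eq_sub_of_add_eq' (sub_eq_iff_eq_add.1 hxe).symm
    have e2 : A ⟨S v, hy⟩ = -Complex.I • S v - v := eq_sub_of_add_eq' (sub_eq_iff_eq_add.1 hye).symm
    rw [e1, e2, inner_sub_left, inner_sub_right, inner_smul_left, inner_smul_right] at h
    simp only [map_neg, Complex.conj_I, neg_neg] at h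
    linear_combination h
  have res1 : ∀ u, S u = R u + (2 * Complex.I) • R (S u) := by
    intro u
    obtain ⟨hy, hye⟩ := hS.1 u
    have := hR.2 ⟨S u, hy⟩
    have e : Complex.I • S u - A ⟨S u, hy⟩ = u + (2 * Complex.I) • S u := by
      nth_rewrite 3 [← hye]; module
    simp only at this
    rw [e, map_add, map_smul] at this
    exact this.symm
  have res2 : ∀ u, S u = R u + (2 * Complex.I) • S (R u) := by
    intro u
    obtain ⟨hy, hye⟩ := hR.1 u
    have := hS.2 ⟨R u, hy⟩
    have e : -Complex.I • R u - A ⟨R u, hy⟩ = u - (2 * Complex.I) • R u := by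
      nth_rewrite 3 [← hye]; module
    simp only at this
    rw [e, map_sub, map_smul] at this
    exact sub_eq_iff_eq_add.1 this
  have hcomm : ∀ u, R (S u) = S (R u) := by
    intro u
    have h := (res1 u).symm.trans (res2 u)
    have h2 := add_left_cancel h
    exact smul_right_injective H (mul_ne_zero two_ne_zero Complex.I_ne_zero) h2
  rw [cutoff, ← hRdef, hstar]
  refine ⟨ContinuousLinearMap.ext hcomm, ContinuousLinearMap.ext fun u => ?_⟩
  change S u - R u = (2 * Complex.I) • S (R u)
  nth_rewrite 1 [res2 u]; abel

lemma starProjection_closure_commute {T X : H →L[ℂ] H} (hX : IsSelfAdjoint X)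
    (h : Commute X T) :
    Commute X (LinearMap.range T.toLinearMap).topologicalClosure.starProjection := by
  set M := (LinearMap.range T.toLinearMap).topologicalClosure
  set P := M.starProjection
  have hPs : star P = P := isSelfAdjoint_starProjection M
  have hinv : ∀ v ∈ M, X v ∈ M := by
    intro v hv
    have hmaps : MapsTo X (LinearMap.range T.toLinearMap : Set H)
        (LinearMap.range T.toLinearMap : Set H) := by
      rintro _ ⟨u, rfl⟩
      exact ⟨X u, (congrArg (fun Y : H →L[ℂ] H => Y u) h.eq).symm⟩
    exact hmaps.closure X.continuous hv
  have h1 : P * (X * P) = X * P := by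
    ext v
    exact Submodule.starProjection_eq_self_iff.2 (hinv _ (Submodule.starProjection_apply_mem M v))
  have h2 := congrArg star h1
  rw [star_mul, star_mul, hPs, hX.star_eq] at h2
  rw [mul_assoc] at h2
  exact (h1.symm.trans h2)

lemma cutoff_facts (hA : IsSelfAdjoint A) :
    0 ≤ cutoff A ∧ 0 ≤ 1 - cutoff A ∧ Function.Injective (cutoff A) ∧
    IsSelfAdjoint (damped A) ∧ Commute (cutoff A) (damped A) ∧
    resolventOp A Complex.I = -damped A - Complex.I • cutoff A ∧
    damped A * damped A = cutoff A * (1 - cutoff A) := by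
  obtain ⟨hn, hd⟩ := resolvent_basic hA
  have hR := resolventOp_spec (exists_resolventAt hA (z := Complex.I) (Or.inl rfl))
  have hG : damped A =
    -((2 : ℂ)⁻¹ • (resolventOp A Complex.I + star (resolventOp A Complex.I))) := rfl
  have hB : cutoff A = star (resolventOp A Complex.I) * resolventOp A Complex.I := rfl
  have hRG : resolventOp A Complex.I = -damped A - Complex.I • cutoff A := by
    have : Complex.I • cutoff A = (2 : ℂ)⁻¹ •
        (star (resolventOp A Complex.I) - resolventOp A Complex.I) := by
      rw [hd, smul_smul]; congr 1; ring
    rw [this, hG]; module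
  have hc1 : Commute (cutoff A) (resolventOp A Complex.I) := by
    rw [hB]; exact (hn.symm).mul_left (Commute.refl _)
  have hc2 : Commute (cutoff A) (star (resolventOp A Complex.I)) := by
    rw [hB]; exact (Commute.refl _).mul_left hn
  have hcBG : Commute (cutoff A) (damped A) := by
    rw [hG]; exact ((hc1.add_right hc2).smul_right _).neg_right
  have hBs : star (cutoff A) = cutoff A := by rw [hB, star_mul, star_star]
  have hGs : star (damped A) = damped A := by
    rw [hG, star_neg, star_smul, star_add, star_star]
    simp [add_comm]
  refine ⟨hB ▸ star_mul_self_nonneg _, ?_, ?_, hGs, hcBG, hRG, ?_⟩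
  · have : 1 - cutoff A = star (Complex.I • resolventOp A Complex.I - 1) *
        (Complex.I • resolventOp A Complex.I - 1) := by
      have h2 : star (resolventOp A Complex.I) =
        resolventOp A Complex.I + (2 * Complex.I) • cutoff A := by rw [← hd]; abel
      rw [star_sub, star_smul, star_one, sub_mul, mul_sub, smul_mul_smul_comm, ← hB]
      simp only [mul_one, one_mul]
      rw [h2]
      simp only [Complex.star_def, Complex.conj_I, smul_add, smul_smul]
      have e1 : -Complex.I * Complex.I = 1 := by simp
      have e2 : -Complex.I * (2 * Complex.I) = 2 := by linear_combination 2 * e1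
      rw [e1, e2]; module
    rw [this]; exact star_mul_self_nonneg _
  · have hinjR : ∀ u, resolventOp A Complex.I u = 0 → u = 0 := by
      intro u hu
      obtain ⟨hx, hxe⟩ := hR.1 u
      have : (⟨resolventOp A Complex.I u, hx⟩ : A.domain) = 0 := Subtype.ext hu
      rw [this, hu] at hxe
      simpa using hxe.symm
    rw [injective_iff_map_eq_zero]
    intro u hu
    apply hinjR
    rw [← inner_self_eq_zero (𝕜 := ℂ)]
    have : inner ℂ (resolventOp A Complex.I u) (resolventOp A Complex.I u) =
        inner ℂ (cutoff A u) u := by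
      rw [hB]
      change _ = inner ℂ (star (resolventOp A Complex.I) (resolventOp A Complex.I u)) u
      rw [ContinuousLinearMap.star_eq_adjoint, ContinuousLinearMap.adjoint_inner_left]
    rw [this, hu, inner_zero_left]
  · have hsR : star (resolventOp A Complex.I) = -damped A + Complex.I • cutoff A := by
      conv_lhs => rw [hRG]
      rw [star_sub, star_neg, star_smul, hGs, hBs]
      simp
    have := hB
    rw [hsR, hRG] at this
    simp only [add_mul, mul_sub, neg_mul, mul_neg, smul_mul_assoc, mul_smul_comm,
      hcBG.eq] at this
    simp only [smul_add, smul_neg, smul_smul, Complex.I_mul_I] at this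
    rw [mul_sub, mul_one]
    conv_rhs => enter [1]; rw [this]
    module

/-- The pair `(|A|, U_A)` is the polar decomposition of `A`, and `|A|^(1/2)` is the nonnegative
self-adjoint square root of `|A|`. -/
theorem polar_spec (hA : IsSelfAdjoint A) :
    (IsSelfAdjoint (absOp A) ∧
      ∀ x : (absOp A).domain, 0 ≤ RCLike.re (inner ℂ (absOp A x) (x : H))) ∧
    (IsSelfAdjoint (absSqrt A) ∧
      ∀ x : (absSqrt A).domain, 0 ≤ RCLike.re (inner ℂ (absSqrt A x) (x : H))) ∧
    (∀ x y : H, (x, y) ∈ (absOp A).graph ↔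
      ∃ v, (x, v) ∈ (absSqrt A).graph ∧ (v, y) ∈ (absSqrt A).graph) ∧
    (∀ x y : H, (x, y) ∈ A.graph ↔ ∃ v, (x, v) ∈ (absOp A).graph ∧ polarFactor A v = y) ∧
    IsSelfAdjoint (polarFactor A) ∧
    (∀ x : (absOp A).domain, ‖polarFactor A (absOp A x)‖ = ‖absOp A x‖) ∧
    (∀ y : H, (∀ x : (absOp A).domain, inner ℂ (absOp A x) y = 0) → polarFactor A y = 0) := by
  obtain ⟨hB0, h1B0, hBinj, hGs, hBG, hRG, hGG⟩ := cutoff_facts hA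
  have hR := resolventOp_spec (exists_resolventAt hA (z := Complex.I) (Or.inl rfl))
  rw [absOp, absSqrt]
  set B := cutoff A with hBdef
  set G := damped A with hGdef
  set K2 := CFC.sqrt B with hK2
  set C2 := CFC.sqrt (1 - B) with hC2
  set K := CFC.sqrt K2 with hK
  set C := CFC.sqrt C2 with hC
  have hK20 : 0 ≤ K2 := CFC.sqrt_nonneg _
  have hC20 : 0 ≤ C2 := CFC.sqrt_nonneg _
  have hK0 : 0 ≤ K := CFC.sqrt_nonneg _
  have hC0 : 0 ≤ C := CFC.sqrt_nonneg _
  have hK2s := IsSelfAdjoint.of_nonneg hK20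
  have hC2s := IsSelfAdjoint.of_nonneg hC20
  have hKs := IsSelfAdjoint.of_nonneg hK0
  have hCs := IsSelfAdjoint.of_nonneg hC0
  have eB : K2 * K2 = B := CFC.sqrt_mul_sqrt_self B hB0
  have e1B : C2 * C2 = 1 - B := CFC.sqrt_mul_sqrt_self _ h1B0
  have eK : K * K = K2 := CFC.sqrt_mul_sqrt_self _ hK20
  have eC : C * C = C2 := CFC.sqrt_mul_sqrt_self _ hC20
  have csq : ∀ {X Y : H →L[ℂ] H}, Commute X Y → Commute (CFC.sqrt X) Y :=
    fun h => h.cfcₙ_nnreal _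
  have hK2G : Commute K2 G := csq hBG
  have hC2G : Commute C2 G := csq ((Commute.one_left G).sub_left hBG)
  have hBB : Commute B (1 - B) := (Commute.one_right B).sub_right (Commute.refl B)
  have hK2C2 : Commute K2 C2 := csq (csq hBB.symm).symm
  have hKC : Commute K C := csq (csq hK2C2.symm).symm
  have hK2C : Commute K2 C := (csq hK2C2.symm).symm
  have hKC2 : Commute K C2 := csq hK2C2
  have inj_of : ∀ {X Y : H →L[ℂ] H}, X * X = Y → Function.Injective Y → Function.Injective X := by
    intro X Y h hY a b hab
    apply hY
    rw [← h]
    exact congrArg X hab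
  have hK2i := inj_of eB hBinj
  have hKi := inj_of eK hK2i
  have hsum : C2 * C2 + K2 * K2 = 1 := by rw [eB, e1B]; abel
  have hsum2 : C2 ^ (1 + 1) + K2 ^ (1 + 1) = 1 := by rw [pow_succ, pow_one, pow_succ, pow_one, hsum]
  have hsum4 : C ^ (3 + 1) + K ^ (3 + 1) = 1 := by
    have h1 : C ^ (3 + 1) = C2 * C2 := by rw [← eC]; noncomm_ring
    have h2 : K ^ (3 + 1) = K2 * K2 := by rw [← eK]; noncomm_ring
    rw [h1, h2, hsum]
  -- the polar factor
  have hU : polarFactor A = (LinearMap.range (G⁺ : H →L[ℂ] H).toLinearMap).topologicalClosure.starProjection -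
    (LinearMap.range (G⁻ : H →L[ℂ] H).toLinearMap).topologicalClosure.starProjection := rfl
  set P := (LinearMap.range (G⁺ : H →L[ℂ] H).toLinearMap).topologicalClosure.starProjection with hP
  set N := (LinearMap.range (G⁻ : H →L[ℂ] H).toLinearMap).topologicalClosure.starProjection with hN
  have hPs : IsSelfAdjoint P := isSelfAdjoint_starProjection _
  have hNs : IsSelfAdjoint N := isSelfAdjoint_starProjection _
  have hGp0 : 0 ≤ G⁺ := CFC.posPart_nonneg G
  have hGn0 : 0 ≤ G⁻ := CFC.negPart_nonneg G
  have proj_self : ∀ X : H →L[ℂ] H,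
      (LinearMap.range X.toLinearMap).topologicalClosure.starProjection * X = X := by
    intro X
    ext v
    exact Submodule.starProjection_eq_self_iff.2 (Submodule.le_topologicalClosure _ ⟨v, rfl⟩)
  have proj_zero : ∀ (X : H →L[ℂ] H), IsSelfAdjoint X → ∀ y : H, X y = 0 →
      (LinearMap.range X.toLinearMap).topologicalClosure.starProjection y = 0 := by
    intro X hX y hy
    rw [Submodule.starProjection_apply_eq_zero_iff, Submodule.orthogonal_closure,
      Submodule.mem_orthogonal]
    rintro _ ⟨u, rfl⟩
    have := hX.isSymmetric u y
    exact this.trans (by rw [ContinuousLinearMap.coe_coe, hy, inner_zero_right])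
  have hPGp : P * G⁺ = G⁺ := proj_self _
  have hNGn : N * G⁻ = G⁻ := proj_self _
  have hPGn : P * G⁻ = 0 := by
    ext v
    exact proj_zero _ (IsSelfAdjoint.of_nonneg hGp0) _
      (congrArg (fun T : H →L[ℂ] H => T v) (CFC.posPart_mul_negPart G))
  have hNGp : N * G⁺ = 0 := by
    ext v
    exact proj_zero _ (IsSelfAdjoint.of_nonneg hGn0) _
      (congrArg (fun T : H →L[ℂ] H => T v) (CFC.negPart_mul_posPart G))
  have hGpm : G⁺ - G⁻ = G := CFC.posPart_sub_negPart G hGs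
  have habs : G⁺ + G⁻ = K2 * C2 := by
    have h1 : CFC.abs G = G⁺ + G⁻ := (CFC.posPart_add_negPart G hGs).symm
    rw [← h1]
    have h2 : 0 ≤ K2 * C2 := hK2C2.mul_nonneg hK20 hC20
    refine CFC.sqrt_unique ?_ h2
    rw [hGs.star_eq, hGG, ← e1B, ← eB]
    calc K2 * C2 * (K2 * C2) = K2 * (C2 * K2) * C2 := by noncomm_ring
      _ = K2 * (K2 * C2) * C2 := by rw [hK2C2.eq]
      _ = _ := by noncomm_ring
  set U := polarFactor A with hUdef
  have hUs : IsSelfAdjoint U := by rw [hU]; exact hPs.sub hNs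
  have hUabs : U * (K2 * C2) = G := by
    refine Eq.trans ?_ hGpm
    rw [← habs, hU, sub_mul, mul_add, mul_add, hPGp, hNGn, hPGn, hNGp]; abel
  have hUG : U * G = K2 * C2 := by
    rw [← habs]
    conv_lhs => rw [← hGpm]
    rw [hU, sub_mul, mul_sub, mul_sub, hPGp, hNGn, hPGn, hNGp]; abel
  have commU : ∀ X : H →L[ℂ] H, IsSelfAdjoint X → Commute X G → Commute X U := by
    intro X hX h
    have hp : Commute X G⁺ := (h.symm.cfcₙ_real _).symm
    have hn : Commute X G⁻ := (h.symm.cfcₙ_real _).symm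
    rw [hU]
    exact (starProjection_closure_commute hX hp).sub_right (starProjection_closure_commute hX hn)
  have hK2U := commU K2 hK2s hK2G
  have hC2U := commU C2 hC2s hC2G
  have hUUC : U * U * C2 = C2 := by
    have h1 : K2 * (U * U * C2) = K2 * C2 := by
      calc K2 * (U * U * C2) = (K2 * U) * (U * C2) := by noncomm_ring
        _ = (U * K2) * (U * C2) := by rw [hK2U.eq]
        _ = U * (K2 * U) * C2 := by noncomm_ring
        _ = U * (U * K2) * C2 := by rw [hK2U.eq]
        _ = U * (U * (K2 * C2)) := by noncomm_ring
        _ = _ := by rw [hUabs, hUG]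
    ext v
    exact hK2i (congrArg (fun T : H →L[ℂ] H => T v) h1)
  have hRK : resolventOp A Complex.I = K2 * (-(C2 * U) - Complex.I • K2) := by
    have hG' : G = K2 * (C2 * U) := by
      rw [← hUabs, ← mul_assoc, ← hK2U.eq, mul_assoc, ← hC2U.eq]
    rw [hRG, ← eB, mul_sub, mul_neg, mul_smul_comm, ← hG']
  have hKR : K2 = resolventOp A Complex.I * (Complex.I • K2 - U * C2) := by
    rw [hRK, mul_assoc]
    have : (-(C2 * U) - Complex.I • K2) * (Complex.I • K2 - U * C2) = 1 := by
      have t1 : C2 * U * K2 = K2 * (U * C2) := by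
        rw [mul_assoc, ← hK2U.eq, ← mul_assoc, ← hK2C2.eq, mul_assoc, hC2U.eq]
      have t2 : C2 * U * (U * C2) = C2 * C2 := by
        rw [mul_assoc, ← mul_assoc U U C2, hUUC]
      rw [sub_mul, mul_sub, mul_sub, neg_mul, neg_mul, mul_smul_comm, smul_mul_smul_comm,
        smul_mul_assoc, t1, t2, Complex.I_mul_I, ← hsum]
      module
    rw [this, mul_one]
  have gabs : ∀ x y : H, (x, y) ∈ (quotOp C2 K2).graph ↔ ∃ u, K2 u = x ∧ C2 u = y :=
    fun _ _ => mem_graph_quotOp hK2i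
  have gsq : ∀ x y : H, (x, y) ∈ (quotOp C K).graph ↔ ∃ u, K u = x ∧ C u = y :=
    fun _ _ => mem_graph_quotOp hKi
  have gA : ∀ x y : H, (x, y) ∈ A.graph ↔
      ∃ u, resolventOp A Complex.I u = x ∧ Complex.I • x - u = y := by
    intro x y
    constructor
    · intro h
      obtain ⟨w, rfl, rfl⟩ := (LinearPMap.mem_graph_iff _).1 h
      exact ⟨_, hR.2 w, by abel⟩
    · rintro ⟨u, rfl, rfl⟩
      obtain ⟨hx, hxe⟩ := hR.1 u
      have h2 := eq_sub_of_add_eq' (sub_eq_iff_eq_add.1 hxe).symm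
      rw [← h2]
      exact LinearPMap.mem_graph A ⟨_, hx⟩
  have hAK : ∀ w, (Complex.I • K2 w - (Complex.I • K2 - U * C2) w) = U (C2 w) := by
    intro w
    change Complex.I • K2 w - (Complex.I • K2 w - U (C2 w)) = U (C2 w)
    abel
  refine ⟨⟨quotOp_isSelfAdjoint hK2i hC2s hK2s hK2C2.symm 1 hsum2,
      quotOp_nonneg hK2i hC20 hK20 hK2C2.symm⟩,
    ⟨quotOp_isSelfAdjoint hKi hCs hKs hKC.symm 3 hsum4, quotOp_nonneg hKi hC0 hK0 hKC.symm⟩,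
    ?_, ?_, hUs, ?_, ?_⟩
  · intro x y
    rw [gabs]
    constructor
    · rintro ⟨u, rfl, rfl⟩
      refine ⟨C (K u), (gsq _ _).2 ⟨K u, ?_, rfl⟩, (gsq _ _).2 ⟨C u, ?_, ?_⟩⟩
      · rw [← eK]; rfl
      · exact congrArg (fun T : H →L[ℂ] H => T u) hKC.eq
      · rw [← eC]; rfl
    · rintro ⟨v, h1, h2⟩
      obtain ⟨a, rfl, rfl⟩ := (gsq _ _).1 h1
      obtain ⟨b, hb, rfl⟩ := (gsq _ _).1 h2
      have ha : a = K (C2 (C b) + K (K2 a)) := by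
        have e := congrArg (fun T : H →L[ℂ] H => T a) hsum
        change C2 (C2 a) + K2 (K2 a) = a at e
        have e1 : C2 a = K (C b) := by
          rw [← eC]
          change C (C a) = _
          rw [← hb]
          exact (congrArg (fun T : H →L[ℂ] H => T b) hKC.eq).symm
        have e2 : C2 (K (C b)) = K (C2 (C b)) :=
          (congrArg (fun T : H →L[ℂ] H => T (C b)) hKC2.eq).symm
        have e3 : K2 (K2 a) = K (K (K2 a)) := 
          (congrArg (fun T : H →L[ℂ] H => T (K2 a)) eK).symm
        rw [e1, e2, e3, ← map_add] at e
        exact e.symm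
      refine ⟨C2 (C b) + K (K2 a), ?_, ?_⟩
      · conv_rhs => rw [ha]
        rw [← eK]; rfl
      · have h3 : K (C2 (C2 (C b) + K (K2 a))) = K (C b) := by
          have e2 : ∀ z, K (C2 z) = C2 (K z) := fun z =>
            congrArg (fun T : H →L[ℂ] H => T z) hKC2.eq
          rw [e2, ← ha, ← eC]
          change C (C a) = _
          rw [← hb]
          exact (congrArg (fun T : H →L[ℂ] H => T b) hKC.eq).symm
        exact hKi h3
  · intro x y
    rw [gA]
    constructor
    · rintro ⟨u, hu, hy⟩
      refine ⟨C2 ((-(C2 * U) - Complex.I • K2) u),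
        (gabs _ _).2 ⟨(-(C2 * U) - Complex.I • K2) u, ?_, rfl⟩, ?_⟩
      · rw [← hu, hRK]; rfl
      · set w := (-(C2 * U) - Complex.I • K2) u with hw
        have hx : K2 w = x := by rw [← hu, hRK]; rfl
        have h4 : resolventOp A Complex.I ((Complex.I • K2 - U * C2) w) = K2 w :=
          (congrArg (fun T : H →L[ℂ] H => T w) hKR).symm
        have hinj : (Complex.I • K2 - U * C2) w = u := by
          have hs : ∀ a, resolventOp A Complex.I a = 0 → a = 0 := by
            intro a ha
            apply hBinj
            rw [map_zero]
            change star (resolventOp A Complex.I) (resolventOp A Complex.I a) = 0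
            rw [ha, map_zero]
          rw [← sub_eq_zero]
          apply hs
          rw [map_sub, h4, hx, hu, sub_self]
        rw [← hAK, hinj, hx, hy]
    · rintro ⟨v, hv, rfl⟩
      obtain ⟨w, rfl, rfl⟩ := (gabs _ _).1 hv
      exact ⟨(Complex.I • K2 - U * C2) w,
        (congrArg (fun T : H →L[ℂ] H => T w) hKR).symm, hAK w⟩
  · intro x
    obtain ⟨u, -, hu⟩ := (gabs _ _).1 (LinearPMap.mem_graph (quotOp C2 K2) x)
    rw [← hu]
    have h5 : inner ℂ (U (C2 u)) (U (C2 u)) = inner ℂ (C2 u) (C2 u) := by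
      have := hUs.isSymmetric (U (C2 u)) (C2 u)
      refine this.symm.trans ?_
      have h6 := congrArg (fun T : H →L[ℂ] H => T u) hUUC
      change U (U (C2 u)) = C2 u at h6
      rw [ContinuousLinearMap.coe_coe, h6]
    rw [← sq_eq_sq₀ (norm_nonneg _) (norm_nonneg _)]
    have := congrArg RCLike.re h5
    rwa [inner_self_eq_norm_sq, inner_self_eq_norm_sq] at this
  · intro y hy
    have hCy : C2 y = 0 := by
      apply ext_inner_left ℂ
      intro u
      have h7 := LinearPMap.mem_domain_of_mem_graph ((gabs _ _).2 ⟨u, rfl, rfl⟩)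
      have h8 := hy ⟨_, h7⟩
      rw [((LinearPMap.image_iff h7).2 ((gabs _ _).2 ⟨u, rfl, rfl⟩)).symm] at h8
      rw [inner_zero_right, ← h8]
      exact (hC2s.isSymmetric u y).symm
    have hs0 : (G⁺ + G⁻) y = 0 := by
      rw [habs]; change K2 (C2 y) = 0; rw [hCy, map_zero]
    have hp0 : ∀ X Y : H →L[ℂ] H, IsSelfAdjoint X → X * Y = 0 → (X + Y) y = 0 → X y = 0 := by
      intro X Y hX hXY h
      have h9 : X (X y) = 0 := by
        have := congrArg X h
        rw [map_zero] at this
        change X (X y + Y y) = 0 at this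
        rw [map_add] at this
        have h10 := congrArg (fun T : H →L[ℂ] H => T y) hXY
        change X (Y y) = 0 at h10
        rwa [h10, add_zero] at this
      rw [← inner_self_eq_zero (𝕜 := ℂ)]
      refine (hX.isSymmetric y (X y)).trans ?_
      rw [ContinuousLinearMap.coe_coe, h9, inner_zero_right]
    have hGp := hp0 _ _ (IsSelfAdjoint.of_nonneg hGp0) (CFC.posPart_mul_negPart G) hs0
    have hGn := hp0 _ _ (IsSelfAdjoint.of_nonneg hGn0) (CFC.negPart_mul_posPart G)
      (by rw [add_comm]; exact hs0)
    rw [hU]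
    change P y - N y = 0
    rw [hP, hN, proj_zero _ (IsSelfAdjoint.of_nonneg hGp0) y hGp,
      proj_zero _ (IsSelfAdjoint.of_nonneg hGn0) y hGn, sub_zero]

end Spec

/-! ### Forms and Ritz values -/

/-- The symmetric form `a(x, y) = (U_A |A|^(1/2) x, |A|^(1/2) y)` associated to `A`, on
`dom a = dom |A|^(1/2)`.  (Mathlib's inner product is linear in its second argument.) -/
def assocForm (A : H →ₗ.[ℂ] H) (x y : (absSqrt A).domain) : ℂ :=
  inner ℂ (absSqrt A y) (polarFactor A (absSqrt A x))

/-- `L` is the operator `A_F` on `F ⊆ dom a` defined by `(A_F x, y) = a(x, y)` on `F`. -/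
def IsRitzOp (A : H →ₗ.[ℂ] H) (F : Submodule ℂ H) (L : F →L[ℂ] F) : Prop :=
  ∀ x y : F, ∃ (hx : (x : H) ∈ (absSqrt A).domain) (hy : (y : H) ∈ (absSqrt A).domain),
    inner ℂ (y : H) (L x : H) = assocForm A ⟨x, hx⟩ ⟨y, hy⟩

/-- `A_F` exists and is unique for every finite-dimensional `F ⊆ dom a`. -/
theorem existsUnique_isRitzOp (A : H →ₗ.[ℂ] H) (F : Submodule ℂ H) [FiniteDimensional ℂ F]
    (hF : F ≤ (absSqrt A).domain) : ∃! L : F →L[ℂ] F, IsRitzOp A F L := by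
  let ι : F →ₗ[ℂ] H := (absSqrt A).toFun ∘ₗ Submodule.inclusion hF
  let ιc : F →L[ℂ] H := LinearMap.toContinuousLinearMap ι
  refine ⟨ContinuousLinearMap.adjoint ιc ∘L (polarFactor A ∘L ιc), ?_, ?_⟩
  · intro x y
    refine ⟨hF x.2, hF y.2, ?_⟩
    exact ContinuousLinearMap.adjoint_inner_right ιc y (polarFactor A (ιc x))
  · intro L hL
    ext1 x
    apply ext_inner_left ℂ
    intro y
    obtain ⟨hx, hy, h⟩ := hL x y
    refine Eq.trans h ?_
    exact (ContinuousLinearMap.adjoint_inner_right ιc y (polarFactor A (ιc x))).symm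

open Classical in
/-- The operator `A_F : F → F` (used for finite-dimensional `F ⊆ dom a` only). -/
def ritzOp (A : H →ₗ.[ℂ] H) (F : Submodule ℂ H) : F →L[ℂ] F :=
  if h : ∃ L, IsRitzOp A F L then h.choose else 0

/-- The set `Σ(A_F)` of Ritz values of `A` on `F`. -/
def ritzValues (A : H →ₗ.[ℂ] H) (F : Submodule ℂ H) : Set ℝ :=
  {lam | (lam : ℂ) ∈ spectrum ℂ (ritzOp A F)}

/-- The supremum of `‖|A|^(1/2) e‖ / ‖e‖` over nonzero `e ∈ F`. -/
def maxRatio (A : H →ₗ.[ℂ] H) (F : Submodule ℂ H) : ℝ :=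
  sSup {r | ∃ e ∈ F, e ≠ 0 ∧ ∃ he : e ∈ (absSqrt A).domain, r = ‖absSqrt A ⟨e, he⟩‖ / ‖e‖}

end Polar

/-- The gap between two subspaces of a normed space. -/
def gap {X : Type*} [NormedAddCommGroup X] [NormedSpace ℂ X] (M L : Submodule ℂ X) : ℝ :=
  max (sSup ((fun m => Metric.infDist m (L : Set X)) '' {m | m ∈ M ∧ ‖m‖ = 1}))
    (sSup ((fun l => Metric.infDist l (M : Set X)) '' {l | l ∈ L ∧ ‖l‖ = 1}))

/-! ### The rational filter -/

/-- `r_N(ξ) = w_N + ∑ w_k (z_k - ξ)⁻¹`. -/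
def ratFilter {N : ℕ} (wN : ℂ) (w z : Fin N → ℂ) (ξ : ℂ) : ℂ :=
  wN + ∑ k, w k * (z k - ξ)⁻¹

/-- `sup |r_N|` over a set of reals. The finitely many nodes, at which Lean's `0⁻¹ = 0` would
enter, are left out; at a genuine pole the supremum over the neighbouring points is infinite. -/
def filterSup {N : ℕ} (wN : ℂ) (w z : Fin N → ℂ) (s : Set ℝ) : ℝ≥0∞ :=
  ⨆ x ∈ {x ∈ s | ∀ k, z k ≠ (x : ℂ)}, ‖ratFilter wN w z (x : ℂ)‖ₑ

/-- `inf |r_N|` over a set of reals, the nodes being left out again. -/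
def filterInf {N : ℕ} (wN : ℂ) (w z : Fin N → ℂ) (s : Set ℝ) : ℝ≥0∞ :=
  ⨅ x ∈ {x ∈ s | ∀ k, z k ≠ (x : ℂ)}, ‖ratFilter wN w z (x : ℂ)‖ₑ

/-- The interval `I_γ^y`. -/
def innerInterval (y γ : ℝ) : Set ℝ := {x | |x - y| ≤ γ}

/-- The set `O_{δ,γ}^y`. -/
def outerSet (y γ δ : ℝ) : Set ℝ := {x | (1 + δ) * γ ≤ |x - y|}

/-- The cluster `Lam` is separated from the rest of the spectrum, and the filter has contraction
factor `κ̂ < 1` (a quotient with nonzero denominator). -/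
structure FilterSeparates (A : H →ₗ.[ℂ] H) (Lam : Set ℝ) {N : ℕ} (wN : ℂ) (w z : Fin N → ℂ)
    (y γ δ : ℝ) : Prop where
  γ_pos : 0 < γ
  δ_pos : 0 < δ
  cluster : Lam ⊆ innerInterval y γ
  rest : ∀ x : ℝ, (x : ℂ) ∈ spec A → x ∉ Lam → x ∈ outerSet y γ δ
  node : ∀ k, z k ∉ closure (spec A)
  inf_pos : 0 < filterInf wN w z (innerInterval y γ)
  contraction : filterSup wN w z (outerSet y γ δ) / filterInf wN w z (innerInterval y γ) < 1

/-! ### Operators on the smaller space `V` and their discretization -/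

section Restrict

variable {V : Type*} [NormedAddCommGroup V] [InnerProductSpace ℂ V]

/-- `T` maps `V`, embedded into `H` by `ι`, to itself, and it is bounded in the norm of `V`. -/
def IsBoundedOn (ι : V →L[ℂ] H) (T : H →ₗ[ℂ] H) : Prop :=
  ∃ L : V →L[ℂ] V, ∀ v, ι (L v) = T (ι v)

open Classical in
/-- `T` viewed as a bounded operator on `V`. -/
def onV (ι : V →L[ℂ] H) (T : H →ₗ[ℂ] H) : V →L[ℂ] V :=
  if h : IsBoundedOn ι T then h.choose else 0

/-- The filter `S_N = w_N + ∑ w_k R(z_k)` as an operator on `V`. -/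
def filterOp (ι : V →L[ℂ] H) (A : H →ₗ.[ℂ] H) {N : ℕ} (wN : ℂ) (w z : Fin N → ℂ) : V →L[ℂ] V :=
  wN • 1 + ∑ k, w k • onV ι (resolventOp A (z k)).toLinearMap

/-- The filter `S_N^h = w_N + ∑ w_k R_h(z_k)` as an operator on `V`, where `Rh` stands for the
family `z ↦ R_h(z)`. -/
def discFilterOp (ι : V →L[ℂ] H) (Rh : ℂ → H →ₗ[ℂ] V) {N : ℕ} (wN : ℂ) (w z : Fin N → ℂ) :
    V →L[ℂ] V :=
  wN • 1 + ∑ k, w k • onV ι (ι.toLinearMap ∘ₗ Rh (z k))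

end Restrict

/-! ### Contours and spectral projectors -/

/-- `(2πi)⁻¹ ∮_Θ f(z) dz` for a curve `Θ : [0,1] → ℂ`. -/
def contourMean {X : Type*} [NormedAddCommGroup X] [NormedSpace ℂ X] (Θ : ℝ → ℂ) (f : ℂ → X) : X :=
  (2 * Real.pi * Complex.I)⁻¹ • ∫ t in (0 : ℝ)..1, deriv Θ t • f (Θ t)

/-- `Θ` is a simple closed rectifiable curve, parametrized over `[0,1]` with bounded speed. -/
structure IsSimpleContour (Θ : ℝ → ℂ) : Prop where
  closed : Θ 0 = Θ 1
  simple : InjOn Θ (Ico 0 1)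
  rectifiable : ∃ K, LipschitzOnWith K Θ (Icc 0 1)

/-- `Θ` has winding number `n` around `c`, which does not lie on `Θ`. -/
def HasWinding (Θ : ℝ → ℂ) (c : ℂ) (n : ℂ) : Prop :=
  (∀ t ∈ Icc (0 : ℝ) 1, Θ t ≠ c) ∧ contourMean Θ (fun z => (z - c)⁻¹) = n

/-- `Θ` is positively oriented, encloses the part `M` of the spectrum of `S` and no other point of
it, and lies strictly outside the circle around `0` whose radius is the maximal modulus of the
other points of the spectrum. -/
structure IsSeparatingContour {V : Type*} [NormedAddCommGroup V] [NormedSpace ℂ V]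
    (S : V →L[ℂ] V) (M : Set ℂ) (Θ : ℝ → ℂ) : Prop extends IsSimpleContour Θ where
  encloses : ∀ μ ∈ M, HasWinding Θ μ 1
  excludes : ∀ μ ∈ spectrum ℂ S \ M, HasWinding Θ μ 0
  outside : ∀ t ∈ Icc (0 : ℝ) 1, sSup (norm '' (spectrum ℂ S \ M)) < ‖Θ t‖

/-- The spectral projector `(2πi)⁻¹ ∮_Θ (z - S)⁻¹ dz`. -/
def spectralProjector {V : Type*} [NormedAddCommGroup V] [NormedSpace ℂ V]
    (S : V →L[ℂ] V) (Θ : ℝ → ℂ) : V →L[ℂ] V :=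
  contourMean Θ (fun z => resolvent S z)

end FilteredSubspace

end

noncomputable section

namespace FilteredSubspace

/-! ### Contour integrals along rectifiable closed curves -/

section Contour

open MeasureTheory

variable {Θ : ℝ → ℂ} {X Y : Type*} [NormedAddCommGroup X] [NormedSpace ℂ X]
  [NormedAddCommGroup Y] [NormedSpace ℂ Y]

/-! Write `S` for the exact filter on `V` and `Q` for the `V`-orthogonal projection onto `E`. The
geometry is this: `|A|^(1/2)` maps `V` isometrically into `H`, it commutes with every resolvent of
`A` (`absSqrt_resolventOp`), and on an eigenspace it is multiplication by `√|λ|`. Hence no `λ ∈ Λ`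
is zero, orthogonality to `E` means the same in `V` and in `H` (`mem_orthogonal_comap_iff`), the two
orthogonal projections onto `E` agree, and norm bounds for the filter pass from `H` to `V`.

Exact filter: on `E` it has the eigenvalues `r_N(λ)`; on the complement its norm is at most `sup_O
|r_N|`, which is smaller than every `|r_N(λ)|`, by the functional calculus of the normal operator
`R(i)` (`norm_hilbertFilter_apply_le`). So the spectrum on the complement misses `r_N(Λ)`. The curve
`Θ` lies outside a centred disc containing that spectrum and does not wind around it, and a finite
Neumann expansion with Gelfand's formula shows that the Riesz projector vanishes there. The spectral
projector of `S` is therefore `Q` (`spectralProjector_filterOp`).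

Discrete filter: Riesz projectors depend continuously on the operator, so `‖P_h - Q‖ < 1` for small
`h`. `P_h` is idempotent because `S_h - w_N` maps into the finite-dimensional `V_h`
(`spectralProjector_idempotent`). Two projections at distance less than one have ranges of equal
dimension and gap less than one (`range_projection_close`).

Ritz values: split `v ∈ E_h` as `Qv + r`. The form has no cross terms, so `a(v,v) - a(Qv,Qv) =
a(r,r)`, of modulus at most `(gap_V ‖v‖_V)²`; Pythagoras in `H` gives `‖v‖² - ‖Qv‖² ≤ gap_H² ‖v‖²`.
Both errors are quadratic in a gap, and `eigenvalues_near` turns closeness of quadratic forms into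
closeness of eigenvalues, with `C₀ = 1`. -/

lemma _root_.AbsolutelyContinuousOnInterval.comp_continuousLinearMap {f : ℝ → ℂ} {a b : ℝ}
    (hf : AbsolutelyContinuousOnInterval f a b) (L : ℂ →L[ℝ] ℝ) :
    AbsolutelyContinuousOnInterval (fun t => L (f t)) a b := by
  unfold AbsolutelyContinuousOnInterval at hf ⊢
  refine squeeze_zero (fun _ => Finset.sum_nonneg fun _ _ => dist_nonneg) (fun E => ?_)
    (by simpa using hf.const_mul ‖L‖)
  rw [Finset.mul_sum]
  gcongr with i hi
  exact L.lipschitz.dist_le_mul _ _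

/-- The real fundamental theorem is applied to the real and imaginary parts. Absolute continuity is
the right generality, since a rectifiable curve is differentiable only almost everywhere. -/
lemma integral_deriv_eq_sub_of_absolutelyContinuous {f : ℝ → ℂ} {a b : ℝ}
    (hf : AbsolutelyContinuousOnInterval f a b)
    (hfi : IntervalIntegrable (deriv f) volume a b) :
    ∫ t in a..b, deriv f t = f b - f a := by
  have hd := hf.boundedVariationOn.ae_differentiableAt_of_mem_uIcc
  have part : ∀ L : ℂ →L[ℝ] ℝ, ∫ t in a..b, L (deriv f t) = L (f b - f a) := by
    intro L
    have hL : AbsolutelyContinuousOnInterval (fun t => L (f t)) a b :=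
      hf.comp_continuousLinearMap L
    rw [map_sub, ← hL.integral_deriv_eq_sub]
    apply intervalIntegral.integral_congr_ae
    filter_upwards [hd] with t ht htm
    exact ((L.hasFDerivAt.comp_hasDerivAt t (ht (uIoc_subset_uIcc htm)).hasDerivAt).deriv).symm
  have e := fun L : ℂ →L[ℝ] ℝ => (L.intervalIntegral_comp_comm hfi).symm.trans (part L)
  exact Complex.ext (e Complex.reCLM) (e Complex.imCLM)

namespace IsSimpleContour

lemma continuousOn (hΘ : IsSimpleContour Θ) : ContinuousOn Θ (Icc 0 1) := by
  obtain ⟨K, hK⟩ := hΘ.rectifiable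
  exact hK.continuousOn

lemma isCompact_image (hΘ : IsSimpleContour Θ) : IsCompact (Θ '' Icc 0 1) :=
  isCompact_Icc.image_of_continuousOn hΘ.continuousOn

lemma exists_norm_deriv_le (hΘ : IsSimpleContour Θ) :
    ∃ K : ℝ, 0 ≤ K ∧ ∀ᵐ t, t ∈ uIoc (0 : ℝ) 1 → ‖deriv Θ t‖ ≤ K := by
  obtain ⟨K, hK⟩ := hΘ.rectifiable
  refine ⟨K, K.2, ?_⟩
  -- At the endpoint the two-sided derivative also sees values of `Θ` outside `[0,1]`, where no
  -- Lipschitz bound is assumed.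
  have h1 : ∀ᵐ t : ℝ, t ≠ 1 := by simp [ae_iff, measure_singleton]
  filter_upwards [h1] with t ht htm
  rw [uIoc_of_le zero_le_one] at htm
  exact norm_deriv_le_of_lipschitzOn (Icc_mem_nhds htm.1 (lt_of_le_of_ne htm.2 ht)) hK

lemma intervalIntegrable_deriv (hΘ : IsSimpleContour Θ) :
    IntervalIntegrable (deriv Θ) volume 0 1 := by
  obtain ⟨K, -, hK⟩ := hΘ.exists_norm_deriv_le
  refine (intervalIntegrable_const (c := K)).mono_fun
    (measurable_deriv Θ).aestronglyMeasurable ?_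
  rw [EventuallyLE, ae_restrict_iff' measurableSet_uIoc]
  filter_upwards [hK] with t ht htm
  exact (ht htm).trans (le_abs_self K)

lemma intervalIntegrable_smul (hΘ : IsSimpleContour Θ) {f : ℂ → X}
    (hf : ContinuousOn f (Θ '' Icc 0 1)) :
    IntervalIntegrable (fun t => deriv Θ t • f (Θ t)) volume 0 1 := by
  refine hΘ.intervalIntegrable_deriv.smul_continuousOn ?_
  rw [uIcc_of_le zero_le_one]
  exact hf.comp hΘ.continuousOn (mapsTo_image _ _)

lemma absolutelyContinuous (hΘ : IsSimpleContour Θ) :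
    AbsolutelyContinuousOnInterval Θ 0 1 := by
  obtain ⟨K, hK⟩ := hΘ.rectifiable
  rw [← uIcc_of_le zero_le_one] at hK
  exact hK.absolutelyContinuousOnInterval

lemma exists_le_norm_sub (hΘ : IsSimpleContour Θ) {c : ℂ}
    (hc : ∀ t ∈ Icc (0 : ℝ) 1, Θ t ≠ c) : ∃ q > 0, ∀ t ∈ Icc (0 : ℝ) 1, q ≤ ‖Θ t - c‖ := by
  obtain ⟨t, ht, h⟩ := isCompact_Icc.exists_isMinOn (nonempty_Icc.2 zero_le_one)
    (hΘ.continuousOn.sub (continuousOn_const (c := c))).norm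
  exact ⟨_, norm_pos_iff.2 (sub_ne_zero.2 (hc t ht)), fun s hs => h hs⟩

/-- These are the primitives needed in `contourMean_inv_pow`. The first power is Lipschitz because
`Θ` keeps a positive distance `q` from `c`; the others are products. -/
lemma absolutelyContinuous_inv (hΘ : IsSimpleContour Θ) {c : ℂ}
    (hc : ∀ t ∈ Icc (0 : ℝ) 1, Θ t ≠ c) (n : ℕ) :
    AbsolutelyContinuousOnInterval (fun t => ((Θ t - c) ^ n)⁻¹) 0 1 := by
  obtain ⟨K, hK⟩ := hΘ.rectifiable
  obtain ⟨q, hq, hqc⟩ := hΘ.exists_le_norm_sub hc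
  have h1 : AbsolutelyContinuousOnInterval (fun t => (Θ t - c)⁻¹) 0 1 := by
    have : LipschitzOnWith (K / (⟨q, hq.le⟩ * ⟨q, hq.le⟩)) (fun t => (Θ t - c)⁻¹)
        (uIcc 0 1) := by
      rw [uIcc_of_le zero_le_one]
      refine LipschitzOnWith.of_dist_le_mul fun s hs t ht => ?_
      have hs' := hqc s hs
      have ht' := hqc t ht
      have hKst := hK.dist_le_mul s hs t ht
      rw [dist_eq_norm] at hKst ⊢
      rw [inv_sub_inv (sub_ne_zero.2 (hc s hs)) (sub_ne_zero.2 (hc t ht)), norm_div, norm_mul,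
        sub_sub_sub_cancel_right, norm_sub_rev]
      have : (((K / (⟨q, hq.le⟩ * ⟨q, hq.le⟩) : NNReal) : ℝ)) = K / (q * q) := rfl
      rw [this, div_mul_eq_mul_div]
      gcongr
    exact this.absolutelyContinuousOnInterval
  induction n with
  | zero =>
    have : LipschitzOnWith 0 (fun t : ℝ => ((Θ t - c) ^ 0)⁻¹) (uIcc 0 1) := by
      simp
    exact this.absolutelyContinuousOnInterval
  | succ n ih =>
    have e : (fun t => ((Θ t - c) ^ (n + 1))⁻¹) =
        (fun t => ((Θ t - c) ^ n)⁻¹) • fun t => (Θ t - c)⁻¹ := by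
      funext t
      rw [pow_succ, mul_inv]
      rfl
    rw [e]
    exact ih.smul h1

end IsSimpleContour

lemma contourMean_congr {f g : ℂ → X} (h : ∀ t ∈ Icc (0 : ℝ) 1, f (Θ t) = g (Θ t)) :
    contourMean Θ f = contourMean Θ g := by
  unfold contourMean
  congr 1
  apply intervalIntegral.integral_congr
  intro t ht
  rw [uIcc_of_le zero_le_one] at ht
  simp only [h t ht]

lemma contourMean_add (hΘ : IsSimpleContour Θ) {f g : ℂ → X}
    (hf : ContinuousOn f (Θ '' Icc 0 1)) (hg : ContinuousOn g (Θ '' Icc 0 1)) :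
    contourMean Θ (fun z => f z + g z) = contourMean Θ f + contourMean Θ g := by
  unfold contourMean
  rw [← smul_add, ← intervalIntegral.integral_add (hΘ.intervalIntegrable_smul hf)
    (hΘ.intervalIntegrable_smul hg)]
  simp only [smul_add]

lemma contourMean_comp [CompleteSpace X] [CompleteSpace Y] (hΘ : IsSimpleContour Θ)
    (L : X →L[ℂ] Y) {f : ℂ → X} (hf : ContinuousOn f (Θ '' Icc 0 1)) :
    contourMean Θ (fun z => L (f z)) = L (contourMean Θ f) := by
  unfold contourMean
  rw [map_smul, ← L.intervalIntegral_comp_comm (hΘ.intervalIntegrable_smul hf)]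
  congr 2
  funext t
  rw [map_smul]

lemma exists_norm_contourMean_le (hΘ : IsSimpleContour Θ) : ∃ K : ℝ, 0 ≤ K ∧
    ∀ {X : Type _} [NormedAddCommGroup X] [NormedSpace ℂ X] (f : ℂ → X) (C : ℝ),
    (∀ t ∈ Icc (0 : ℝ) 1, ‖f (Θ t)‖ ≤ C) → ‖contourMean Θ f‖ ≤ K * C := by
  obtain ⟨K, hK0, hK⟩ := hΘ.exists_norm_deriv_le
  refine ⟨‖(2 * Real.pi * Complex.I : ℂ)⁻¹‖ * K, by positivity, fun f C hf => ?_⟩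
  unfold contourMean
  rw [norm_smul, mul_assoc ‖_‖]
  refine mul_le_mul_of_nonneg_left ?_ (norm_nonneg _)
  have e : K * C = K * C * |(1 : ℝ) - 0| := by simp
  rw [e]
  refine intervalIntegral.norm_integral_le_of_norm_le_const_ae ?_
  filter_upwards [hK] with t ht htm
  rw [norm_smul]
  have htm' := htm
  rw [uIoc_of_le zero_le_one] at htm'
  exact mul_le_mul (ht htm) (hf t ⟨htm'.1.le, htm'.2⟩) (norm_nonneg _) hK0

/-- From exponent two on, the integrand has a single-valued primitive, and the curve is closed. -/
lemma contourMean_inv_pow (hΘ : IsSimpleContour Θ) {c : ℂ}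
    (hc : ∀ t ∈ Icc (0 : ℝ) 1, Θ t ≠ c) (n : ℕ) :
    contourMean Θ (fun z => ((z - c) ^ (n + 2))⁻¹) = 0 := by
  have hac := hΘ.absolutelyContinuous_inv hc (n + 1)
  have hd := hΘ.absolutelyContinuous.boundedVariationOn.ae_differentiableAt_of_mem_uIcc
  have hderiv : ∀ᵐ t, t ∈ uIoc (0 : ℝ) 1 → deriv (fun t => ((Θ t - c) ^ (n + 1))⁻¹) t =
      -(n + 1 : ℂ) * (deriv Θ t • ((Θ t - c) ^ (n + 2))⁻¹) := by
    filter_upwards [hd] with t ht htm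
    have htm' := uIoc_subset_uIcc htm
    have hne : Θ t - c ≠ 0 := sub_ne_zero.2 (hc t (by rwa [uIcc_of_le zero_le_one] at htm'))
    have := (((ht htm').hasDerivAt.sub_const c).pow (n + 1)).inv (pow_ne_zero _ hne)
    refine this.deriv.trans ?_
    simp only [smul_eq_mul, Pi.pow_apply, Nat.add_sub_cancel]
    push_cast
    field_simp
    ring
  have hcont : ContinuousOn (fun z : ℂ => ((z - c) ^ (n + 2))⁻¹) (Θ '' Icc 0 1) := by
    refine ContinuousOn.inv₀ (by fun_prop) ?_
    rintro _ ⟨t, ht, rfl⟩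
    exact pow_ne_zero _ (sub_ne_zero.2 (hc t ht))
  have hint := (hΘ.intervalIntegrable_smul hcont).const_mul (-(n + 1 : ℂ))
  have hint2 : IntervalIntegrable (deriv (fun t => ((Θ t - c) ^ (n + 1))⁻¹)) volume 0 1 := by
    refine hint.congr_ae ?_
    rw [EventuallyEq, ae_restrict_iff' measurableSet_uIoc]
    filter_upwards [hderiv] with t ht htm
    exact (ht htm).symm
  have h := integral_deriv_eq_sub_of_absolutelyContinuous hac hint2
  rw [intervalIntegral.integral_congr_ae hderiv, intervalIntegral.integral_const_mul,
    hΘ.closed, sub_self] at h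
  unfold contourMean
  rcases mul_eq_zero.1 h with h | h
  · exact absurd h (neg_ne_zero.2 (Nat.cast_add_one_ne_zero n))
  · rw [h, smul_zero]

end Contour

/-! ### Riesz projectors in Banach algebras -/

section Riesz

open MeasureTheory

variable {Θ : ℝ → ℂ} {B : Type*} [NormedRing B] [NormedAlgebra ℂ B] [CompleteSpace B]

/-- The winding number of `Θ` around `c`. -/
def winding (Θ : ℝ → ℂ) (c : ℂ) : ℂ := contourMean Θ (fun z => (z - c)⁻¹)

lemma continuousAt_resolvent_uncurry {S : B} {z : ℂ} (hz : z ∈ resolventSet ℂ S) :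
    ContinuousAt (fun p : B × ℂ => resolvent p.1 p.2) (S, z) := by
  have h1 : ContinuousAt (fun p : B × ℂ => algebraMap ℂ B p.2 - p.1) (S, z) := by
    have : Continuous (fun p : B × ℂ => algebraMap ℂ B p.2 - p.1) :=
      ((algebraMapCLM ℂ B).continuous.comp continuous_snd).sub continuous_fst
    exact this.continuousAt
  obtain ⟨u, hu⟩ := hz
  have h2 : ContinuousAt Ring.inverse ((fun p : B × ℂ => algebraMap ℂ B p.2 - p.1) (S, z)) := by
    change ContinuousAt Ring.inverse (algebraMap ℂ B z - S)
    rw [← hu]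
    exact NormedRing.inverse_continuousAt u
  exact ContinuousAt.comp (f := fun p : B × ℂ => algebraMap ℂ B p.2 - p.1) h2 h1

lemma continuousOn_resolvent {S : B} {s : Set ℂ} (hs : s ⊆ resolventSet ℂ S) :
    ContinuousOn (resolvent S) s := fun z hz =>
  ((continuousAt_resolvent_uncurry (hs hz)).comp
    (f := fun z => ((S, z) : B × ℂ)) (by fun_prop)).continuousWithinAt

-- One step of the expansion of the resolvent in powers of `(z - c)⁻¹`. As an algebraic identity it
-- holds wherever the resolvent exists, with no convergence condition.
omit [CompleteSpace B] in
lemma resolvent_eq_smul {S : B} {z c : ℂ} (hz : z ∈ resolventSet ℂ S) (hc : z ≠ c) :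
    resolvent S z = (z - c)⁻¹ • (1 + resolvent S z * (S - algebraMap ℂ B c)) := by
  have hzc : z - c ≠ 0 := sub_ne_zero.2 hc
  have h1 : resolvent S z * (algebraMap ℂ B z - S) = 1 := Ring.inverse_mul_cancel _ hz
  have h2 : S - algebraMap ℂ B c = algebraMap ℂ B (z - c) - (algebraMap ℂ B z - S) := by
    rw [map_sub]; abel
  rw [h2, mul_sub, h1, add_sub_cancel, ← Algebra.commutes, ← Algebra.smul_def, smul_smul,
    inv_mul_cancel₀ hzc, one_smul]

lemma continuousOn_resolvent_image {S : B}
    (hS : ∀ t ∈ Icc (0 : ℝ) 1, Θ t ∈ resolventSet ℂ S) :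
    ContinuousOn (resolvent S) (Θ '' Icc 0 1) :=
  continuousOn_resolvent (by rintro _ ⟨t, ht, rfl⟩; exact hS t ht)

lemma continuousOn_inv_pow {c : ℂ} (hc : ∀ t ∈ Icc (0 : ℝ) 1, Θ t ≠ c) (m : ℕ) :
    ContinuousOn (fun z : ℂ => ((z - c) ^ m)⁻¹) (Θ '' Icc 0 1) := by
  refine ContinuousOn.inv₀ (by fun_prop) ?_
  rintro _ ⟨t, ht, rfl⟩
  exact pow_ne_zero _ (sub_ne_zero.2 (hc t ht))

/-- The finite Neumann expansion of the Riesz projector. -/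
lemma contourMean_resolvent_eq (hΘ : IsSimpleContour Θ) {S : B}
    (hS : ∀ t ∈ Icc (0 : ℝ) 1, Θ t ∈ resolventSet ℂ S)
    {c : ℂ} (hc : ∀ t ∈ Icc (0 : ℝ) 1, Θ t ≠ c) (m : ℕ) :
    contourMean Θ (resolvent S) = winding Θ c • (1 : B) +
      contourMean Θ (fun z => ((z - c) ^ (m + 1))⁻¹ • resolvent S z) *
        (S - algebraMap ℂ B c) ^ (m + 1) := by
  set T := S - algebraMap ℂ B c
  have hres := continuousOn_resolvent_image hS
  have hp := fun m => continuousOn_inv_pow hc m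
  have hpr : ∀ m, ContinuousOn (fun z : ℂ => ((z - c) ^ m)⁻¹ • resolvent S z) (Θ '' Icc 0 1) :=
    fun m => (hp m).smul hres
  -- Multiply the one-step identity by `(z - c)^(-m)` and integrate. The scalar term contributes the
  -- winding number for `m = 0` and nothing for larger `m`.
  have step : ∀ m, contourMean Θ (fun z => ((z - c) ^ m)⁻¹ • resolvent S z) =
      contourMean Θ (fun z => ((z - c) ^ (m + 1))⁻¹) • (1 : B) +
      contourMean Θ (fun z => ((z - c) ^ (m + 1))⁻¹ • resolvent S z) * T := by
    intro m
    have e : contourMean Θ (fun z => ((z - c) ^ m)⁻¹ • resolvent S z) =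
        contourMean Θ (fun z => ((z - c) ^ (m + 1))⁻¹ • (1 : B) +
          ((z - c) ^ (m + 1))⁻¹ • resolvent S z * T) := by
      apply contourMean_congr
      intro t ht
      conv_lhs => rw [resolvent_eq_smul (hS t ht) (hc t ht)]
      rw [smul_smul, ← mul_inv, ← pow_succ, smul_add, smul_mul_assoc]
    rw [e, contourMean_add hΘ (f := fun z => ((z - c) ^ (m + 1))⁻¹ • (1 : B))
      (g := fun z => ((z - c) ^ (m + 1))⁻¹ • resolvent S z * T)
      ((hp _).smul continuousOn_const) ((hpr _).mul continuousOn_const)]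
    congr 1
    · exact contourMean_comp hΘ ((ContinuousLinearMap.id ℂ ℂ).smulRight (1 : B)) (hp _)
    · exact contourMean_comp hΘ ((ContinuousLinearMap.mul ℂ B).flip T) (hpr _)
  induction m with
  | zero =>
    have := step 0
    simpa [winding] using this
  | succ m ih =>
    rw [ih, step (m + 1), contourMean_inv_pow hΘ hc m, zero_smul, zero_add, mul_assoc,
      ← pow_succ']

lemma exists_norm_contourMean_smul_resolvent_le (hΘ : IsSimpleContour Θ) {S : B}
    (hS : ∀ t ∈ Icc (0 : ℝ) 1, Θ t ∈ resolventSet ℂ S)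
    {c : ℂ} {q : ℝ} (hq : 0 < q)
    (hqc : ∀ t ∈ Icc (0 : ℝ) 1, q ≤ ‖Θ t - c‖) :
    ∃ C : ℝ, ∀ m : ℕ, ‖contourMean Θ (fun z => ((z - c) ^ m)⁻¹ • resolvent S z)‖ ≤
      C * (q ^ m)⁻¹ := by
  obtain ⟨K, hK0, hK⟩ := exists_norm_contourMean_le hΘ
  obtain ⟨D, hD⟩ := hΘ.isCompact_image.exists_bound_of_continuousOn
    (continuousOn_resolvent_image hS)
  refine ⟨K * D, fun m => ?_⟩
  rw [mul_assoc]
  refine hK _ _ fun t ht => ?_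
  have h1 := hD _ (mem_image_of_mem Θ ht)
  rw [norm_smul, norm_inv, norm_pow, mul_comm]
  have h2 := hqc t ht
  have h0 := (norm_nonneg _).trans h1
  gcongr

/-- If `Θ` lies outside a disc that contains the spectrum, its Riesz projector is scalar. -/
lemma contourMean_resolvent_of_spectralRadius_lt (hΘ : IsSimpleContour Θ) {S : B}
    (hS : ∀ t ∈ Icc (0 : ℝ) 1, Θ t ∈ resolventSet ℂ S)
    {c : ℂ} {q : NNReal}
    (hqc : ∀ t ∈ Icc (0 : ℝ) 1, (q : ℝ) ≤ ‖Θ t - c‖)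
    (hr : spectralRadius ℂ (S - algebraMap ℂ B c) < q) :
    contourMean Θ (resolvent S) = winding Θ c • (1 : B) := by
  set T := S - algebraMap ℂ B c
  have hq : 0 < (q : ℝ) := by
    have : (0 : ℝ≥0∞) < q := bot_le.trans_lt hr
    exact_mod_cast this
  have hc : ∀ t ∈ Icc (0 : ℝ) 1, Θ t ≠ c := by
    intro t ht h
    have := hqc t ht
    rw [h, sub_self, norm_zero] at this
    exact this.not_gt hq
  obtain ⟨r, hr1, hr2⟩ := exists_between hr
  lift r to NNReal using hr2.ne_top
  -- By Gelfand's formula the powers of `T` are eventually bounded by `r ^ n` for any `r` above the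
  -- spectral radius. With `r < q` the remainder of the finite expansion is of order `(r / q) ^ n`.
  have hev : ∀ᶠ n : ℕ in atTop, ‖T ^ n‖ ≤ (r : ℝ) ^ n := by
    filter_upwards [(spectrum.pow_nnnorm_pow_one_div_tendsto_nhds_spectralRadius T).eventually
      (gt_mem_nhds hr1), eventually_gt_atTop 0] with n hn hn0
    have hn0' : (n : ℝ) ≠ 0 := by positivity
    have h1 := ENNReal.rpow_le_rpow hn.le (Nat.cast_nonneg n)
    rw [← ENNReal.rpow_mul, one_div, inv_mul_cancel₀ hn0', ENNReal.rpow_one,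
      ENNReal.rpow_natCast] at h1
    exact_mod_cast h1
  obtain ⟨C, hC⟩ := exists_norm_contourMean_smul_resolvent_le hΘ hS hq hqc
  rw [← sub_eq_zero, ← norm_le_zero_iff]
  have hrq : (r : ℝ) / q < 1 := by
    rw [div_lt_one hq]; exact_mod_cast hr2
  have hlim : Tendsto (fun n : ℕ => C * ((r : ℝ) / q) ^ (n + 1)) atTop (𝓝 0) := by
    have := ((tendsto_pow_atTop_nhds_zero_of_lt_one (by positivity) hrq).comp
      (tendsto_add_atTop_nat 1)).const_mul C
    simpa using this
  refine ge_of_tendsto hlim ?_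
  filter_upwards [(tendsto_add_atTop_nat 1).eventually hev] with n hn
  rw [contourMean_resolvent_eq hΘ hS hc n, add_sub_cancel_left]
  refine (norm_mul_le _ _).trans ?_
  have := hC (n + 1)
  calc _ ≤ C * ((q : ℝ) ^ (n + 1))⁻¹ * (r : ℝ) ^ (n + 1) := by
        gcongr
        exact (norm_nonneg _).trans this
    _ = _ := by rw [div_pow]; ring

/-- In the Banach algebra `ℂ` the Riesz projector of `d` is the winding number around `d`, so
constancy of the winding number on discs that avoid `Θ` is a case of the previous lemma. -/
lemma winding_eq_of_norm_sub_lt (hΘ : IsSimpleContour Θ) {c d : ℂ} {q : ℝ}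
    (hqc : ∀ t ∈ Icc (0 : ℝ) 1, q ≤ ‖Θ t - c‖) (hd : ‖d - c‖ < q) :
    winding Θ d = winding Θ c := by
  have hq : 0 < q := (norm_nonneg _).trans_lt hd
  lift q to NNReal using hq.le
  have hne : ∀ t ∈ Icc (0 : ℝ) 1, Θ t - d ≠ 0 := by
    intro t ht h
    rw [← sub_eq_zero.1 h] at hd
    exact (hqc t ht).not_gt hd
  have h := contourMean_resolvent_of_spectralRadius_lt (B := ℂ) hΘ (S := d) (c := c) (q := q)
    (fun t ht => by
      rw [spectrum.mem_resolventSet_iff, Algebra.algebraMap_self_apply]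
      exact (hne t ht).isUnit) hqc
    ((spectrum.spectralRadius_le_nnnorm _).trans_lt (by exact_mod_cast hd))
  rw [smul_eq_mul, mul_one] at h
  rw [← h, winding]
  apply contourMean_congr
  intro t ht
  simp [resolvent]

end Riesz

/-! ### Perturbation of Riesz projectors -/

section Perturbation

variable {Θ : ℝ → ℂ} {B : Type*} [NormedRing B] [NormedAlgebra ℂ B] [CompleteSpace B]

lemma contourMean_sub (hΘ : IsSimpleContour Θ) {X : Type*} [NormedAddCommGroup X]
    [NormedSpace ℂ X] {f g : ℂ → X}
    (hf : ContinuousOn f (Θ '' Icc 0 1)) (hg : ContinuousOn g (Θ '' Icc 0 1)) :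
    contourMean Θ (fun z => f z - g z) = contourMean Θ f - contourMean Θ g := by
  unfold contourMean
  rw [← smul_sub, ← intervalIntegral.integral_sub (hΘ.intervalIntegrable_smul hf)
    (hΘ.intervalIntegrable_smul hg)]
  simp only [smul_sub]

lemma eventually_mem_resolventSet {S : B} {z : ℂ} (hz : z ∈ resolventSet ℂ S) :
    ∀ᶠ p : B × ℂ in 𝓝 (S, z), p.2 ∈ resolventSet ℂ p.1 := by
  have hc : Continuous (fun p : B × ℂ => algebraMap ℂ B p.2 - p.1) :=
    ((algebraMapCLM ℂ B).continuous.comp continuous_snd).sub continuous_fst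
  exact (Units.isOpen.preimage hc).mem_nhds hz

lemma eventually_forall_mem_resolventSet {S : B} {s : Set ℂ} (hs : IsCompact s)
    (h : s ⊆ resolventSet ℂ S) : ∀ᶠ T in 𝓝 S, s ⊆ resolventSet ℂ T :=
  hs.eventually_forall_of_forall_eventually (P := fun T z => z ∈ resolventSet ℂ T)
    fun _ hz => eventually_mem_resolventSet (h hz)

lemma eventually_contour_mem_resolventSet (hΘ : IsSimpleContour Θ) {S : B}
    (hS : ∀ t ∈ Icc (0 : ℝ) 1, Θ t ∈ resolventSet ℂ S) :
    ∀ᶠ T in 𝓝 S, ∀ t ∈ Icc (0 : ℝ) 1, Θ t ∈ resolventSet ℂ T := by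
  filter_upwards [eventually_forall_mem_resolventSet hΘ.isCompact_image
    (image_subset_iff.2 hS)] with T hT t ht
  exact hT (mem_image_of_mem Θ ht)

/-- The resolvent is jointly continuous in operator and point, and the curve is compact, so the
integrands converge uniformly on the curve. -/
lemma tendsto_contourMean_resolvent (hΘ : IsSimpleContour Θ) {S : B}
    (hS : ∀ t ∈ Icc (0 : ℝ) 1, Θ t ∈ resolventSet ℂ S) :
    Tendsto (fun T : B => contourMean Θ (resolvent T)) (𝓝 S)
      (𝓝 (contourMean Θ (resolvent S))) := by
  obtain ⟨K, hK0, hK⟩ := exists_norm_contourMean_le hΘ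
  rw [Metric.tendsto_nhds]
  intro ε hε
  set η := ε / (2 * (K + 1)) with hη
  have hη0 : 0 < η := by positivity
  have h1 : ∀ᶠ T in 𝓝 S, ∀ z ∈ Θ '' Icc 0 1, ‖resolvent T z - resolvent S z‖ < η := by
    refine hΘ.isCompact_image.eventually_forall_of_forall_eventually
      (P := fun T z => ‖resolvent T z - resolvent S z‖ < η) ?_
    rintro _ ⟨t, ht, rfl⟩
    have hc := continuousAt_resolvent_uncurry (hS t ht)
    have hc2 : ContinuousAt (fun p : B × ℂ => resolvent S p.2) (S, Θ t) :=
      ContinuousAt.comp (g := fun p : B × ℂ => resolvent p.1 p.2)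
        (f := fun p : B × ℂ => (S, p.2)) hc (by fun_prop)
    have := (hc.sub hc2).norm
    refine this.eventually (gt_mem_nhds ?_)
    simpa using hη0
  filter_upwards [h1, eventually_contour_mem_resolventSet hΘ hS] with T hT1 hT2
  rw [dist_eq_norm, ← contourMean_sub hΘ (continuousOn_resolvent_image hT2)
    (continuousOn_resolvent_image hS)]
  refine (hK _ η fun t ht => (hT1 _ (mem_image_of_mem Θ ht)).le).trans_lt ?_
  rw [hη]
  calc K * (ε / (2 * (K + 1))) = ε * (K / (K + 1)) / 2 := by field_simp
    _ ≤ ε * 1 / 2 := by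
      gcongr
      rw [div_le_one (by positivity)]; linarith
    _ < ε := by linarith

/-- Upper semicontinuity of the spectrum: the points off `Θ` with winding number `0` or `1` form an
open neighbourhood `G` of the spectrum of `S`, and the spectrum of a nearby operator cannot leave
`G`. This is what makes the discrete projector idempotent. -/
lemma eventually_winding_spectrum (hΘ : IsSimpleContour Θ) {S : B}
    (hS : ∀ t ∈ Icc (0 : ℝ) 1, Θ t ∈ resolventSet ℂ S)
    (hw : ∀ μ ∈ spectrum ℂ S, winding Θ μ = 0 ∨ winding Θ μ = 1) :
    ∀ᶠ T in 𝓝 S, ∀ μ ∈ spectrum ℂ T, winding Θ μ = 0 ∨ winding Θ μ = 1 := by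
  set G : Set ℂ := {μ | (∀ t ∈ Icc (0 : ℝ) 1, Θ t ≠ μ) ∧ (winding Θ μ = 0 ∨ winding Θ μ = 1)}
  have hG : IsOpen G := by
    rw [Metric.isOpen_iff]
    rintro μ ⟨h1, h2⟩
    obtain ⟨q, hq, hqc⟩ := hΘ.exists_le_norm_sub h1
    refine ⟨q, hq, fun d hd => ?_⟩
    rw [mem_ball_iff_norm] at hd
    refine ⟨fun t ht h => ?_, ?_⟩
    · rw [← h] at hd
      exact (hqc t ht).not_gt hd
    · rwa [winding_eq_of_norm_sub_lt hΘ hqc hd]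
  -- A radius that bounds the spectra of all operators near `S`, so that only a compact part of the
  -- complement of `G` matters. The factor `‖1‖` is there because the norm of the algebra is not
  -- normalized.
  set ρ := ‖S‖ * ‖(1 : B)‖ + 1
  have hK : IsCompact (Metric.closedBall (0 : ℂ) ρ ∩ Gᶜ) :=
    (isCompact_closedBall _ _).inter_right hG.isClosed_compl
  have hKS : Metric.closedBall (0 : ℂ) ρ ∩ Gᶜ ⊆ resolventSet ℂ S := by
    rintro μ ⟨-, hμ⟩
    by_contra h
    refine hμ ⟨fun t ht he => h ?_, hw μ h⟩
    rw [← he]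
    exact hS t ht
  have hn : ∀ᶠ T : B in 𝓝 S, ‖T‖ * ‖(1 : B)‖ < ρ := by
    have : Continuous fun T : B => ‖T‖ * ‖(1 : B)‖ := by fun_prop
    exact this.continuousAt.eventually (gt_mem_nhds (lt_add_one _))
  filter_upwards [hn, eventually_forall_mem_resolventSet hK hKS] with T hT1 hT2 μ hμ
  by_contra h
  refine hμ (hT2 ⟨?_, fun hμG => h hμG.2⟩)
  rw [mem_closedBall_zero_iff]
  exact (spectrum.norm_le_norm_mul_of_mem hμ).trans hT1.le

/-- The Riesz projector vanishes if `Θ` lies outside a disc around `0` that contains the spectrum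
and does not wind around the spectrum. -/
lemma contourMean_resolvent_eq_zero [Nontrivial B] (hΘ : IsSimpleContour Θ) {S : B}
    (hS : ∀ t ∈ Icc (0 : ℝ) 1, Θ t ∈ resolventSet ℂ S) {s : Set ℂ} (hsb : Bornology.IsBounded s)
    (hs : spectrum ℂ S ⊆ s) (hw : ∀ μ ∈ s, winding Θ μ = 0)
    (hout : ∀ t ∈ Icc (0 : ℝ) 1, sSup (norm '' s) < ‖Θ t‖) :
    contourMean Θ (resolvent S) = 0 := by
  obtain ⟨t₀, ht₀, hmin⟩ := isCompact_Icc.exists_isMinOn (nonempty_Icc.2 zero_le_one)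
    hΘ.continuousOn.norm
  obtain ⟨μ, hμ⟩ := spectrum.nonempty S
  have hbdd : BddAbove (norm '' s) := by
    obtain ⟨C, hC⟩ := isBounded_iff_forall_norm_le.1 hsb
    exact ⟨C, forall_mem_image.2 hC⟩
  have hlt : ∀ k ∈ spectrum ℂ S, ‖k‖ < ‖Θ t₀‖ := fun k hk =>
    (le_csSup hbdd (mem_image_of_mem _ (hs hk))).trans_lt (hout t₀ ht₀)
  have hq : ∀ t ∈ Icc (0 : ℝ) 1, ‖Θ t₀‖ ≤ ‖Θ t - 0‖ := fun t ht => by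
    rw [sub_zero]; exact hmin ht
  have hr : spectralRadius ℂ (S - algebraMap ℂ B 0) < (‖Θ t₀‖₊ : ℝ≥0∞) := by
    rw [map_zero, sub_zero]
    exact spectrum.spectralRadius_lt_of_forall_lt_of_nonempty (spectrum.nonempty S) hlt
  -- The projector is the winding number around `0`. That equals the winding number around the
  -- spectral point `μ`, since both lie in the disc of radius `min ‖Θ‖`, and the latter vanishes.
  rw [contourMean_resolvent_of_spectralRadius_lt hΘ hS hq hr,
    ← winding_eq_of_norm_sub_lt hΘ hq (d := μ) (by rw [sub_zero]; exact hlt μ hμ),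
    hw μ (hs hμ), zero_smul]

end Perturbation

/-! ### Idempotence of the Riesz projector for scalar plus finite rank -/

section Idempotent

variable {Θ : ℝ → ℂ} {V : Type*} [NormedAddCommGroup V] [NormedSpace ℂ V] [CompleteSpace V]

lemma spectralProjector_apply (hΘ : IsSimpleContour Θ) {S : V →L[ℂ] V}
    (hS : ∀ t ∈ Icc (0 : ℝ) 1, Θ t ∈ resolventSet ℂ S) (x : V) :
    spectralProjector S Θ x = contourMean Θ (fun z => resolvent S z x) :=
  (contourMean_comp hΘ (ContinuousLinearMap.apply ℂ V x)
    (continuousOn_resolvent_image hS)).symm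

/-- In the finite expansion centred at `μ`, the remainder contains a power of `S - μ` acting first,
and this kills a generalized eigenvector. -/
lemma spectralProjector_of_pow_apply_eq_zero (hΘ : IsSimpleContour Θ) {S : V →L[ℂ] V}
    (hS : ∀ t ∈ Icc (0 : ℝ) 1, Θ t ∈ resolventSet ℂ S) {μ : ℂ}
    (hμ : ∀ t ∈ Icc (0 : ℝ) 1, Θ t ≠ μ) {x : V} {k : ℕ}
    (hx : ((S - algebraMap ℂ (V →L[ℂ] V) μ) ^ k) x = 0) :
    spectralProjector S Θ x = winding Θ μ • x := by
  have h := contourMean_resolvent_eq hΘ hS hμ k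
  change contourMean Θ (fun z => resolvent S z) x = _
  rw [h, pow_succ']
  generalize contourMean Θ (fun z => ((z - μ) ^ (k + 1))⁻¹ • resolvent S z) = D
  change winding Θ μ • x + D ((S - algebraMap ℂ (V →L[ℂ] V) μ)
    (((S - algebraMap ℂ (V →L[ℂ] V) μ) ^ k) x)) = _
  rw [hx, map_zero, map_zero, add_zero]

lemma norm_le_of_mem_spectrum {S : V →L[ℂ] V} {μ : ℂ} (hμ : μ ∈ spectrum ℂ S) : ‖μ‖ ≤ ‖S‖ :=
  (spectrum.norm_le_norm_mul_of_mem hμ).trans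
    (mul_le_of_le_one_right (norm_nonneg S) ContinuousLinearMap.norm_id_le)

omit [CompleteSpace V] in
lemma mem_spectrum_of_pow_apply_eq_zero {S : V →L[ℂ] V} {μ : ℂ} {x : V} {k : ℕ} (hx0 : x ≠ 0)
    (hx : ((S - algebraMap ℂ (V →L[ℂ] V) μ) ^ k) x = 0) : μ ∈ spectrum ℂ S := by
  intro h
  have h1 : IsUnit ((S - algebraMap ℂ (V →L[ℂ] V) μ) ^ k) := by
    refine IsUnit.pow k ?_
    rw [← neg_sub]
    exact IsUnit.neg h
  obtain ⟨u, hu⟩ := h1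
  apply hx0
  have h2 : (↑u⁻¹ * (u : V →L[ℂ] V)) x = x := by rw [Units.inv_mul]; rfl
  rw [← h2, hu]
  change (↑u⁻¹ : V →L[ℂ] V) (((S - algebraMap ℂ (V →L[ℂ] V) μ) ^ k) x) = 0
  rw [hx, map_zero]

/-- Since `S - c` maps into `F`, the space `F + ℂx` is finite-dimensional and invariant, hence a sum
of generalized eigenspaces. On each of them the projector is multiplication by a winding number,
which is `0` or `1`. No second contour and no double integral enter. -/
lemma spectralProjector_idempotent (hΘ : IsSimpleContour Θ) {S : V →L[ℂ] V}
    (hS : ∀ t ∈ Icc (0 : ℝ) 1, Θ t ∈ resolventSet ℂ S)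
    (hw : ∀ μ ∈ spectrum ℂ S, winding Θ μ = 0 ∨ winding Θ μ = 1)
    (F : Submodule ℂ V) [FiniteDimensional ℂ F] (c : ℂ) (hF : ∀ v, S v - c • v ∈ F) (x : V) :
    spectralProjector S Θ (spectralProjector S Θ x) = spectralProjector S Θ x := by
  set Y : Submodule ℂ V := F ⊔ Submodule.span ℂ {x}
  have hinv : ∀ y ∈ Y, S.toLinearMap y ∈ Y := by
    intro y hy
    have h1 : S y = (S y - c • y) + c • y := by abel
    change S y ∈ Y
    rw [h1]
    exact Y.add_mem (Submodule.mem_sup_left (hF y)) (Y.smul_mem c hy)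
  set T : Module.End ℂ Y := S.toLinearMap.restrict hinv
  have hpow : ∀ (μ : ℂ) (k : ℕ) (y : Y), ((((T - μ • (1 : Module.End ℂ Y)) ^ k) y : Y) : V) =
      ((S - algebraMap ℂ (V →L[ℂ] V) μ) ^ k) y := by
    intro μ k
    induction k with
    | zero => intro y; rfl
    | succ k ih =>
      intro y
      rw [pow_succ, pow_succ]
      exact ih _
  have hall : ∀ y : Y, spectralProjector S Θ (spectralProjector S Θ y) =
      spectralProjector S Θ y := by
    intro y
    have hy : y ∈ ⨆ μ, T.maxGenEigenspace μ := by
      rw [Module.End.iSup_maxGenEigenspace_eq_top]; trivial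
    refine Submodule.iSup_induction _ (motive := fun y : Y =>
      spectralProjector S Θ (spectralProjector S Θ y) = spectralProjector S Θ y) hy ?_ ?_ ?_
    · intro μ y hy
      obtain ⟨k, hk⟩ := (Module.End.mem_maxGenEigenspace _ _ _).1 hy
      have hk' : ((S - algebraMap ℂ (V →L[ℂ] V) μ) ^ k) (y : V) = 0 := by
        rw [← hpow, hk]; rfl
      rcases eq_or_ne (y : V) 0 with h0 | h0
      · simp [h0]
      · have hμ := mem_spectrum_of_pow_apply_eq_zero h0 hk'
        have hμΘ : ∀ t ∈ Icc (0 : ℝ) 1, Θ t ≠ μ := by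
          rintro t ht rfl
          exact hμ (hS t ht)
        rw [spectralProjector_of_pow_apply_eq_zero hΘ hS hμΘ hk', map_smul,
          spectralProjector_of_pow_apply_eq_zero hΘ hS hμΘ hk', smul_smul]
        rcases hw μ hμ with h | h <;> simp [h]
    · simp
    · intro a b ha hb
      simp only [Submodule.coe_add, map_add, ha, hb]
  exact hall ⟨x, Submodule.mem_sup_right (Submodule.mem_span_singleton_self x)⟩

end Idempotent

/-! ### Riesz projectors on invariant subspaces and orthogonal complements -/

section Reduction

variable {Θ : ℝ → ℂ} {V : Type*} [NormedAddCommGroup V] [InnerProductSpace ℂ V]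

lemma apply_resolvent {S : V →L[ℂ] V} {z : ℂ} (hz : z ∈ resolventSet ℂ S) (x : V) :
    z • resolvent S z x - S (resolvent S z x) = x := by
  have h : (algebraMap ℂ (V →L[ℂ] V) z - S) * resolvent S z = 1 := Ring.mul_inverse_cancel _ hz
  exact congrArg (fun T : V →L[ℂ] V => T x) h

lemma resolvent_apply {S : V →L[ℂ] V} {z : ℂ} (hz : z ∈ resolventSet ℂ S) (x : V) :
    resolvent S z (z • x - S x) = x := by
  have h : resolvent S z * (algebraMap ℂ (V →L[ℂ] V) z - S) = 1 := Ring.inverse_mul_cancel _ hz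
  exact congrArg (fun T : V →L[ℂ] V => T x) h

lemma spectralProjector_restrict [CompleteSpace V] (hΘ : IsSimpleContour Θ) {S : V →L[ℂ] V}
    (hS : ∀ t ∈ Icc (0 : ℝ) 1, Θ t ∈ resolventSet ℂ S) {W : Submodule ℂ V} [CompleteSpace W]
    {T : W →L[ℂ] W} (hT : ∀ w : W, (T w : V) = S w)
    (hTΘ : ∀ t ∈ Icc (0 : ℝ) 1, Θ t ∈ resolventSet ℂ T) (w : W) :
    (spectralProjector T Θ w : V) = spectralProjector S Θ w := by
  have hc : ContinuousOn (fun z => resolvent T z w) (Θ '' Icc 0 1) :=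
    (continuousOn_resolvent_image hTΘ).clm_apply continuousOn_const
  rw [spectralProjector_apply hΘ hS, spectralProjector_apply hΘ hTΘ]
  refine (contourMean_comp hΘ W.subtypeL hc).symm.trans ?_
  apply contourMean_congr
  intro t ht
  have h2 := congrArg (Subtype.val) (apply_resolvent (hTΘ t ht) w)
  rw [W.coe_sub, W.coe_smul, hT] at h2
  have h3 := resolvent_apply (hS t ht) (resolvent T (Θ t) w : V)
  rw [h2] at h3
  exact h3.symm

/-- Invariance under the resolvent is required and not just under `S`: otherwise `z - S` may fail to
map `W` onto itself. -/
lemma mem_resolventSet_restrict {S : V →L[ℂ] V} {W : Submodule ℂ V} {T : W →L[ℂ] W}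
    (hT : ∀ w : W, (T w : V) = S w) {z : ℂ} (hz : z ∈ resolventSet ℂ S)
    (hW : ∀ w ∈ W, resolvent S z w ∈ W) : z ∈ resolventSet ℂ T := by
  obtain ⟨R, hR⟩ : ∃ R : W →L[ℂ] W, ∀ w : W, (R w : V) = resolvent S z w :=
    ⟨(resolvent S z ∘L W.subtypeL).codRestrict W (fun w => hW _ w.2), fun _ => rfl⟩
  refine ⟨⟨algebraMap ℂ _ z - T, R, ?_, ?_⟩, rfl⟩
  · ext w
    change z • (R w : V) - (T (R w) : V) = w
    rw [hT, hR, apply_resolvent hz]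
  · ext w
    change (R (z • w - T w) : V) = w
    rw [hR, Submodule.coe_sub, Submodule.coe_smul, hT, resolvent_apply hz]

/-- The restriction of `S` to `W` has its spectrum inside that of `S` and norm at most `s`, so its
spectrum misses `M`. It lies in the part that `Θ` does not enclose and that sits in the disc inside
`Θ`. -/
lemma spectralProjector_apply_eq_zero [CompleteSpace V] {S : V →L[ℂ] V} {M : Set ℂ}
    (hΘ : IsSeparatingContour S M Θ)
    (hS : ∀ t ∈ Icc (0 : ℝ) 1, Θ t ∈ resolventSet ℂ S) {W : Submodule ℂ V} [CompleteSpace W]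
    (hSW : ∀ w ∈ W, S w ∈ W) (hW : ∀ z ∈ resolventSet ℂ S, ∀ w ∈ W, resolvent S z w ∈ W)
    {s : ℝ} (hs0 : 0 ≤ s) (hs : ∀ w ∈ W, ‖S w‖ ≤ s * ‖w‖) (hsM : ∀ m ∈ M, s < ‖m‖)
    {w : V} (hw : w ∈ W) : spectralProjector S Θ w = 0 := by
  obtain ⟨T, hT⟩ : ∃ T : W →L[ℂ] W, ∀ w : W, (T w : V) = S w :=
    ⟨(S ∘L W.subtypeL).codRestrict W (fun w => hSW _ w.2), fun _ => rfl⟩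
  have hTn : ‖T‖ ≤ s := T.opNorm_le_bound hs0 fun w => by
    rw [Submodule.coe_norm, hT]
    exact hs w w.2
  have hres : ∀ z ∈ resolventSet ℂ S, z ∈ resolventSet ℂ T := fun z hz =>
    mem_resolventSet_restrict hT hz (hW z hz)
  have hspec : spectrum ℂ T ⊆ spectrum ℂ S \ M := by
    intro μ hμ
    refine ⟨spectrum.mem_iff.2 fun h => spectrum.mem_iff.1 hμ (hres μ h), fun h => ?_⟩
    linarith [hsM μ h, norm_le_of_mem_spectrum hμ]
  have hTΘ : ∀ t ∈ Icc (0 : ℝ) 1, Θ t ∈ resolventSet ℂ T := fun t ht => hres _ (hS t ht)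
  have hP : spectralProjector T Θ = 0 := by
    -- On the zero space the spectrum is empty and offers no point at which to evaluate the winding
    -- number.
    rcases subsingleton_or_nontrivial W with hsub | hnon
    · exact Subsingleton.elim _ _
    exact contourMean_resolvent_eq_zero hΘ.toIsSimpleContour hTΘ
      ((spectrum.isBounded S).subset sdiff_subset) hspec
      (fun μ hμ => (hΘ.excludes μ hμ).2) hΘ.outside
  have h := spectralProjector_restrict hΘ.toIsSimpleContour hS hT hTΘ ⟨w, hw⟩
  rw [← h, hP]
  rfl

/-- The projector fixes `E`, which is spanned by eigenvectors at enclosed points, and kills `Eᗮ` by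
the previous lemma. Intersecting the eigenspaces with `E` in `hE` also makes `E` invariant under
`S`. -/
lemma spectralProjector_eq_starProjection [CompleteSpace V] {S : V →L[ℂ] V} {E : Submodule ℂ V}
    [FiniteDimensional ℂ E] {M : Set ℂ}
    (hE : E ≤ ⨆ m : M, Module.End.eigenspace S.toLinearMap m ⊓ E)
    (hW : ∀ w ∈ Eᗮ, S w ∈ Eᗮ) {s : ℝ} (hs0 : 0 ≤ s) (hs : ∀ w ∈ Eᗮ, ‖S w‖ ≤ s * ‖w‖)
    (hsM : ∀ m ∈ M, s < ‖m‖) (hΘ : IsSeparatingContour S M Θ) :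
    (∀ t ∈ Icc (0 : ℝ) 1, Θ t ∈ resolventSet ℂ S) ∧
    (∀ μ ∈ spectrum ℂ S, winding Θ μ = 0 ∨ winding Θ μ = 1) ∧
    spectralProjector S Θ = E.starProjection := by
  have hwind : ∀ μ ∈ spectrum ℂ S, (∀ t ∈ Icc (0 : ℝ) 1, Θ t ≠ μ) ∧
      (winding Θ μ = 0 ∨ winding Θ μ = 1) := by
    intro μ hμ
    by_cases hM : μ ∈ M
    · have := hΘ.encloses μ hM
      exact ⟨this.1, Or.inr this.2⟩
    · have := hΘ.excludes μ ⟨hμ, hM⟩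
      exact ⟨this.1, Or.inl this.2⟩
  have hS : ∀ t ∈ Icc (0 : ℝ) 1, Θ t ∈ resolventSet ℂ S := by
    intro t ht
    by_contra h
    exact (hwind _ h).1 t ht rfl
  have hΘs := hΘ.toIsSimpleContour
  refine ⟨hS, fun μ hμ => (hwind μ hμ).2, ?_⟩
  have hPE : ∀ e ∈ E, spectralProjector S Θ e = e := by
    intro e he
    refine Submodule.iSup_induction _ (motive := fun e => spectralProjector S Θ e = e)
      (hE he) ?_ ?_ ?_
    · rintro ⟨m, hm⟩ x ⟨hx, -⟩
      have hx' : ((S - algebraMap ℂ (V →L[ℂ] V) m) ^ 1) x = 0 := by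
        rw [pow_one]
        exact sub_eq_zero.2 (Module.End.mem_eigenspace_iff.1 hx)
      have hw := hΘ.encloses m hm
      rw [spectralProjector_of_pow_apply_eq_zero hΘs hS hw.1 hx']
      change contourMean Θ (fun z => (z - m)⁻¹) • x = x
      rw [hw.2, one_smul]
    · exact map_zero _
    · intro a b ha hb
      rw [map_add, ha, hb]
  have hSE : ∀ e ∈ E, S e ∈ E := by
    intro e he
    refine Submodule.iSup_induction _ (motive := fun e => S e ∈ E) (hE he) ?_ ?_ ?_
    · rintro ⟨m, hm⟩ x ⟨hx, hxE⟩
      have : S x = m • x := Module.End.mem_eigenspace_iff.1 hx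
      rw [this]
      exact E.smul_mem _ hxE
    · rw [map_zero]; exact E.zero_mem
    · intro a b ha hb
      rw [map_add]; exact E.add_mem ha hb
  -- Let `e` be the `E`-component of the resolvent vector. Both `E` and `Eᗮ` are invariant, so `(z -
  -- S) e` lies in both and vanishes; injectivity of `z - S` gives `e = 0`.
  have hresW : ∀ z ∈ resolventSet ℂ S, ∀ w ∈ Eᗮ, resolvent S z w ∈ Eᗮ := by
    intro z hz w hw
    have h1 := apply_resolvent hz w
    set u := resolvent S z w
    set e := E.starProjection u
    have he : e ∈ E := Submodule.starProjection_apply_mem E u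
    have hu : u - e ∈ Eᗮ := Submodule.sub_starProjection_mem_orthogonal u
    have h2 : z • e - S e = w - (z • (u - e) - S (u - e)) := by
      rw [← h1, map_sub]; module
    have h3 : z • e - S e ∈ E := E.sub_mem (E.smul_mem z he) (hSE e he)
    have h4 : z • e - S e ∈ Eᗮ := by
      rw [h2]
      exact Eᗮ.sub_mem hw (Eᗮ.sub_mem (Eᗮ.smul_mem z hu) (hW _ hu))
    have h5 : z • e - S e = 0 := by
      have : z • e - S e ∈ E ⊓ Eᗮ := ⟨h3, h4⟩
      rwa [Submodule.inf_orthogonal_eq_bot, Submodule.mem_bot] at this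
    have h6 := resolvent_apply hz e
    rw [h5, map_zero] at h6
    rwa [← h6, sub_zero] at hu
  have hPW : ∀ w ∈ Eᗮ, spectralProjector S Θ w = 0 := fun w hw =>
    spectralProjector_apply_eq_zero hΘ hS hW hresW hs0 hs hsM hw
  ext x
  have h1 : x = E.starProjection x + (x - E.starProjection x) := by abel
  conv_lhs => rw [h1]
  rw [map_add, hPE _ (Submodule.starProjection_apply_mem E x),
    hPW _ (Submodule.sub_starProjection_mem_orthogonal x), add_zero]

end Reduction

/-! ### The resolvent and the square root of the modulus -/

section Operator

variable {H : Type*} [NormedAddCommGroup H] [InnerProductSpace ℂ H]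

lemma mem_eigSpace_iff {A : H →ₗ.[ℂ] H} {lam : ℝ} {e : H} :
    e ∈ eigSpace A lam ↔ ∃ he : e ∈ A.domain, A ⟨e, he⟩ = (lam : ℂ) • e := by
  unfold eigSpace
  rw [Submodule.mem_map]
  constructor
  · rintro ⟨x, hx, rfl⟩
    refine ⟨x.2, ?_⟩
    exact sub_eq_zero.1 (LinearMap.mem_ker.1 hx)
  · rintro ⟨he, h⟩
    exact ⟨⟨e, he⟩, LinearMap.mem_ker.2 (sub_eq_zero.2 h), rfl⟩

variable [CompleteSpace H] {A : H →ₗ.[ℂ] H}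

lemma isSymmetric_of_isSelfAdjoint {T : H →ₗ.[ℂ] H} (hT : IsSelfAdjoint T) (x y : T.domain) :
    inner ℂ (T x) (y : H) = inner ℂ (x : H) (T y) := by
  have := LinearPMap.adjoint_isFormalAdjoint hT.dense_domain (T := T)
  rw [LinearPMap.isSelfAdjoint_def.1 hT] at this
  exact this x y

lemma resolventOp_spec_of_mem {z : ℂ} (hz : z ∈ resolventPts A) :
    IsResolventAt A z (resolventOp A z) :=
  resolventOp_spec hz

lemma I_mem_resolventPts (hA : IsSelfAdjoint A) : Complex.I ∈ resolventPts A :=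
  exists_resolventAt hA (Or.inl rfl)

lemma resolventOp_sub {z ζ : ℂ} (hz : z ∈ resolventPts A) (hζ : ζ ∈ resolventPts A) :
    resolventOp A z - resolventOp A ζ = (ζ - z) • (resolventOp A ζ * resolventOp A z) := by
  ext x
  obtain ⟨hx, hxe⟩ := (resolventOp_spec_of_mem hz).1 x
  have h := (resolventOp_spec_of_mem hζ).2 ⟨_, hx⟩
  have e : ζ • resolventOp A z x - A ⟨resolventOp A z x, hx⟩ =
      (ζ - z) • resolventOp A z x + x := by
    nth_rewrite 4 [← hxe]; module
  simp only at h
  rw [e, map_add, map_smul] at h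
  change resolventOp A z x - resolventOp A ζ x = (ζ - z) • resolventOp A ζ (resolventOp A z x)
  nth_rewrite 1 [← h]; abel

lemma commute_resolventOp {z ζ : ℂ} (hz : z ∈ resolventPts A) (hζ : ζ ∈ resolventPts A) :
    Commute (resolventOp A z) (resolventOp A ζ) := by
  rcases eq_or_ne z ζ with rfl | hne
  · exact Commute.refl _
  have h1 := resolventOp_sub hz hζ
  have h2 := resolventOp_sub hζ hz
  have h3 : (ζ - z) • (resolventOp A z * resolventOp A ζ) =
      (ζ - z) • (resolventOp A ζ * resolventOp A z) := by
    rw [← h1, ← neg_sub (resolventOp A ζ), h2]; module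
  exact smul_right_injective _ (sub_ne_zero.2 hne.symm) h3

lemma star_resolventOp_I_mul (hA : IsSelfAdjoint A) :
    star (resolventOp A Complex.I) * (1 - (2 * Complex.I) • resolventOp A Complex.I) =
      resolventOp A Complex.I := by
  have h := (resolvent_basic hA).2
  rw [cutoff] at h
  rw [mul_sub, mul_one, mul_smul_comm, ← h]; abel

/-- The adjoint of `R = R(i)` is `R (1 - 2iR)⁻¹`, with `(1 - 2iR)⁻¹ = 1 + 2iR*`. Whatever commutes
with `R` thus commutes with its adjoint. -/
lemma commute_star_resolventOp_I (hA : IsSelfAdjoint A) {z : ℂ} (hz : z ∈ resolventPts A) :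
    Commute (resolventOp A z) (star (resolventOp A Complex.I)) := by
  have hc := commute_resolventOp hz (I_mem_resolventPts hA)
  have h := (resolvent_basic hA).2
  have hstar := star_resolventOp_I_mul hA
  rw [cutoff] at h
  set R := resolventOp A Complex.I
  set T := star R
  set X := resolventOp A z
  have hcX : Commute X (1 - (2 * Complex.I) • R) :=
    (Commute.one_right X).sub_right (hc.smul_right _)
  have hinv : (1 - (2 * Complex.I) • R) * (1 + (2 * Complex.I) • T) = 1 := by
    have hRT : R * T = T * R := (resolvent_basic hA).1.eq
    rw [sub_mul, mul_add, mul_add, one_mul, one_mul, mul_one, smul_mul_smul_comm, hRT]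
    have e : (2 * Complex.I) * (2 * Complex.I) = -4 := by
      linear_combination 4 * Complex.I_mul_I
    have h' : (2 * Complex.I) • T - (2 * Complex.I) • R = (-4 : ℂ) • (T * R) := by
      rw [← smul_sub, h, smul_smul, e]
    rw [e, ← h']; abel
  have hXT : (X * T) * (1 - (2 * Complex.I) • R) = (T * X) * (1 - (2 * Complex.I) • R) := by
    rw [mul_assoc, hstar, mul_assoc, hcX.eq, ← mul_assoc, hstar, hc.eq]
  calc X * T = (X * T) * (1 - (2 * Complex.I) • R) * (1 + (2 * Complex.I) • T) := by
        rw [mul_assoc, hinv, mul_one]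
    _ = T * X := by rw [hXT, mul_assoc, hinv, mul_one]

lemma commute_cutoff (hA : IsSelfAdjoint A) {z : ℂ} (hz : z ∈ resolventPts A) :
    Commute (cutoff A) (resolventOp A z) := by
  rw [cutoff]
  exact ((commute_star_resolventOp_I hA hz).mul_right
    (commute_resolventOp hz (I_mem_resolventPts hA))).symm

/-- `(1 + A²)^(-1/4)`. -/
def rootCutoff (A : H →ₗ.[ℂ] H) : H →L[ℂ] H := CFC.sqrt (CFC.sqrt (cutoff A))

/-- `(A² (1 + A²)⁻¹)^(1/4)`. -/
def rootCocutoff (A : H →ₗ.[ℂ] H) : H →L[ℂ] H := CFC.sqrt (CFC.sqrt (1 - cutoff A))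

lemma commute_sqrt_sqrt {X Y : H →L[ℂ] H} (h : Commute X Y) :
    Commute (CFC.sqrt (CFC.sqrt X)) Y := (h.cfcₙ_nnreal _).cfcₙ_nnreal _

lemma commute_rootCutoff_resolventOp (hA : IsSelfAdjoint A) {z : ℂ} (hz : z ∈ resolventPts A) :
    Commute (rootCutoff A) (resolventOp A z) := commute_sqrt_sqrt (commute_cutoff hA hz)

lemma commute_rootCocutoff_resolventOp (hA : IsSelfAdjoint A) {z : ℂ}
    (hz : z ∈ resolventPts A) : Commute (rootCocutoff A) (resolventOp A z) :=
  commute_sqrt_sqrt ((Commute.one_left _).sub_left (commute_cutoff hA hz))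

lemma injective_rootCutoff (hA : IsSelfAdjoint A) : Function.Injective (rootCutoff A) := by
  obtain ⟨hB0, -, hBinj, -⟩ := cutoff_facts hA
  intro a b hab
  apply hBinj
  have h : CFC.sqrt (cutoff A) * (rootCutoff A * rootCutoff A) = cutoff A := by
    rw [rootCutoff, CFC.sqrt_mul_sqrt_self (CFC.sqrt (cutoff A)) (CFC.sqrt_nonneg _),
      CFC.sqrt_mul_sqrt_self (cutoff A) hB0]
  rw [← h]
  exact congrArg (fun v => CFC.sqrt (cutoff A) (rootCutoff A v)) hab

lemma mem_graph_absSqrt (hA : IsSelfAdjoint A) {x y : H} :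
    (x, y) ∈ (absSqrt A).graph ↔ ∃ u, rootCutoff A u = x ∧ rootCocutoff A u = y :=
  mem_graph_quotOp (injective_rootCutoff hA)

omit [CompleteSpace H] in
lemma apply_eq_of_mem_graph {T : H →ₗ.[ℂ] H} {x y : H} (h : (x, y) ∈ T.graph) :
    ∃ hx : x ∈ T.domain, T ⟨x, hx⟩ = y :=
  ⟨LinearPMap.mem_domain_of_mem_graph h,
    ((LinearPMap.image_iff (LinearPMap.mem_domain_of_mem_graph h)).2 h).symm⟩

/-- The graph of `|A|^(1/2)` is parametrized by `u ↦ (rootCutoff A u, rootCocutoff A u)`, and both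
operators commute with the resolvent because `cutoff A` does. -/
lemma absSqrt_resolventOp (hA : IsSelfAdjoint A) {z : ℂ} (hz : z ∈ resolventPts A) {x y : H}
    (h : (x, y) ∈ (absSqrt A).graph) :
    (resolventOp A z x, resolventOp A z y) ∈ (absSqrt A).graph := by
  obtain ⟨u, rfl, rfl⟩ := (mem_graph_absSqrt hA).1 h
  refine (mem_graph_absSqrt hA).2 ⟨resolventOp A z u, ?_, ?_⟩
  · exact congrArg (fun T : H →L[ℂ] H => T u) (commute_rootCutoff_resolventOp hA hz).eq
  · exact congrArg (fun T : H →L[ℂ] H => T u) (commute_rootCocutoff_resolventOp hA hz).eq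

/-! ### Eigenvectors -/

/-- With `Y = √X` and `y = √x`, the vector `f = (Y - y) e` satisfies `(Y + y) f = 0`. Nonnegativity
of `Y` and `y` forces `Y f = 0` and `y f = 0`, and then `⟨f, f⟩ = ⟨e, Y f⟩ - y ⟨e, f⟩ = 0`. -/
lemma sqrt_apply_of_apply_eq_smul {X : H →L[ℂ] H} (hX : 0 ≤ X) {x : ℝ} (hx : 0 ≤ x) {e : H}
    (he : X e = (x : ℂ) • e) : CFC.sqrt X e = ((Real.sqrt x : ℝ) : ℂ) • e := by
  set Y := CFC.sqrt X
  set y := Real.sqrt x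
  have hY0 : 0 ≤ Y := CFC.sqrt_nonneg _
  have hYs : ∀ a b : H, inner ℂ (Y a) b = inner ℂ a (Y b) :=
    (IsSelfAdjoint.of_nonneg hY0).isSymmetric
  have hYY : Y (Y e) = (x : ℂ) • e := by
    rw [← he, ← CFC.sqrt_mul_sqrt_self X hX]; rfl
  have hyy : ((y : ℝ) : ℂ) * y = x := by
    rw [← Complex.ofReal_mul, Real.mul_self_sqrt hx]
  set f := Y e - (y : ℂ) • e with hf
  have hfe : Y f = -(y : ℂ) • f := by
    rw [hf, map_sub, map_smul, hYY, ← hyy]; module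
  have h1 : 0 ≤ RCLike.re (inner ℂ (Y f) f) :=
    ((ContinuousLinearMap.nonneg_iff_isPositive _).1 hY0).re_inner_nonneg_left f
  have h2 : Y f = 0 := by
    rw [hfe] at h1 ⊢
    rw [inner_smul_left, inner_self_eq_norm_sq_to_K] at h1
    have h3 : RCLike.re ((starRingEnd ℂ) (-(y : ℂ)) * ((‖f‖ : ℂ)) ^ 2) = -(y * ‖f‖ ^ 2) := by
      rw [map_neg, Complex.conj_ofReal, ← Complex.ofReal_pow, neg_mul, ← Complex.ofReal_mul,
        ← Complex.ofReal_neg]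
      exact Complex.ofReal_re _
    rw [show ((RCLike.ofReal ‖f‖ : ℂ)) = ((‖f‖ : ℝ) : ℂ) from rfl, h3] at h1
    have hy0 : 0 ≤ y := Real.sqrt_nonneg x
    have h4 : y * ‖f‖ ^ 2 = 0 := le_antisymm (by linarith) (by positivity)
    rcases mul_eq_zero.1 h4 with h | h
    · rw [h]; simp
    · rw [norm_eq_zero.1 (pow_eq_zero_iff two_ne_zero |>.1 h), smul_zero]
  have h5 : inner ℂ f f = 0 := by
    have : inner ℂ f f = inner ℂ e (Y f) - (y : ℂ) * inner ℂ e f := by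
      conv_lhs => enter [2]; rw [hf]
      rw [inner_sub_left, inner_smul_left, Complex.conj_ofReal, hYs]
    rw [this, h2, inner_zero_right, zero_sub, neg_eq_zero]
    rw [hfe] at h2
    rcases smul_eq_zero.1 h2 with h | h
    · rw [neg_eq_zero.1 h, zero_mul]
    · rw [h, inner_zero_right, mul_zero]
  exact sub_eq_zero.1 (inner_self_eq_zero.1 h5)

lemma resolventOp_apply_eigSpace {z : ℂ} (hz : z ∈ resolventPts A) {lam : ℝ} {e : H}
    (he : e ∈ eigSpace A lam) : (z - lam) • resolventOp A z e = e := by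
  obtain ⟨hd, hAe⟩ := mem_eigSpace_iff.1 he
  have h := (resolventOp_spec_of_mem hz).2 ⟨e, hd⟩
  rw [hAe] at h
  simp only at h
  rw [← sub_smul, map_smul] at h
  exact h

lemma mem_resolventPts_ne {z : ℂ} (hz : z ∈ resolventPts A) {lam : ℝ}
    (he : eigSpace A lam ≠ ⊥) : z - lam ≠ 0 := by
  obtain ⟨e, he, he0⟩ := (Submodule.ne_bot_iff _).1 he
  intro h
  have := resolventOp_apply_eigSpace hz he
  rw [h, zero_smul] at this
  exact he0 this.symm

lemma cutoff_apply_eigSpace (hA : IsSelfAdjoint A) {lam : ℝ} {e : H}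
    (he : e ∈ eigSpace A lam) : cutoff A e = (((1 + lam ^ 2)⁻¹ : ℝ) : ℂ) • e := by
  have h1 := resolventOp_apply_eigSpace (I_mem_resolventPts hA) he
  have hne : Complex.I - lam ≠ 0 := fun h => by simpa using congrArg Complex.im h
  have hne' : -Complex.I - lam ≠ 0 := fun h => by simpa using congrArg Complex.im h
  have hR : resolventOp A Complex.I e = (Complex.I - lam)⁻¹ • e := by
    rw [eq_inv_smul_iff₀ hne, h1]
  have hT := congrArg (fun T : H →L[ℂ] H => T e) (star_resolventOp_I_mul hA)
  change star (resolventOp A Complex.I) (e - (2 * Complex.I) • resolventOp A Complex.I e) =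
    resolventOp A Complex.I e at hT
  have e1 : e - (2 * Complex.I) • resolventOp A Complex.I e =
      (-Complex.I - lam) • ((Complex.I - lam)⁻¹ • e) := by
    rw [hR, smul_smul, smul_smul]
    have : (-Complex.I - lam) * (Complex.I - lam)⁻¹ =
        1 - 2 * Complex.I * (Complex.I - lam)⁻¹ := by
      field_simp; ring
    rw [this]; module
  rw [e1, map_smul, hR] at hT
  change star (resolventOp A Complex.I) (resolventOp A Complex.I e) = _
  have hT' := (eq_inv_smul_iff₀ hne').2 hT
  rw [hR, hT', smul_smul]
  congr 1
  rw [← mul_inv]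
  push_cast
  congr 1
  linear_combination -Complex.I_sq

lemma rootCutoff_apply_eigSpace (hA : IsSelfAdjoint A) {lam : ℝ} {e : H}
    (he : e ∈ eigSpace A lam) :
    rootCutoff A e = ((Real.sqrt (Real.sqrt (1 + lam ^ 2)⁻¹) : ℝ) : ℂ) • e := by
  have h1 := sqrt_apply_of_apply_eq_smul (cutoff_facts hA).1 (x := (1 + lam ^ 2)⁻¹)
    (by positivity) (cutoff_apply_eigSpace hA he)
  have h0 : 0 ≤ CFC.sqrt (cutoff A) := CFC.sqrt_nonneg _
  exact sqrt_apply_of_apply_eq_smul h0 (Real.sqrt_nonneg _) h1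

lemma rootCocutoff_apply_eigSpace (hA : IsSelfAdjoint A) {lam : ℝ} {e : H}
    (he : e ∈ eigSpace A lam) :
    rootCocutoff A e = ((Real.sqrt (Real.sqrt (1 - (1 + lam ^ 2)⁻¹)) : ℝ) : ℂ) • e := by
  have h1 : (1 + lam ^ 2)⁻¹ ≤ 1 := inv_le_one_of_one_le₀ (by nlinarith [sq_nonneg lam])
  have h2 : (1 - cutoff A) e = ((1 - (1 + lam ^ 2)⁻¹ : ℝ) : ℂ) • e := by
    change e - cutoff A e = _
    rw [cutoff_apply_eigSpace hA he, Complex.ofReal_sub, sub_smul, Complex.ofReal_one, one_smul]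
  have h3 := sqrt_apply_of_apply_eq_smul (cutoff_facts hA).2.1
    (x := 1 - (1 + lam ^ 2)⁻¹) (by linarith) h2
  have h0 : 0 ≤ CFC.sqrt (1 - cutoff A) := CFC.sqrt_nonneg _
  exact sqrt_apply_of_apply_eq_smul h0 (Real.sqrt_nonneg _) h3

lemma absSqrt_eigSpace (hA : IsSelfAdjoint A) {lam : ℝ} {e : H} (he : e ∈ eigSpace A lam) :
    (e, ((Real.sqrt |lam| : ℝ) : ℂ) • e) ∈ (absSqrt A).graph := by
  set k := Real.sqrt (Real.sqrt (1 + lam ^ 2)⁻¹) with hk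
  have hpos : (0 : ℝ) < 1 + lam ^ 2 := by positivity
  have hk0 : (k : ℂ) ≠ 0 := by
    have : 0 < k := Real.sqrt_pos.2 (Real.sqrt_pos.2 (by positivity))
    exact_mod_cast this.ne'
  -- Since `1 - (1 + λ²)⁻¹ = λ² (1 + λ²)⁻¹`, the two fourth roots have ratio `√|λ|`. The parameter
  -- of the graph point over `e` is then `k⁻¹ e`.
  have hc : Real.sqrt (Real.sqrt (1 - (1 + lam ^ 2)⁻¹)) = Real.sqrt |lam| * k := by
    have h1 : 1 - (1 + lam ^ 2)⁻¹ = |lam| ^ 2 * (1 + lam ^ 2)⁻¹ := by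
      rw [sq_abs]; field_simp; ring
    rw [h1, Real.sqrt_mul (by positivity), Real.sqrt_sq (abs_nonneg _),
      Real.sqrt_mul (abs_nonneg _)]
  refine (mem_graph_absSqrt hA).2 ⟨(k : ℂ)⁻¹ • e, ?_, ?_⟩
  · rw [map_smul, rootCutoff_apply_eigSpace hA he, inv_smul_smul₀ hk0]
  · rw [map_smul, rootCocutoff_apply_eigSpace hA he, hc, Complex.ofReal_mul, mul_smul,
      smul_comm, inv_smul_smul₀ hk0]

end Operator

/-! ### The form of a self-adjoint operator -/

section Form

variable {H : Type*} [NormedAddCommGroup H] [InnerProductSpace ℂ H] [CompleteSpace H]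
  {A : H →ₗ.[ℂ] H}

/-- The polar factor is a partial isometry: isometric on the closed range of `|A|` and zero on its
orthogonal complement. -/
lemma norm_polarFactor_apply_le (hA : IsSelfAdjoint A) (y : H) : ‖polarFactor A y‖ ≤ ‖y‖ := by
  obtain ⟨-, -, -, -, -, hiso, hker⟩ := polar_spec hA
  set M := (LinearMap.range (absOp A).toFun).topologicalClosure
  have hM : ∀ m ∈ M, ‖polarFactor A m‖ ≤ ‖m‖ := by
    have hcl : IsClosed {m : H | ‖polarFactor A m‖ ≤ ‖m‖} :=
      isClosed_le (by fun_prop) continuous_norm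
    have hsub : (LinearMap.range (absOp A).toFun : Set H) ⊆
        {m : H | ‖polarFactor A m‖ ≤ ‖m‖} := by
      rintro _ ⟨x, rfl⟩
      exact (hiso x).le
    exact fun m hm => closure_minimal hsub hcl hm
  have h0 : polarFactor A (y - M.starProjection y) = 0 := by
    refine hker _ fun x => ?_
    exact (Submodule.mem_orthogonal _ _).1 (Submodule.sub_starProjection_mem_orthogonal y) _
      (Submodule.le_topologicalClosure _ ⟨x, rfl⟩)
  rw [map_sub, sub_eq_zero] at h0
  rw [h0]
  exact (hM _ (Submodule.starProjection_apply_mem M y)).trans (M.norm_starProjection_apply_le y)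

omit [CompleteSpace H] in
lemma mem_graph_of_mem_eigSpace {lam : ℝ} {e : H} (he : e ∈ eigSpace A lam) :
    (e, (lam : ℂ) • e) ∈ A.graph := by
  obtain ⟨hd, h⟩ := mem_eigSpace_iff.1 he
  rw [← h]
  exact LinearPMap.mem_graph A ⟨e, hd⟩

omit [CompleteSpace H] in
lemma eq_of_mem_graph {T : H →ₗ.[ℂ] H} {x y y' : H} (h : (x, y) ∈ T.graph)
    (h' : (x, y') ∈ T.graph) : y = y' := by
  obtain ⟨hx, rfl⟩ := apply_eq_of_mem_graph h
  obtain ⟨-, rfl⟩ := apply_eq_of_mem_graph h'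
  rfl

/-- Compare the two expressions for `A e`, as `U_A |A| e` and as `λ e`. The factor `|λ|` is kept so
that `λ = 0` needs no exception. -/
lemma polarFactor_eigSpace (hA : IsSelfAdjoint A) {lam : ℝ} {e : H}
    (he : e ∈ eigSpace A lam) : ((|lam| : ℝ) : ℂ) • polarFactor A e = (lam : ℂ) • e := by
  obtain ⟨-, -, habs, hgr, -⟩ := polar_spec hA
  have h1 := absSqrt_eigSpace hA he
  have h2 : (e, ((|lam| : ℝ) : ℂ) • e) ∈ (absOp A).graph := by
    refine (habs _ _).2 ⟨_, h1, ?_⟩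
    have := (absSqrt A).graph.smul_mem ((Real.sqrt |lam| : ℝ) : ℂ) h1
    rw [Prod.smul_mk, smul_smul, ← Complex.ofReal_mul, Real.mul_self_sqrt (abs_nonneg _)] at this
    exact this
  have h3 : (e, ((|lam| : ℝ) : ℂ) • polarFactor A e) ∈ A.graph :=
    (hgr _ _).2 ⟨_, h2, map_smul _ _ _⟩
  exact eq_of_mem_graph h3 (mem_graph_of_mem_eigSpace he)

lemma assocForm_conj_symm (hA : IsSelfAdjoint A) (x y : (absSqrt A).domain) :
    (starRingEnd ℂ) (assocForm A x y) = assocForm A y x := by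
  have hU : ∀ a b : H, inner ℂ (polarFactor A a) b = inner ℂ a (polarFactor A b) :=
    (polar_spec hA).2.2.2.2.1.isSymmetric
  unfold assocForm
  rw [inner_conj_symm, hU]

lemma inner_absSqrt_eigSpace (hA : IsSelfAdjoint A) {lam : ℝ} {e : H}
    (he : e ∈ eigSpace A lam) (y : (absSqrt A).domain) :
    inner ℂ (absSqrt A y) e = ((Real.sqrt |lam| : ℝ) : ℂ) * inner ℂ (y : H) e := by
  obtain ⟨hd, h⟩ := apply_eq_of_mem_graph (absSqrt_eigSpace hA he)
  have hs := isSymmetric_of_isSelfAdjoint (polar_spec hA).2.1.1 y ⟨e, hd⟩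
  rw [h, inner_smul_right] at hs
  exact hs

/-- For `λ ≠ 0`, `U_A` acts as the sign of `λ` and the two factors `√|λ|` recombine. That `y` ranges
over the whole form domain is what later removes cross terms with vectors outside `E`. -/
lemma assocForm_eigSpace (hA : IsSelfAdjoint A) {lam : ℝ} {e : H} (he : e ∈ eigSpace A lam)
    (hd : e ∈ (absSqrt A).domain) (y : (absSqrt A).domain) :
    assocForm A ⟨e, hd⟩ y = (lam : ℂ) * inner ℂ (y : H) e := by
  obtain ⟨_, h⟩ := apply_eq_of_mem_graph (absSqrt_eigSpace hA he)
  unfold assocForm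
  rw [h]
  rcases eq_or_ne lam 0 with rfl | h0
  · simp
  have hU : polarFactor A e = ((lam : ℂ) / ((|lam| : ℝ) : ℂ)) • e := by
    have h1 := polarFactor_eigSpace hA he
    have h2 : ((|lam| : ℝ) : ℂ) ≠ 0 := by simpa using h0
    rw [← eq_inv_smul_iff₀ h2, smul_smul] at h1
    rw [h1, div_eq_inv_mul]
  have h2 : ((|lam| : ℝ) : ℂ) ≠ 0 := by simpa using h0
  rw [map_smul, hU, inner_smul_right, inner_smul_right, inner_absSqrt_eigSpace hA he]
  have h3 : ((Real.sqrt |lam| : ℝ) : ℂ) * ((Real.sqrt |lam| : ℝ) : ℂ) = ((|lam| : ℝ) : ℂ) := by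
    rw [← Complex.ofReal_mul, Real.mul_self_sqrt (abs_nonneg _)]
  calc _ = (((Real.sqrt |lam| : ℝ) : ℂ) * ((Real.sqrt |lam| : ℝ) : ℂ)) * ((lam : ℂ) / ((|lam| : ℝ) : ℂ)) *
        inner ℂ (y : H) e := by ring
    _ = _ := by rw [h3, mul_div_cancel₀ _ h2]

lemma norm_assocForm_self_le (hA : IsSelfAdjoint A) (x : (absSqrt A).domain) :
    ‖assocForm A x x‖ ≤ ‖absSqrt A x‖ ^ 2 := by
  unfold assocForm
  refine (norm_inner_le_norm _ _).trans ?_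
  rw [sq]
  gcongr
  exact norm_polarFactor_apply_le hA _

/-- `‖|A|^(1/2) e‖² = (e, |A| e)`, and `‖|A| e‖ = ‖A e‖` because `U_A` is isometric on the range of
`|A|`. -/
lemma norm_absSqrt_sq_le (hA : IsSelfAdjoint A) (e : A.domain) :
    ∃ he : (e : H) ∈ (absSqrt A).domain, ‖absSqrt A ⟨e, he⟩‖ ^ 2 ≤ ‖A e‖ * ‖(e : H)‖ := by
  obtain ⟨-, ⟨hs, -⟩, habs, hgr, -, hiso, -⟩ := polar_spec hA
  obtain ⟨v, h1, h2⟩ := (hgr _ _).1 (LinearPMap.mem_graph A e)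
  obtain ⟨v', h3, h4⟩ := (habs _ _).1 h1
  obtain ⟨hd1, rfl⟩ := apply_eq_of_mem_graph h1
  obtain ⟨hd3, rfl⟩ := apply_eq_of_mem_graph h3
  obtain ⟨hd4, h4'⟩ := apply_eq_of_mem_graph h4
  refine ⟨hd3, ?_⟩
  have h5 := isSymmetric_of_isSelfAdjoint hs ⟨_, hd3⟩ ⟨_, hd4⟩
  rw [h4', inner_self_eq_norm_sq_to_K] at h5
  have h6 := congrArg norm h5
  rw [norm_pow, RCLike.norm_ofReal, abs_norm] at h6
  rw [h6, ← h2, hiso, mul_comm]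
  exact norm_inner_le_norm _ _

end Form

/-! ### The filter as a function of the resolvent -/

section Filter

variable {H : Type*} [NormedAddCommGroup H] [InnerProductSpace ℂ H] [CompleteSpace H]
  {A : H →ₗ.[ℂ] H}

lemma isStarNormal_resolventOp_I (hA : IsSelfAdjoint A) :
    IsStarNormal (resolventOp A Complex.I) := ⟨(resolvent_basic hA).1.symm⟩

/-- Formally this is `(z - A) R(i)`, with inverse `(i - A) R(z) = 1 - (z - i) R(z)`. -/
lemma isUnit_one_add_smul_resolventOp (hA : IsSelfAdjoint A) {z : ℂ} (hz : z ∈ resolventPts A) :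
    IsUnit (1 + (z - Complex.I) • resolventOp A Complex.I) := by
  have hI := I_mem_resolventPts hA
  have h1 := resolventOp_sub hz hI
  have hc := (commute_resolventOp hz hI).eq
  set R := resolventOp A Complex.I
  set X := resolventOp A z
  have h2 : R - X = (z - Complex.I) • (R * X) := by
    rw [← neg_sub X, h1]; module
  have key : (1 + (z - Complex.I) • R) * (1 - (z - Complex.I) • X) = 1 := by
    rw [add_mul, mul_sub, mul_sub, one_mul, one_mul, mul_one, smul_mul_smul_comm, mul_smul,
      ← h2]
    module
  refine ⟨⟨_, _, key, ?_⟩, rfl⟩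
  have hcX : Commute (1 - (z - Complex.I) • X) ((z - Complex.I) • R) :=
    ((Commute.one_left _).sub_left ((show Commute X R from hc).smul_left _)).smul_right _
  rw [((Commute.one_right _).add_right hcX).eq, key]

/-- The identity `R* - R = 2i R*R` passes through the functional calculus to every spectral point
`ζ` of the normal operator `R = R(i)` and says that `x = i - ζ⁻¹` is real. If `x` were in the
resolvent set, `ζ - R = ζ (1 + (x - i) R)` would be invertible. -/
lemma spectrum_resolventOp_I (hA : IsSelfAdjoint A) {ζ : ℂ}
    (hζ : ζ ∈ spectrum ℂ (resolventOp A Complex.I)) (h0 : ζ ≠ 0) :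
    ∃ x : ℝ, (x : ℂ) ∈ spec A ∧ ζ = (Complex.I - x)⁻¹ := by
  have hN := isStarNormal_resolventOp_I hA
  have hsub := (resolvent_basic hA).2
  set R := resolventOp A Complex.I with hR
  have hcfc : cfc (fun w : ℂ => star w - w - (2 * Complex.I) • (star w * w)) R = 0 := by
    rw [cfc_sub (fun w : ℂ => star w - w) (fun w : ℂ => (2 * Complex.I) • (star w * w)) R,
      cfc_sub (fun w : ℂ => star w) (fun w => w) R, cfc_smul (2 * Complex.I) _ R,
      cfc_mul (fun w : ℂ => star w) (fun w => w) R, cfc_star_id (R := ℂ) R, cfc_id' ℂ R, hsub, cutoff,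
      ← hR, sub_self]
  have him : star ζ - ζ - (2 * Complex.I) • (star ζ * ζ) = 0 := by
    have h1 := cfc_map_spectrum (R := ℂ)
      (fun w : ℂ => star w - w - (2 * Complex.I) • (star w * w)) R
    rw [hcfc] at h1
    have h2 : star ζ - ζ - (2 * Complex.I) • (star ζ * ζ) ∈ spectrum ℂ (0 : H →L[ℂ] H) := by
      rw [h1]; exact ⟨ζ, hζ, rfl⟩
    by_contra hne
    exact h2 (by rw [spectrum.mem_resolventSet_iff, sub_zero]
                 exact (IsUnit.mk0 _ hne).map (algebraMap ℂ (H →L[ℂ] H)))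
  have hs0 : star ζ ≠ 0 := star_ne_zero.2 h0
  have hreal : (starRingEnd ℂ) (Complex.I - ζ⁻¹) = Complex.I - ζ⁻¹ := by
    rw [map_sub, Complex.conj_I, map_inv₀]
    change -Complex.I - (star ζ)⁻¹ = _
    rw [smul_eq_mul] at him
    field_simp
    linear_combination him
  obtain ⟨x, hx⟩ := Complex.conj_eq_iff_real.1 hreal
  have hx' : ζ = (Complex.I - x)⁻¹ := by rw [← hx]; simp
  refine ⟨x, fun hmem => hζ ?_, hx'⟩
  have hu := isUnit_one_add_smul_resolventOp hA hmem
  rw [← hx, sub_sub_cancel_left, ← hR] at hu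
  have h3 : algebraMap ℂ (H →L[ℂ] H) ζ - R = algebraMap ℂ _ ζ * (1 + -ζ⁻¹ • R) := by
    rw [mul_add, mul_one, neg_smul, mul_neg, ← Algebra.smul_def, smul_smul,
      mul_inv_cancel₀ h0, one_smul, sub_eq_add_neg]
  rw [spectrum.mem_resolventSet_iff, h3]
  exact ((IsUnit.mk0 _ h0).map (algebraMap ℂ (H →L[ℂ] H))).mul hu

lemma one_add_mul_ne_zero (hA : IsSelfAdjoint A) {z : ℂ} (hz : z ∈ resolventPts A) {ζ : ℂ}
    (hζ : ζ ∈ spectrum ℂ (resolventOp A Complex.I)) : 1 + (z - Complex.I) * ζ ≠ 0 := by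
  intro h
  have h0 : ζ ≠ 0 := by rintro rfl; simp at h
  obtain ⟨x, hx, rfl⟩ := spectrum_resolventOp_I hA hζ h0
  have hne : Complex.I - x ≠ 0 := fun h => by simp [h] at h0
  have : z = x := by
    field_simp at h
    linear_combination h
  exact hx (this ▸ hz)

lemma continuousOn_resolvent_symbol (hA : IsSelfAdjoint A) {z : ℂ} (hz : z ∈ resolventPts A) :
    ContinuousOn (fun ζ : ℂ => ζ * (1 + (z - Complex.I) * ζ)⁻¹)
      (spectrum ℂ (resolventOp A Complex.I)) :=
  continuousOn_id.mul (ContinuousOn.inv₀ (by fun_prop) fun _ hζ => one_add_mul_ne_zero hA hz hζ)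

/-- For `ζ = (i - x)⁻¹` the symbol equals `(z - x)⁻¹`. In the variable `ζ` the point at infinity of
the spectrum of `A` becomes `ζ = 0`. -/
lemma resolventOp_eq_cfc (hA : IsSelfAdjoint A) {z : ℂ} (hz : z ∈ resolventPts A) :
    resolventOp A z =
      cfc (fun ζ : ℂ => ζ * (1 + (z - Complex.I) * ζ)⁻¹) (resolventOp A Complex.I) := by
  have hN := isStarNormal_resolventOp_I hA
  have hI := I_mem_resolventPts hA
  have hu := isUnit_one_add_smul_resolventOp hA hz
  have h1 := resolventOp_sub hI hz
  have hcont := continuousOn_resolvent_symbol hA hz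
  set R := resolventOp A Complex.I
  set X := resolventOp A z
  have h2 : X * (1 + (z - Complex.I) • R) = R := by
    rw [mul_add, mul_one, mul_smul_comm, ← h1]; abel
  have h3 : cfc (fun ζ : ℂ => 1 + (z - Complex.I) * ζ) R = 1 + (z - Complex.I) • R := by
    rw [cfc_add R (fun _ : ℂ => (1 : ℂ)) (fun ζ => (z - Complex.I) * ζ), cfc_const_one ℂ R,
      cfc_const_mul_id (z - Complex.I) R]
  have h4 : cfc (fun ζ : ℂ => ζ * (1 + (z - Complex.I) * ζ)⁻¹) R *
      (1 + (z - Complex.I) • R) = R := by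
    rw [← h3, ← cfc_mul _ _ R hcont (by fun_prop)]
    conv_rhs => rw [← cfc_id' ℂ R]
    apply cfc_congr
    intro ζ hζ
    have := one_add_mul_ne_zero hA hz hζ
    simp only
    rw [mul_assoc, inv_mul_cancel₀ this, mul_one]
  exact hu.mul_right_cancel (h2.trans h4.symm)

/-- The filter `w_N + ∑ w_k R(z_k)` as an operator on `H`. -/
def hilbertFilter (A : H →ₗ.[ℂ] H) {N : ℕ} (wN : ℂ) (w z : Fin N → ℂ) : H →L[ℂ] H :=
  wN • 1 + ∑ k, w k • resolventOp A (z k)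

/-- The filter as a function of a spectral value of `R(i)`. -/
def filterSymbol {N : ℕ} (wN : ℂ) (w z : Fin N → ℂ) (ζ : ℂ) : ℂ :=
  wN + ∑ k, w k * (ζ * (1 + (z k - Complex.I) * ζ)⁻¹)

lemma filterSymbol_zero {N : ℕ} (wN : ℂ) (w z : Fin N → ℂ) : filterSymbol wN w z 0 = wN := by
  simp [filterSymbol]

lemma filterSymbol_inv {N : ℕ} (wN : ℂ) (w z : Fin N → ℂ) (x : ℝ) :
    filterSymbol wN w z (Complex.I - x)⁻¹ = ratFilter wN w z x := by
  have hne : Complex.I - x ≠ 0 := fun h => by simpa using congrArg Complex.im h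
  unfold filterSymbol ratFilter
  congr 1
  refine Finset.sum_congr rfl fun k _ => ?_
  congr 1
  rw [← mul_inv]
  congr 1
  field_simp
  ring

lemma continuousOn_filterSymbol (hA : IsSelfAdjoint A) {N : ℕ} (wN : ℂ) (w z : Fin N → ℂ)
    (hz : ∀ k, z k ∈ resolventPts A) :
    ContinuousOn (filterSymbol wN w z) (spectrum ℂ (resolventOp A Complex.I)) := by
  unfold filterSymbol
  exact continuousOn_const.add (continuousOn_finsetSum _ fun k _ =>
    continuousOn_const.mul (continuousOn_resolvent_symbol hA (hz k)))

lemma hilbertFilter_eq_cfc (hA : IsSelfAdjoint A) {N : ℕ} (wN : ℂ) (w z : Fin N → ℂ)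
    (hz : ∀ k, z k ∈ resolventPts A) :
    hilbertFilter A wN w z = cfc (filterSymbol wN w z) (resolventOp A Complex.I) := by
  have hN := isStarNormal_resolventOp_I hA
  have hc := fun k => continuousOn_resolvent_symbol hA (hz k)
  have hc' : ∀ k, ContinuousOn (fun ζ : ℂ => w k * (ζ * (1 + (z k - Complex.I) * ζ)⁻¹))
      (spectrum ℂ (resolventOp A Complex.I)) := fun k => continuousOn_const.mul (hc k)
  unfold filterSymbol hilbertFilter
  rw [cfc_const_add wN _ _ (continuousOn_finsetSum _ fun k _ => hc' k), Algebra.smul_def, mul_one]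
  congr 1
  have h := cfc_sum (R := ℂ) (fun (k : Fin N) (ζ : ℂ) => w k * (ζ * (1 + (z k - Complex.I) * ζ)⁻¹))
    (resolventOp A Complex.I) Finset.univ (fun k _ => hc' k)
  have e : (∑ k : Fin N, fun ζ : ℂ => w k * (ζ * (1 + (z k - Complex.I) * ζ)⁻¹)) =
      fun ζ : ℂ => ∑ k, w k * (ζ * (1 + (z k - Complex.I) * ζ)⁻¹) := by
    ext ζ; simp
  rw [e] at h
  rw [h]
  refine Finset.sum_congr rfl fun k _ => ?_
  rw [cfc_const_mul _ _ _ (hc k), ← resolventOp_eq_cfc hA (hz k)]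

end Filter

/-! ### Bounds for the filter on the complement of the cluster -/

section FilterBound

variable {H : Type*} [NormedAddCommGroup H] [InnerProductSpace ℂ H] [CompleteSpace H]
  {A : H →ₗ.[ℂ] H} {Lam : Set ℝ} {N : ℕ} {wN : ℂ} {w z : Fin N → ℂ} {y γ δ : ℝ}

lemma I_sub_ofReal_ne_zero (x : ℝ) : Complex.I - (x : ℂ) ≠ 0 :=
  fun h => by simpa using congrArg Complex.im h

omit [CompleteSpace H] in
lemma FilterSeparates.node_mem (h : FilterSeparates A Lam wN w z y γ δ) (k : Fin N) :
    z k ∈ resolventPts A := by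
  by_contra hk
  exact h.node k (subset_closure hk)

omit [CompleteSpace H] in
lemma FilterSeparates.node_ne (h : FilterSeparates A Lam wN w z y γ δ) (k : Fin N) {x : ℝ}
    (hx : (x : ℂ) ∈ spec A) : z k ≠ (x : ℂ) := by
  intro hk
  exact hx (hk ▸ h.node_mem k)

lemma mem_spec_of_eigSpace_ne_bot {lam : ℝ} (h : eigSpace A lam ≠ ⊥) : (lam : ℂ) ∈ spec A :=
  fun hmem => mem_resolventPts_ne hmem h (sub_self _)

lemma tendsto_ratFilter (wN : ℂ) (w z : Fin N → ℂ) :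
    Tendsto (fun x : ℝ => ratFilter wN w z (x : ℂ)) atTop (𝓝 wN) := by
  have hcob : Tendsto (fun x : ℝ => (x : ℂ)) atTop (Bornology.cobounded ℂ) := by
    rw [← tendsto_norm_atTop_iff_cobounded]
    simpa using tendsto_abs_atTop_atTop
  have h : ∀ k, Tendsto (fun x : ℝ => w k * (z k - (x : ℂ))⁻¹) atTop (𝓝 0) := by
    intro k
    have h1 : Tendsto (fun x : ℝ => z k - (x : ℂ)) atTop (Bornology.cobounded ℂ) := by
      have h2 := (tendsto_const_sub_cobounded (z k)).comp hcob
      exact h2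
    have := (tendsto_inv₀_cobounded.comp h1).const_mul (w k)
    simpa using this
  have := (tendsto_finsetSum Finset.univ fun k _ => h k).const_add wN
  simpa [ratFilter] using this

lemma eventually_ne_node (z : Fin N → ℂ) : ∀ᶠ x : ℝ in atTop, ∀ k, z k ≠ (x : ℂ) := by
  rw [eventually_all]
  intro k
  filter_upwards [eventually_gt_atTop (z k).re] with x hx h
  rw [h] at hx
  simp at hx

/-- The bound `s` is the supremum over the outer set. Spectral points are never nodes, so omitting
the nodes from the supremum and infimum loses nothing here. The bound on `wN` covers the value of
the filter at infinity. -/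
lemma FilterSeparates.exists_bound (h : FilterSeparates A Lam wN w z y γ δ)
    (hLam : IsEigenCluster A Lam) : ∃ s : ℝ, 0 ≤ s ∧ ‖wN‖ ≤ s ∧
      (∀ x : ℝ, (x : ℂ) ∈ spec A → x ∉ Lam → ‖ratFilter wN w z x‖ ≤ s) ∧
      ∀ lam ∈ Lam, s < ‖ratFilter wN w z lam‖ := by
  set S := filterSup wN w z (outerSet y γ δ) with hS
  set L := filterInf wN w z (innerInterval y γ) with hL
  have hLle : ∀ lam ∈ Lam, L ≤ ‖ratFilter wN w z lam‖ₑ := fun lam hlam =>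
    iInf₂_le (f := fun (x : ℝ) _ => ‖ratFilter wN w z (x : ℂ)‖ₑ) lam
      ⟨h.cluster hlam, fun k => h.node_ne k (mem_spec_of_eigSpace_ne_bot (hLam.eigenvalue _ hlam))⟩
  obtain ⟨lam₀, hlam₀⟩ := hLam.nonempty
  -- A point of the cluster makes the infimum finite. Only then can the denominator be cleared in
  -- the extended reals.
  have hLtop : L ≠ ⊤ := ((hLle _ hlam₀).trans_lt enorm_lt_top).ne
  have hSL : S < L := by
    have h1 := h.contraction
    rwa [← hS, ← hL, ENNReal.div_lt_iff (Or.inl h.inf_pos.ne') (Or.inl hLtop), one_mul] at h1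
  have hStop : S ≠ ⊤ := hSL.ne_top
  have hout : ∀ x ∈ outerSet y γ δ, (∀ k, z k ≠ (x : ℂ)) → ‖ratFilter wN w z x‖ ≤ S.toReal := by
    intro x hx hk
    have : ‖ratFilter wN w z x‖ₑ ≤ S :=
      le_iSup₂ (f := fun (x : ℝ) (_ : x ∈ {x ∈ outerSet y γ δ | ∀ k, z k ≠ (x : ℂ)}) =>
        ‖ratFilter wN w z (x : ℂ)‖ₑ) x ⟨hx, hk⟩
    rw [← toReal_enorm]
    exact ENNReal.toReal_mono hStop this
  refine ⟨S.toReal, ENNReal.toReal_nonneg, ?_, ?_, ?_⟩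
  -- The outer set contains all large reals, along which the filter tends to `wN`.
  · refine le_of_tendsto (tendsto_ratFilter wN w z).norm ?_
    filter_upwards [eventually_ne_node z, eventually_ge_atTop (y + (1 + δ) * γ)] with x hx hxy
    refine hout x ?_ hx
    change (1 + δ) * γ ≤ |x - y|
    exact le_trans (by linarith) (le_abs_self _)
  · intro x hx hxL
    exact hout x (h.rest x hx hxL) fun k => h.node_ne k hx
  · intro lam hlam
    rw [← toReal_enorm]
    exact (ENNReal.toReal_lt_toReal hStop enorm_ne_top).2 (hSL.trans_le (hLle _ hlam))

/-- The separating functions of the cluster. -/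
lemma exists_separating_functions (hLam : Lam.Finite) (hγ : 0 < γ) (hδ : 0 < δ)
    (hcl : Lam ⊆ innerInterval y γ) (lam : ℝ) (hlam : lam ∈ Lam) :
    ∃ f : C(ℂ, ℝ), f (Complex.I - lam)⁻¹ = 1 ∧
      (∀ μ ∈ Lam, μ ≠ lam → f (Complex.I - μ)⁻¹ = 0) ∧ f 0 = 0 ∧
      ∀ x ∈ outerSet y γ δ, f (Complex.I - x)⁻¹ = 0 := by
  -- A closed set that contains `0` and whose points `(i - x)⁻¹` are those with `|x - y| ≥ (1 + δ)
  -- γ`, because `|(i - y) ζ - 1| = |x - y| |ζ|` there. Urysohn's lemma then separates one cluster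
  -- point from `T` and the other cluster points.
  set T : Set ℂ := {ζ | (1 + δ) * γ * ‖ζ‖ ≤ ‖(Complex.I - y) * ζ - 1‖}
  have hT : IsClosed T := isClosed_le (by fun_prop) (by fun_prop)
  have hF : IsClosed ((fun μ : ℝ => (Complex.I - (μ : ℂ))⁻¹) '' (Lam \ {lam})) :=
    ((hLam.subset sdiff_subset).image _).isClosed
  have hnorm : ∀ x : ℝ, ‖(Complex.I - y) * (Complex.I - x)⁻¹ - 1‖ =
      |x - y| * ‖(Complex.I - (x : ℂ))⁻¹‖ := by
    intro x
    have : (Complex.I - y) * (Complex.I - x)⁻¹ - 1 =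
        ((x - y : ℝ) : ℂ) * (Complex.I - (x : ℂ))⁻¹ := by
      have := I_sub_ofReal_ne_zero x
      push_cast
      field_simp
      ring
    rw [this, norm_mul, Complex.norm_real, Real.norm_eq_abs]
  have hdisj : Disjoint (T ∪ (fun μ : ℝ => (Complex.I - (μ : ℂ))⁻¹) '' (Lam \ {lam}))
      {(Complex.I - (lam : ℂ))⁻¹} := by
    rw [disjoint_singleton_right]
    rintro (h | ⟨μ, ⟨-, hμ⟩, h⟩)
    · have h1 : (1 + δ) * γ * ‖(Complex.I - (lam : ℂ))⁻¹‖ ≤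
        ‖(Complex.I - y) * (Complex.I - (lam : ℂ))⁻¹ - 1‖ := h
      rw [hnorm] at h1
      have h2 := le_of_mul_le_mul_right h1
        (norm_pos_iff.2 (inv_ne_zero (I_sub_ofReal_ne_zero lam)))
      have h3 : |lam - y| ≤ γ := hcl hlam
      nlinarith
    · have := inv_injective h
      exact hμ (Complex.ofReal_injective (sub_right_injective this))
  obtain ⟨f, h0, h1, -⟩ := exists_continuous_zero_one_of_isClosed (hT.union hF)
    isClosed_singleton hdisj
  refine ⟨f, h1 rfl, fun μ hμ hne => h0 (Or.inr ⟨μ, ⟨hμ, hne⟩, rfl⟩), h0 (Or.inl ?_),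
    fun x hx => h0 (Or.inl ?_)⟩
  · change (1 + δ) * γ * ‖(0 : ℂ)‖ ≤ ‖(Complex.I - y) * 0 - 1‖
    simp
  · change (1 + δ) * γ * ‖(Complex.I - (x : ℂ))⁻¹‖ ≤
      ‖(Complex.I - y) * (Complex.I - (x : ℂ))⁻¹ - 1‖
    rw [hnorm]
    have : (1 + δ) * γ ≤ |x - y| := hx
    gcongr

lemma mem_eigSpace_of_resolventOp_I_apply (hA : IsSelfAdjoint A) {lam : ℝ} {v : H}
    (h : resolventOp A Complex.I v = (Complex.I - (lam : ℂ))⁻¹ • v) : v ∈ eigSpace A lam := by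
  have hne := I_sub_ofReal_ne_zero lam
  have hv : v = (Complex.I - (lam : ℂ)) • resolventOp A Complex.I v := by
    rw [h, smul_inv_smul₀ hne]
  obtain ⟨hd, hxe⟩ := (resolventOp_spec_of_mem (I_mem_resolventPts hA)).1 v
  rw [hv]
  refine Submodule.smul_mem _ _ (mem_eigSpace_iff.2 ⟨hd, ?_⟩)
  have h1 := eq_sub_of_add_eq' (sub_eq_iff_eq_add.1 hxe).symm
  rw [h1]
  nth_rewrite 2 [hv]
  module

/-- On the spectrum `f` lives at the single point `c = (i - λ)⁻¹`, so `ζ f(ζ) = c f(ζ)` there and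
`R(i)` acts as `c` on the range of `f(R(i))`. -/
lemma cfc_apply_mem_eigSpace (hA : IsSelfAdjoint A) {lam : ℝ} {f : C(ℂ, ℝ)}
    (hf : ∀ ζ ∈ spectrum ℂ (resolventOp A Complex.I), ζ ≠ (Complex.I - (lam : ℂ))⁻¹ → f ζ = 0)
    (v : H) : cfc (fun ζ : ℂ => (f ζ : ℂ)) (resolventOp A Complex.I) v ∈ eigSpace A lam := by
  have hN := isStarNormal_resolventOp_I hA
  apply mem_eigSpace_of_resolventOp_I_apply hA
  set R := resolventOp A Complex.I
  set c := (Complex.I - (lam : ℂ))⁻¹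
  have h1 : cfc (fun ζ : ℂ => ζ * (f ζ : ℂ)) R = cfc (fun ζ : ℂ => c * (f ζ : ℂ)) R := by
    apply cfc_congr
    intro ζ hζ
    by_cases h : ζ = c
    · simp [h]
    · simp [hf ζ hζ h]
  rw [cfc_mul (fun ζ : ℂ => ζ) (fun ζ : ℂ => (f ζ : ℂ)) R, cfc_id' ℂ R,
    cfc_const_mul c (fun ζ : ℂ => (f ζ : ℂ)) R] at h1
  exact congrArg (fun T : H →L[ℂ] H => T v) h1

/-- Each `f_λ(R(i))` is self-adjoint with range in the cluster space, so it kills `v`. On the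
spectrum, `χ = ∑ f_λ` is the indicator of the cluster; subtracting the filter times `χ` does not
change the action on `v` and leaves a symbol bounded by `s`. -/
lemma norm_hilbertFilter_apply_le (hA : IsSelfAdjoint A) (hLam : IsEigenCluster A Lam)
    (h : FilterSeparates A Lam wN w z y γ δ) {s : ℝ} (hs0 : 0 ≤ s) (hwN : ‖wN‖ ≤ s)
    (hs : ∀ x : ℝ, (x : ℂ) ∈ spec A → x ∉ Lam → ‖ratFilter wN w z x‖ ≤ s)
    {v : H} (hv : ∀ e ∈ clusterSpace A Lam, inner ℂ e v = 0) :
    ‖hilbertFilter A wN w z v‖ ≤ s * ‖v‖ := by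
  have hN := isStarNormal_resolventOp_I hA
  have hg := continuousOn_filterSymbol hA wN w z h.node_mem
  have hSg := hilbertFilter_eq_cfc hA wN w z h.node_mem
  choose! f hf1 hf2 hf0 hfo using
    exists_separating_functions hLam.finite h.γ_pos h.δ_pos h.cluster
  have hcase : ∀ ζ ∈ spectrum ℂ (resolventOp A Complex.I), ζ = 0 ∨
      (∃ x : ℝ, x ∈ Lam ∧ ζ = (Complex.I - x)⁻¹) ∨
      ∃ x : ℝ, (x : ℂ) ∈ spec A ∧ x ∉ Lam ∧ ζ = (Complex.I - x)⁻¹ := by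
    intro ζ hζ
    rcases eq_or_ne ζ 0 with h0 | h0
    · exact Or.inl h0
    obtain ⟨x, hx, rfl⟩ := spectrum_resolventOp_I hA hζ h0
    by_cases hxL : x ∈ Lam
    · exact Or.inr (Or.inl ⟨x, hxL, rfl⟩)
    · exact Or.inr (Or.inr ⟨x, hx, hxL, rfl⟩)
  set R := resolventOp A Complex.I
  have hzero : ∀ lam ∈ Lam, cfc (fun ζ : ℂ => (f lam ζ : ℂ)) R v = 0 := by
    intro lam hlam
    have hmem : ∀ u, cfc (fun ζ : ℂ => (f lam ζ : ℂ)) R u ∈ clusterSpace A Lam := by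
      intro u
      refine Submodule.mem_iSup_of_mem lam (Submodule.mem_iSup_of_mem hlam ?_)
      refine cfc_apply_mem_eigSpace hA (fun ζ hζ hne => ?_) u
      rcases hcase ζ hζ with rfl | ⟨x, hx, rfl⟩ | ⟨x, hx, hxL, rfl⟩
      · exact hf0 lam hlam
      · exact hf2 lam hlam x hx fun h => hne (by rw [h])
      · exact hfo lam hlam x (h.rest x hx hxL)
    have hself : star (cfc (fun ζ : ℂ => (f lam ζ : ℂ)) R) =
        cfc (fun ζ : ℂ => (f lam ζ : ℂ)) R := by
      rw [← cfc_star]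
      congr 1
      ext ζ
      exact Complex.conj_ofReal _
    rw [← inner_self_eq_zero (𝕜 := ℂ)]
    have h1 := (show IsSelfAdjoint (cfc (fun ζ : ℂ => (f lam ζ : ℂ)) R) from hself).isSymmetric
      (cfc (fun ζ : ℂ => (f lam ζ : ℂ)) R v) v
    exact h1.symm.trans (hv _ (hmem _))
  set χ : ℂ → ℂ := fun ζ => ∑ lam ∈ hLam.finite.toFinset, (f lam ζ : ℂ) with hχ
  have hχc : ContinuousOn χ (spectrum ℂ R) :=
    continuousOn_finsetSum _ fun lam _ => by fun_prop
  have hχv : cfc χ R v = 0 := by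
    have e : χ = ∑ lam ∈ hLam.finite.toFinset, fun ζ : ℂ => (f lam ζ : ℂ) := by
      ext ζ; simp [hχ]
    rw [e, cfc_sum (R := ℂ) (fun (lam : ℝ) (ζ : ℂ) => (f lam ζ : ℂ)) R hLam.finite.toFinset
      (fun lam _ => by fun_prop), sum_apply]
    exact Finset.sum_eq_zero fun lam hlam => hzero lam (hLam.finite.mem_toFinset.1 hlam)
  have hkey : hilbertFilter A wN w z v =
      cfc (fun ζ => filterSymbol wN w z ζ - filterSymbol wN w z ζ * χ ζ) R v := by
    rw [cfc_sub (filterSymbol wN w z) (fun ζ => filterSymbol wN w z ζ * χ ζ) R hg (hg.mul hχc),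
      cfc_mul (filterSymbol wN w z) χ R hg hχc, ← hSg]
    change _ = hilbertFilter A wN w z v - hilbertFilter A wN w z (cfc χ R v)
    rw [hχv, map_zero, sub_zero]
  rw [hkey]
  refine ContinuousLinearMap.le_of_opNorm_le _ (norm_cfc_le hs0 fun ζ hζ => ?_) v
  rcases hcase ζ hζ with rfl | ⟨x, hx, rfl⟩ | ⟨x, hx, hxL, rfl⟩
  · have : χ 0 = 0 := Finset.sum_eq_zero fun lam hlam => by
      rw [hf0 lam (hLam.finite.mem_toFinset.1 hlam), Complex.ofReal_zero]
    rw [this, mul_zero, sub_zero, filterSymbol_zero]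
    exact hwN
  · have : χ (Complex.I - x)⁻¹ = 1 := by
      rw [hχ]
      simp only
      rw [Finset.sum_eq_single x]
      · rw [hf1 x hx, Complex.ofReal_one]
      · intro lam hlam hne
        rw [hf2 lam (hLam.finite.mem_toFinset.1 hlam) x hx hne.symm, Complex.ofReal_zero]
      · intro hn
        exact absurd (hLam.finite.mem_toFinset.2 hx) hn
    rw [this, mul_one, sub_self, norm_zero]
    exact hs0
  · have : χ (Complex.I - x)⁻¹ = 0 := Finset.sum_eq_zero fun lam hlam => by
      rw [hfo lam (hLam.finite.mem_toFinset.1 hlam) x (h.rest x hx hxL), Complex.ofReal_zero]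
    rw [this, mul_zero, sub_zero, filterSymbol_inv]
    exact hs x hx hxL

end FilterBound

/-! ### Comparison of eigenvalues of symmetric operators on finite-dimensional spaces -/

section Comparison

variable {E F : Type*} [NormedAddCommGroup E] [InnerProductSpace ℂ E] [FiniteDimensional ℂ E]
  [NormedAddCommGroup F] [InnerProductSpace ℂ F]

/-- The quadratic form of a symmetric operator on a partial sum of an eigenbasis expansion. -/
lemma inner_eigenvector_sum {L : E →ₗ[ℂ] E} (hL : L.IsSymmetric) {n : ℕ}
    (hn : Module.finrank ℂ E = n) (s : Finset (Fin n)) (c : Fin n → ℂ) :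
    (inner ℂ (L (∑ i ∈ s, c i • hL.eigenvectorBasis hn i))
        (∑ i ∈ s, c i • hL.eigenvectorBasis hn i)).re =
      ∑ i ∈ s, hL.eigenvalues hn i * ‖c i‖ ^ 2 ∧
    ‖∑ i ∈ s, c i • hL.eigenvectorBasis hn i‖ ^ 2 = ∑ i ∈ s, ‖c i‖ ^ 2 := by
  set b := hL.eigenvectorBasis hn
  have hb := b.orthonormal
  have hLe : L (∑ i ∈ s, c i • b i) =
      ∑ i ∈ s, (c i * (hL.eigenvalues hn i : ℂ)) • b i := by
    rw [map_sum]
    refine Finset.sum_congr rfl fun i _ => ?_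
    rw [map_smul, hL.apply_eigenvectorBasis, smul_smul]
    rfl
  constructor
  · rw [hLe, hb.inner_sum, Complex.re_sum]
    refine Finset.sum_congr rfl fun i _ => ?_
    rw [map_mul, Complex.conj_ofReal, mul_right_comm, Complex.conj_mul', mul_comm,
      ← Complex.ofReal_pow, ← Complex.ofReal_mul, Complex.ofReal_re]
  · have h := hb.inner_sum c c s
    rw [inner_self_eq_norm_sq_to_K] at h
    have h2 : ∑ i ∈ s, (starRingEnd ℂ) (c i) * c i = ((∑ i ∈ s, ‖c i‖ ^ 2 : ℝ) : ℂ) := by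
      push_cast
      exact Finset.sum_congr rfl fun i _ => Complex.conj_mul' _
    rw [h2] at h
    exact Complex.ofReal_injective (by rw [Complex.ofReal_pow]; exact h)

/-- If `L` had no eigenvalue within `d` of `μ`, split `T x`, for an eigenvector `x` of `K`, into its
spectral parts below `μ - d` and above `μ + d`. The form `q` of `K - μ` is negative on the preimage
of the first part and positive on that of the second, yet takes the same value on both because they
add up to `x`. No min-max principle or ordering of eigenvalues is needed. -/
lemma exists_hasEigenvalue_near (T : F ≃ₗ[ℂ] E) {K : F →ₗ[ℂ] F} {L : E →ₗ[ℂ] E}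
    (hK : K.IsSymmetric) (hL : L.IsSymmetric) {μ d : ℝ}
    (hμ : Module.End.HasEigenvalue K (μ : ℂ))
    (hlow : ∀ x, (inner ℂ (L (T x)) (T x)).re < (μ - d) * ‖T x‖ ^ 2 →
      (inner ℂ (K x) x).re < μ * ‖x‖ ^ 2)
    (hhigh : ∀ x, (μ + d) * ‖T x‖ ^ 2 < (inner ℂ (L (T x)) (T x)).re →
      μ * ‖x‖ ^ 2 < (inner ℂ (K x) x).re) :
    ∃ lam : ℝ, Module.End.HasEigenvalue L (lam : ℂ) ∧ |lam - μ| ≤ d := by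
  by_contra! hcon
  obtain ⟨x, hx⟩ := hμ.exists_hasEigenvector
  have hKx : K x = (μ : ℂ) • x := hx.apply_eq_smul
  obtain ⟨n, hn⟩ : ∃ n, Module.finrank ℂ E = n := ⟨_, rfl⟩
  set b := hL.eigenvectorBasis hn
  set lam := hL.eigenvalues hn
  have hfar : ∀ i, d < |lam i - μ| := fun i => hcon _ (hL.hasEigenvalue_eigenvalues hn i)
  set c : Fin n → ℂ := fun i => b.repr (T x) i
  set s : Finset (Fin n) := Finset.univ.filter fun i => lam i < μ
  set t : Finset (Fin n) := Finset.univ.filter fun i => ¬ lam i < μ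
  set em := ∑ i ∈ s, c i • b i with hem
  set ep := ∑ i ∈ t, c i • b i with hep
  have hsum : em + ep = T x := by
    rw [hem, hep, Finset.sum_filter_add_sum_filter_not]
    exact b.sum_repr (T x)
  have hex : ∀ r : Finset (Fin n), ∑ i ∈ r, c i • b i ≠ 0 → ∃ i ∈ r, 0 < ‖c i‖ ^ 2 := by
    intro r hr
    obtain ⟨i, hi, hne⟩ := Finset.exists_ne_zero_of_sum_ne_zero hr
    have : c i ≠ 0 := fun h => hne (by rw [h, zero_smul])
    exact ⟨i, hi, by positivity⟩
  set q : F → ℝ := fun u => (inner ℂ (K u) u).re - μ * ‖u‖ ^ 2 with hq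
  have hqm : em ≠ 0 → q (T.symm em) < 0 := by
    intro h0
    obtain ⟨i, hi, hci⟩ := hex s h0
    obtain ⟨h1, h2⟩ := inner_eigenvector_sum hL hn s c
    refine sub_neg.2 (hlow _ ?_)
    rw [T.apply_symm_apply]
    rw [h1, h2, Finset.mul_sum]
    have hlt : ∀ i ∈ s, lam i < μ - d := by
      intro i hi
      have h3 : lam i < μ := (Finset.mem_filter.1 hi).2
      have h4 := hfar i
      rw [abs_of_neg (by linarith)] at h4
      linarith
    exact Finset.sum_lt_sum (fun i hi => by gcongr; exact (hlt i hi).le)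
      ⟨i, hi, mul_lt_mul_of_pos_right (hlt i hi) hci⟩
  have hqp : ep ≠ 0 → 0 < q (T.symm ep) := by
    intro h0
    obtain ⟨i, hi, hci⟩ := hex t h0
    obtain ⟨h1, h2⟩ := inner_eigenvector_sum hL hn t c
    refine sub_pos.2 (hhigh _ ?_)
    rw [T.apply_symm_apply]
    rw [h1, h2, Finset.mul_sum]
    have hlt : ∀ i ∈ t, μ + d < lam i := by
      intro i hi
      have h3 : μ ≤ lam i := not_lt.1 (Finset.mem_filter.1 hi).2
      have h4 := hfar i
      rw [abs_of_nonneg (by linarith)] at h4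
      linarith
    exact Finset.sum_lt_sum (fun i hi => by gcongr; exact (hlt i hi).le)
      ⟨i, hi, mul_lt_mul_of_pos_right (hlt i hi) hci⟩
  -- From `(K - μ)(u + v) = 0` and symmetry, both `q u` and `q v` equal minus the real part of `⟨(K
  -- - μ) u, v⟩`.
  have hqeq : q (T.symm em) = q (T.symm ep) := by
    have hxx : T.symm em + T.symm ep = x := by
      rw [← map_add, hsum, T.symm_apply_apply]
    generalize T.symm em = u at *
    generalize T.symm ep = v at *
    have h1 : K u + K v = (μ : ℂ) • u + (μ : ℂ) • v := by
      rw [← map_add, ← smul_add, hxx, hKx]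
    have e1 := congrArg (fun a => (inner ℂ a u).re) h1
    have e2 := congrArg (fun a => (inner ℂ a v).re) h1
    have hnn : ∀ a : F, (inner ℂ a a).re = ‖a‖ ^ 2 := fun a => inner_self_eq_norm_sq (𝕜 := ℂ) a
    simp only [inner_add_left, inner_smul_left, Complex.conj_ofReal, Complex.add_re,
      Complex.re_ofReal_mul, hnn] at e1 e2
    have h2 : (inner ℂ (K v) u).re = (inner ℂ (K u) v).re := by
      rw [hK v u]; exact inner_re_symm (𝕜 := ℂ) _ _
    have h3 : (inner ℂ v u).re = (inner ℂ u v).re := inner_re_symm (𝕜 := ℂ) _ _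
    simp only [hq]
    rw [h2, h3] at e1
    linarith
  have hz : T x = 0 := by
    by_cases h1 : em = 0
    · by_cases h2 : ep = 0
      · rw [← hsum, h1, h2, add_zero]
      · have := hqp h2
        rw [← hqeq, h1] at this
        simp [hq] at this
    · have h3 := hqm h1
      by_cases h2 : ep = 0
      · rw [hqeq, h2] at h3
        simp [hq] at h3
      · have := hqp h2
        linarith
  exact hx.2 (T.map_eq_zero_iff.1 hz)

variable [FiniteDimensional ℂ F] (T : F ≃ₗ[ℂ] E) {K : F →ₗ[ℂ] F} {L : E →ₗ[ℂ] E} {D N G : ℝ}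

/-- Eigenvalues of symmetric operators with close quadratic forms are close. -/
lemma eigenvalues_near (hK : K.IsSymmetric) (hL : L.IsSymmetric) (hN0 : 0 ≤ N)
    (hKL : ∀ x, |(inner ℂ (K x) x).re - (inner ℂ (L (T x)) (T x)).re| ≤ D * ‖x‖ ^ 2)
    (hT : ∀ x, ‖T x‖ ^ 2 ≤ ‖x‖ ^ 2) (hG : ∀ x, ‖x‖ ^ 2 - ‖T x‖ ^ 2 ≤ G * ‖x‖ ^ 2)
    (hN : ∀ e, |(inner ℂ (L e) e).re| ≤ N * ‖e‖ ^ 2) :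
    (∀ μ : ℝ, Module.End.HasEigenvalue K (μ : ℂ) →
      ∃ lam : ℝ, Module.End.HasEigenvalue L (lam : ℂ) ∧ |lam - μ| ≤ D + N * G) ∧
    (∀ lam : ℝ, Module.End.HasEigenvalue L (lam : ℂ) →
      ∃ μ : ℝ, Module.End.HasEigenvalue K (μ : ℂ) ∧ |μ - lam| ≤ D + N * G) := by
  constructor
  · intro μ hμ
    refine exists_hasEigenvalue_near T hK hL hμ (fun x h => ?_) (fun x h => ?_)
    all_goals
      have h1 := abs_le.1 (hKL x)
      have h2 := abs_le.1 (hN (T x))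
      have h3 := hT x
      have h4 := hG x
      have h5 : N * (‖x‖ ^ 2 - ‖T x‖ ^ 2) ≤ N * (G * ‖x‖ ^ 2) := by gcongr
      have h6 : 0 ≤ ‖T x‖ ^ 2 := by positivity
    -- `|μ| ≤ N` is not available, but the hypothesis of this case with the lower bound on the form
    -- of `L` forces `-N < μ - d`. Replacing `‖T x‖²` by `‖x‖²` then costs at most `N G ‖x‖²`, which
    -- with the error `D ‖x‖²` is exactly `d ‖x‖²`.
    · have h7 : -N < μ - (D + N * G) := by
        by_contra! hc
        have := mul_le_mul_of_nonneg_right hc h6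
        linarith
      nlinarith [mul_nonneg (by linarith : 0 ≤ N + (μ - (D + N * G)))
        (by linarith : 0 ≤ ‖x‖ ^ 2 - ‖T x‖ ^ 2)]
    · have h7 : μ + (D + N * G) < N := by
        by_contra! hc
        have := mul_le_mul_of_nonneg_right hc h6
        linarith
      nlinarith [mul_nonneg (by linarith : 0 ≤ N - (μ + (D + N * G)))
        (by linarith : 0 ≤ ‖x‖ ^ 2 - ‖T x‖ ^ 2)]
  · intro lam hlam
    obtain ⟨e, he⟩ := hlam.exists_hasEigenvector
    -- In this direction the eigenvalue belongs to `L`, so `N` bounds it directly.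
    have habs : |lam| ≤ N := by
      have h1 := hN e
      rw [he.apply_eq_smul, inner_smul_left, Complex.conj_ofReal, Complex.re_ofReal_mul] at h1
      have h2 : (inner ℂ e e).re = ‖e‖ ^ 2 := inner_self_eq_norm_sq (𝕜 := ℂ) e
      have h3 : 0 < ‖e‖ ^ 2 := by
        have := norm_pos_iff.2 he.2
        positivity
      rw [h2, abs_mul, abs_of_pos h3] at h1
      exact le_of_mul_le_mul_right h1 h3
    obtain ⟨hl1, hl2⟩ := abs_le.1 habs
    refine exists_hasEigenvalue_near T.symm hL hK hlam (fun e h => ?_) (fun e h => ?_)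
    all_goals
      obtain ⟨x, rfl⟩ := T.surjective e
      rw [T.symm_apply_apply] at h
      have h1 := abs_le.1 (hKL x)
      have h3 := hT x
      have h4 := hG x
      have h5 : N * (‖x‖ ^ 2 - ‖T x‖ ^ 2) ≤ N * (G * ‖x‖ ^ 2) := by gcongr
    · nlinarith [mul_nonneg (by linarith : 0 ≤ N - lam)
        (by linarith : 0 ≤ ‖x‖ ^ 2 - ‖T x‖ ^ 2)]
    · nlinarith [mul_nonneg (by linarith : 0 ≤ N + lam)
        (by linarith : 0 ≤ ‖x‖ ^ 2 - ‖T x‖ ^ 2)]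

end Comparison

/-! ### The gap between subspaces -/

section Gap

variable {X : Type*} [NormedAddCommGroup X]

lemma infDist_submodule_le_norm [NormedSpace ℂ X] (M : Submodule ℂ X) (x : X) :
    Metric.infDist x (M : Set X) ≤ ‖x‖ := by
  simpa using Metric.infDist_le_dist_of_mem (x := x) M.zero_mem

/-- This makes the supremum in `gap` a genuine one and not the default value of an unbounded real
supremum. -/
lemma bddAbove_infDist [NormedSpace ℂ X] (M L : Submodule ℂ X) :
    BddAbove ((fun l => Metric.infDist l (M : Set X)) '' {l | l ∈ L ∧ ‖l‖ = 1}) := by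
  refine ⟨1, ?_⟩
  rintro _ ⟨l, ⟨-, hl⟩, rfl⟩
  exact (infDist_submodule_le_norm M l).trans hl.le

lemma gap_nonneg [NormedSpace ℂ X] (M L : Submodule ℂ X) : 0 ≤ gap M L := by
  refine le_max_of_le_left (Real.sSup_nonneg ?_)
  rintro _ ⟨m, -, rfl⟩
  exact Metric.infDist_nonneg

lemma gap_le [NormedSpace ℂ X] {M L : Submodule ℂ X} {c : ℝ} (hc : 0 ≤ c)
    (h1 : ∀ m ∈ M, ‖m‖ = 1 → ∃ l ∈ L, ‖m - l‖ ≤ c)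
    (h2 : ∀ l ∈ L, ‖l‖ = 1 → ∃ m ∈ M, ‖l - m‖ ≤ c) : gap M L ≤ c := by
  refine max_le (Real.sSup_le ?_ hc) (Real.sSup_le ?_ hc)
  · rintro _ ⟨m, ⟨hm, hm1⟩, rfl⟩
    obtain ⟨l, hl, h⟩ := h1 m hm hm1
    exact (Metric.infDist_le_dist_of_mem hl).trans (by rwa [dist_eq_norm])
  · rintro _ ⟨m, ⟨hm, hm1⟩, rfl⟩
    obtain ⟨l, hl, h⟩ := h2 m hm hm1
    exact (Metric.infDist_le_dist_of_mem hl).trans (by rwa [dist_eq_norm])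

lemma norm_sub_starProjection_le_gap [InnerProductSpace ℂ X] (M L : Submodule ℂ X)
    [M.HasOrthogonalProjection] {l : X} (hl : l ∈ L) :
    ‖l - M.starProjection l‖ ≤ gap M L * ‖l‖ := by
  rcases eq_or_ne l 0 with rfl | h0
  · simp
  have hn : ‖l‖ ≠ 0 := norm_ne_zero_iff.2 h0
  set u : X := ((‖l‖⁻¹ : ℝ) : ℂ) • l with hu
  have hu1 : ‖u‖ = 1 := by
    rw [hu, norm_smul, Complex.norm_real, norm_inv, norm_norm, inv_mul_cancel₀ hn]
  have hlu : l = ((‖l‖ : ℝ) : ℂ) • u := by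
    rw [hu, smul_smul, ← Complex.ofReal_mul, mul_inv_cancel₀ hn, Complex.ofReal_one, one_smul]
  have h1 : ‖u - M.starProjection u‖ ≤ Metric.infDist u (M : Set X) := by
    rw [Metric.le_infDist ⟨0, M.zero_mem⟩]
    intro m hm
    rw [M.starProjection_minimal u, dist_eq_norm]
    exact ciInf_le ⟨0, by rintro _ ⟨a, rfl⟩; exact norm_nonneg _⟩ (⟨m, hm⟩ : M)
  have h2 : Metric.infDist u (M : Set X) ≤ gap M L :=
    (le_csSup (bddAbove_infDist M L) ⟨u, ⟨L.smul_mem _ hl, hu1⟩, rfl⟩).trans (le_max_right _ _)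
  conv_lhs => rw [hlu]
  rw [map_smul, ← smul_sub, norm_smul, Complex.norm_real, norm_norm, mul_comm]
  gcongr
  exact h1.trans h2

end Gap

/-! ### The compressed operator on the cluster space -/

section Cluster

variable {H : Type*} [NormedAddCommGroup H] [InnerProductSpace ℂ H]
  {A : H →ₗ.[ℂ] H} {Lam : Set ℝ}

lemma clusterSpace_le_iff {S : Submodule ℂ H} :
    clusterSpace A Lam ≤ S ↔ ∀ lam ∈ Lam, eigSpace A lam ≤ S := iSup₂_le_iff

lemma eigSpace_le_clusterSpace {lam : ℝ} (h : lam ∈ Lam) :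
    eigSpace A lam ≤ clusterSpace A Lam := le_iSup₂ (f := fun l (_ : l ∈ Lam) => eigSpace A l) lam h

lemma IsEigenCluster.finiteDimensional (h : IsEigenCluster A Lam) :
    FiniteDimensional ℂ (clusterSpace A Lam) := by
  have := h.finite.to_subtype
  have : ∀ l : Lam, FiniteDimensional ℂ (eigSpace A (l : ℝ)) := fun l => h.finiteMult l l.2
  unfold clusterSpace
  rw [← iSup_subtype'']
  infer_instance

lemma clusterSpace_orthogonal_iff {v : H} :
    (∀ e ∈ clusterSpace A Lam, inner ℂ e v = 0) ↔
      ∀ lam ∈ Lam, ∀ e ∈ eigSpace A lam, inner ℂ e v = 0 := by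
  refine ⟨fun h lam hlam e he => h e (eigSpace_le_clusterSpace hlam he), fun h e he => ?_⟩
  have : clusterSpace A Lam ≤ (Submodule.span ℂ {v})ᗮ := clusterSpace_le_iff.2
    fun lam hlam e he => (Submodule.mem_orthogonal_singleton_iff_inner_left).2 (h lam hlam e he)
  exact Submodule.mem_orthogonal_singleton_iff_inner_left.1 (this he)

variable [CompleteSpace H]

lemma clusterSpace_le_domain_absSqrt (hA : IsSelfAdjoint A) :
    clusterSpace A Lam ≤ (absSqrt A).domain :=
  clusterSpace_le_iff.2 fun _ _ _ he =>
    LinearPMap.mem_domain_of_mem_graph (absSqrt_eigSpace hA he)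

lemma ritzOp_spec {F : Submodule ℂ H} [FiniteDimensional ℂ F] (hF : F ≤ (absSqrt A).domain) :
    IsRitzOp A F (ritzOp A F) := by
  have h := (existsUnique_isRitzOp A F hF).exists
  rw [ritzOp, dif_pos h]
  exact h.choose_spec

lemma inner_ritzOp {F : Submodule ℂ H} [FiniteDimensional ℂ F] (hF : F ≤ (absSqrt A).domain)
    (x y : F) : inner ℂ (y : H) (ritzOp A F x : H) =
      assocForm A ⟨x, hF x.2⟩ ⟨y, hF y.2⟩ := by
  obtain ⟨_, _, h⟩ := ritzOp_spec hF x y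
  exact h

lemma isSymmetric_ritzOp (hA : IsSelfAdjoint A) {F : Submodule ℂ H} [FiniteDimensional ℂ F]
    (hF : F ≤ (absSqrt A).domain) : (ritzOp A F).toLinearMap.IsSymmetric := by
  intro x y
  change inner ℂ (ritzOp A F x : H) (y : H) = inner ℂ (x : H) (ritzOp A F y : H)
  rw [inner_ritzOp hF, ← inner_conj_symm, inner_ritzOp hF, assocForm_conj_symm hA]

lemma mem_ritzValues_iff {F : Submodule ℂ H} [FiniteDimensional ℂ F] {lam : ℝ} :
    lam ∈ ritzValues A F ↔
      Module.End.HasEigenvalue (ritzOp A F).toLinearMap (lam : ℂ) := by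
  rw [Module.End.hasEigenvalue_iff_mem_spectrum]
  change (lam : ℂ) ∈ spectrum ℂ (ritzOp A F) ↔ _
  rw [← AlgEquiv.spectrum_eq (Module.End.toContinuousLinearMap F) (ritzOp A F).toLinearMap]
  rfl

lemma ritzOp_eigSpace (hA : IsSelfAdjoint A) (hLam : IsEigenCluster A Lam) {lam : ℝ}
    {e : clusterSpace A Lam} (he : (e : H) ∈ eigSpace A lam) :
    ritzOp A (clusterSpace A Lam) e = (lam : ℂ) • e := by
  have := hLam.finiteDimensional
  apply ext_inner_left ℂ
  intro y
  change inner ℂ (y : H) (ritzOp A (clusterSpace A Lam) e : H) = inner ℂ (y : H) ((lam : ℂ) • (e : H))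
  rw [inner_ritzOp (clusterSpace_le_domain_absSqrt hA), assocForm_eigSpace hA he,
    inner_smul_right]

/-- The cluster space is invariant, so the compression to it is `A` itself. -/
lemma ritzOp_mem_graph (hA : IsSelfAdjoint A) (hLam : IsEigenCluster A Lam)
    (e : clusterSpace A Lam) : ((e : H), (ritzOp A (clusterSpace A Lam) e : H)) ∈ A.graph := by
  set L := ritzOp A (clusterSpace A Lam)
  set φ : clusterSpace A Lam →ₗ[ℂ] H × H :=
    (clusterSpace A Lam).subtype.prod ((clusterSpace A Lam).subtype ∘ₗ L.toLinearMap)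
  -- The vectors with the desired property form a subspace, so it is enough that this subspace
  -- contains every eigenspace.
  have h : clusterSpace A Lam ≤ (A.graph.comap φ).map (clusterSpace A Lam).subtype :=
    clusterSpace_le_iff.2 fun lam hlam e he => by
      refine ⟨⟨e, eigSpace_le_clusterSpace hlam he⟩, ?_, rfl⟩
      change (e, (L ⟨e, _⟩ : H)) ∈ A.graph
      rw [ritzOp_eigSpace hA hLam (e := ⟨e, eigSpace_le_clusterSpace hlam he⟩) he]
      exact mem_graph_of_mem_eigSpace he
  obtain ⟨e', he', heq⟩ := h e.2
  have : e' = e := Subtype.ext heq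
  rw [← this]
  exact he'

lemma assocForm_clusterSpace (hA : IsSelfAdjoint A) (hLam : IsEigenCluster A Lam)
    (e : clusterSpace A Lam) (he : (e : H) ∈ (absSqrt A).domain) (y : (absSqrt A).domain) :
    assocForm A ⟨e, he⟩ y = inner ℂ (y : H) (ritzOp A (clusterSpace A Lam) e : H) := by
  set L := ritzOp A (clusterSpace A Lam)
  have hdom := clusterSpace_le_domain_absSqrt (Lam := Lam) hA
  set f : clusterSpace A Lam →ₗ[ℂ] ℂ :=
    (innerₛₗ ℂ (absSqrt A y)) ∘ₗ (polarFactor A).toLinearMap ∘ₗ (absSqrt A).toFun ∘ₗ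
      Submodule.inclusion hdom
  set g : clusterSpace A Lam →ₗ[ℂ] ℂ :=
    (innerₛₗ ℂ (y : H)) ∘ₗ (clusterSpace A Lam).subtype ∘ₗ L.toLinearMap
  have h : clusterSpace A Lam ≤ (LinearMap.eqLocus f g).map (clusterSpace A Lam).subtype :=
    clusterSpace_le_iff.2 fun lam hlam e he => by
      have heC := eigSpace_le_clusterSpace hlam he
      refine ⟨⟨e, heC⟩, ?_, rfl⟩
      change assocForm A ⟨e, hdom heC⟩ y = inner ℂ (y : H) (L ⟨e, heC⟩ : H)
      rw [assocForm_eigSpace hA he, ritzOp_eigSpace hA hLam (e := ⟨e, heC⟩) he]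
      exact (inner_smul_right _ _ _).symm
  obtain ⟨e', he', heq⟩ := h e.2
  obtain rfl : e' = e := Subtype.ext heq
  exact he'

/-- An eigenvector at a value outside `Λ` would be orthogonal to all eigenspaces of the cluster,
hence to the cluster space that contains it. -/
lemma hasEigenvalue_ritzOp_clusterSpace (hA : IsSelfAdjoint A) (hLam : IsEigenCluster A Lam)
    {lam : ℝ} :
    Module.End.HasEigenvalue (ritzOp A (clusterSpace A Lam)).toLinearMap (lam : ℂ) ↔
      lam ∈ Lam := by
  have := hLam.finiteDimensional
  constructor
  · intro h
    obtain ⟨e, he⟩ := h.exists_hasEigenvector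
    by_contra hn
    have hsym := isSymmetric_ritzOp hA (clusterSpace_le_domain_absSqrt (Lam := Lam) hA)
    have horth : ∀ x ∈ clusterSpace A Lam, inner ℂ x (e : H) = 0 := by
      rw [clusterSpace_orthogonal_iff]
      intro μ hμ x hx
      have hxC := eigSpace_le_clusterSpace hμ hx
      have h1 := hsym ⟨x, hxC⟩ e
      rw [he.apply_eq_smul] at h1
      have h2 : (ritzOp A (clusterSpace A Lam)).toLinearMap ⟨x, hxC⟩ = (μ : ℂ) • ⟨x, hxC⟩ :=
        ritzOp_eigSpace hA hLam (e := ⟨x, hxC⟩) hx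
      rw [h2, inner_smul_left, inner_smul_right, Complex.conj_ofReal] at h1
      have h3 : ((μ : ℂ) - lam) * inner ℂ x (e : H) = 0 := by
        change (μ : ℂ) * inner ℂ x (e : H) = lam * inner ℂ x (e : H) at h1
        linear_combination h1
      rcases mul_eq_zero.1 h3 with h4 | h4
      · exact absurd (Complex.ofReal_injective (sub_eq_zero.1 h4) ▸ hμ) hn
      · exact h4
    exact he.2 (Subtype.ext (inner_self_eq_zero.1 (horth _ e.2)))
  · intro h
    obtain ⟨e, he, he0⟩ := (Submodule.ne_bot_iff _).1 (hLam.eigenvalue lam h)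
    have heC := eigSpace_le_clusterSpace h he
    refine Module.End.hasEigenvalue_of_hasEigenvector (x := ⟨e, heC⟩)
      ⟨Module.End.mem_eigenspace_iff.2 (ritzOp_eigSpace hA hLam (e := ⟨e, heC⟩) he), ?_⟩
    exact fun h => he0 (congrArg Subtype.val h)

lemma norm_absSqrt_clusterSpace_le (hA : IsSelfAdjoint A) (hLam : IsEigenCluster A Lam)
    (e : clusterSpace A Lam) (he : (e : H) ∈ (absSqrt A).domain) :
    ‖absSqrt A ⟨e, he⟩‖ ^ 2 ≤ ‖ritzOp A (clusterSpace A Lam)‖ * ‖(e : H)‖ ^ 2 := by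
  obtain ⟨hd, h1⟩ := apply_eq_of_mem_graph (ritzOp_mem_graph hA hLam e)
  obtain ⟨_, h2⟩ := norm_absSqrt_sq_le hA ⟨e, hd⟩
  refine h2.trans ?_
  rw [h1, sq, ← mul_assoc]
  gcongr
  exact (ritzOp A (clusterSpace A Lam)).le_opNorm e

end Cluster

/-! ### The filter on the cluster space and its complement -/

section FilterAction

variable {H : Type*} [NormedAddCommGroup H] [InnerProductSpace ℂ H] [CompleteSpace H]
  {A : H →ₗ.[ℂ] H} {Lam : Set ℝ} {N : ℕ} {wN : ℂ} {w z : Fin N → ℂ}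

omit [CompleteSpace H] in
lemma hilbertFilter_apply (v : H) :
    hilbertFilter A wN w z v = wN • v + ∑ k, w k • resolventOp A (z k) v := by
  simp [hilbertFilter, sum_apply]

lemma hilbertFilter_eigSpace (hz : ∀ k, z k ∈ resolventPts A) {lam : ℝ}
    (hlam : eigSpace A lam ≠ ⊥) {e : H} (he : e ∈ eigSpace A lam) :
    hilbertFilter A wN w z e = ratFilter wN w z lam • e := by
  rw [hilbertFilter_apply, ratFilter, add_smul, Finset.sum_smul]
  congr 1
  refine Finset.sum_congr rfl fun k _ => ?_
  rw [mul_smul]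
  congr 1
  rw [eq_inv_smul_iff₀ (mem_resolventPts_ne (hz k) hlam)]
  exact resolventOp_apply_eigSpace (hz k) he

lemma hilbertFilter_mem_graph (hA : IsSelfAdjoint A) (hz : ∀ k, z k ∈ resolventPts A) {x y : H}
    (h : (x, y) ∈ (absSqrt A).graph) :
    (hilbertFilter A wN w z x, hilbertFilter A wN w z y) ∈ (absSqrt A).graph := by
  have h1 : (wN • (x, y) + ∑ k, w k • (resolventOp A (z k) x, resolventOp A (z k) y)) ∈
      (absSqrt A).graph :=
    Submodule.add_mem _ (Submodule.smul_mem _ _ h) (Submodule.sum_mem _ fun k _ =>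
      Submodule.smul_mem _ _ (absSqrt_resolventOp hA (hz k) h))
  rw [hilbertFilter_apply, hilbertFilter_apply]
  convert h1 using 1
  ext
  · simp [Prod.fst_sum]
  · simp [Prod.snd_sum]

lemma resolventOp_orthogonal (hA : IsSelfAdjoint A) {ζ : ℂ} (hζ : ζ ∈ resolventPts A) {lam : ℝ}
    (hlam : eigSpace A lam ≠ ⊥) {e v : H} (he : e ∈ eigSpace A lam) (hv : inner ℂ e v = 0) :
    inner ℂ e (resolventOp A ζ v) = 0 := by
  obtain ⟨hd, hxe⟩ := (resolventOp_spec_of_mem hζ).1 v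
  obtain ⟨hed, hAe⟩ := mem_eigSpace_iff.1 he
  have h1 := isSymmetric_of_isSelfAdjoint hA ⟨e, hed⟩ ⟨_, hd⟩
  rw [hAe, inner_smul_left, Complex.conj_ofReal] at h1
  simp only at h1
  have h2 : (ζ - lam) * inner ℂ e (resolventOp A ζ v) = 0 := by
    rw [← hv, ← hxe, inner_sub_right, inner_smul_right, ← h1, hxe]
    ring
  exact (mul_eq_zero.1 h2).resolve_left (mem_resolventPts_ne hζ hlam)

lemma hilbertFilter_orthogonal (hA : IsSelfAdjoint A) (hz : ∀ k, z k ∈ resolventPts A) {lam : ℝ}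
    (hlam : eigSpace A lam ≠ ⊥) {e v : H} (he : e ∈ eigSpace A lam) (hv : inner ℂ e v = 0) :
    inner ℂ e (hilbertFilter A wN w z v) = 0 := by
  rw [hilbertFilter_apply, inner_add_right, inner_smul_right, hv, mul_zero, zero_add, inner_sum]
  refine Finset.sum_eq_zero fun k _ => ?_
  rw [inner_smul_right, resolventOp_orthogonal hA (hz k) hlam he hv, mul_zero]

end FilterAction

/-! ### The space `V` with the norm `‖|A|^(1/2) u‖` -/

section EnergySpace

variable {H : Type*} [NormedAddCommGroup H] [InnerProductSpace ℂ H] [CompleteSpace H]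
  {V : Type*} [NormedAddCommGroup V] [InnerProductSpace ℂ V]
  {A : H →ₗ.[ℂ] H} {Lam : Set ℝ} {N : ℕ} {wN : ℂ} {w z : Fin N → ℂ} {ι : V →L[ℂ] H}

/-- The isometry `v ↦ |A|^(1/2) v` of `V` into `H`. -/
lemma exists_energyIsometry
    (hnorm : ∀ v : V, ∃ hv : ι v ∈ (absSqrt A).domain, ‖v‖ = ‖absSqrt A ⟨ι v, hv⟩‖) :
    ∃ J : V →ₗᵢ[ℂ] H, ∀ v, (ι v, J v) ∈ (absSqrt A).graph := by
  have hdom : ∀ v, ι v ∈ (absSqrt A).domain := fun v => (hnorm v).1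
  refine ⟨⟨(absSqrt A).toFun ∘ₗ (ι.toLinearMap.codRestrict (absSqrt A).domain hdom),
    fun v => ?_⟩, fun v => LinearPMap.mem_graph (absSqrt A) ⟨ι v, hdom v⟩⟩
  obtain ⟨_, h⟩ := hnorm v
  exact h.symm

variable {J : V →ₗᵢ[ℂ] H}

lemma inner_energyIsometry_eigSpace (hA : IsSelfAdjoint A)
    (hJ : ∀ v, (ι v, J v) ∈ (absSqrt A).graph) {lam : ℝ} {e : H} (he : e ∈ eigSpace A lam)
    (v : V) : inner ℂ (J v) e = ((Real.sqrt |lam| : ℝ) : ℂ) * inner ℂ (ι v) e := by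
  obtain ⟨hd, h⟩ := apply_eq_of_mem_graph (hJ v)
  rw [← h]
  exact inner_absSqrt_eigSpace hA he ⟨ι v, hd⟩

/-- One factor `√|λ|` comes from applying `|A|^(1/2)` to the eigenvector, the other from its
symmetry. For `λ ≠ 0`, orthogonality to an eigenvector is thus the same in both spaces. -/
lemma inner_eigSpace_eq (hA : IsSelfAdjoint A) (hJ : ∀ v, (ι v, J v) ∈ (absSqrt A).graph)
    {lam : ℝ} {u : V} (hu : ι u ∈ eigSpace A lam) (v : V) :
    inner ℂ v u = ((|lam| : ℝ) : ℂ) * inner ℂ (ι v) (ι u) := by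
  rw [← J.inner_map_map, eq_of_mem_graph (hJ u) (absSqrt_eigSpace hA hu), inner_smul_right,
    inner_energyIsometry_eigSpace hA hJ hu, ← mul_assoc, ← Complex.ofReal_mul,
    Real.mul_self_sqrt (abs_nonneg _)]

/-- An eigenvector at `0` would lie in `V` with vanishing `V`-norm. -/
lemma ne_zero_of_mem_cluster (hA : IsSelfAdjoint A) (hLam : IsEigenCluster A Lam)
    (hEV : clusterSpace A Lam ≤ LinearMap.range ι.toLinearMap)
    (hJ : ∀ v, (ι v, J v) ∈ (absSqrt A).graph) {lam : ℝ} (h : lam ∈ Lam) : lam ≠ 0 := by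
  rintro rfl
  obtain ⟨e, he, he0⟩ := (Submodule.ne_bot_iff _).1 (hLam.eigenvalue 0 h)
  obtain ⟨u, rfl⟩ := hEV (eigSpace_le_clusterSpace h he)
  have h1 := inner_eigSpace_eq hA hJ he u
  rw [abs_zero, Complex.ofReal_zero, zero_mul, inner_self_eq_zero] at h1
  apply he0
  rw [h1, map_zero]

/-- Orthogonality to the cluster space in `V` is the same as orthogonality in `H`. -/
lemma mem_orthogonal_comap_iff (hA : IsSelfAdjoint A) (hLam : IsEigenCluster A Lam)
    (hι : Function.Injective ι) (hEV : clusterSpace A Lam ≤ LinearMap.range ι.toLinearMap)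
    (hJ : ∀ v, (ι v, J v) ∈ (absSqrt A).graph) (v : V) :
    v ∈ ((clusterSpace A Lam).comap ι.toLinearMap)ᗮ ↔
      ∀ e ∈ clusterSpace A Lam, inner ℂ e (ι v) = 0 := by
  constructor
  · intro hv
    rw [clusterSpace_orthogonal_iff]
    intro lam hlam e he
    have heC := eigSpace_le_clusterSpace hlam he
    obtain ⟨u, rfl⟩ := hEV heC
    have h1 := (Submodule.mem_orthogonal' _ _).1 hv u heC
    rw [inner_eigSpace_eq hA hJ he] at h1
    have h2 := (mul_eq_zero.1 h1).resolve_left (by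
      have := ne_zero_of_mem_cluster hA hLam hEV hJ hlam
      simpa using this)
    exact inner_eq_zero_symm.1 h2
  · intro hv
    have hle : clusterSpace A Lam ≤
        ((Submodule.span ℂ {v})ᗮ).map ι.toLinearMap :=
      clusterSpace_le_iff.2 fun lam hlam e he => by
        have heC := eigSpace_le_clusterSpace hlam he
        obtain ⟨u, rfl⟩ := hEV heC
        refine ⟨u, Submodule.mem_orthogonal_singleton_iff_inner_right.2 ?_, rfl⟩
        have h0 : inner ℂ (ι v) (ι u) = 0 := inner_eq_zero_symm.1 (hv _ heC)
        rw [inner_eigSpace_eq hA hJ he, h0, mul_zero]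
    rw [Submodule.mem_orthogonal]
    intro u hu
    obtain ⟨u', hu', heq⟩ := hle hu
    obtain rfl : u' = u := hι heq
    exact Submodule.mem_orthogonal_singleton_iff_inner_left.1 hu'

omit [CompleteSpace H] in
lemma finiteDimensional_comap_clusterSpace (hLam : IsEigenCluster A Lam)
    (hι : Function.Injective ι) :
    FiniteDimensional ℂ ((clusterSpace A Lam).comap ι.toLinearMap) := by
  have := hLam.finiteDimensional
  refine Module.Finite.of_injective
    (ι.toLinearMap.restrict (p := (clusterSpace A Lam).comap ι.toLinearMap)
      (q := clusterSpace A Lam) fun _ h => h) ?_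
  intro a b hab
  exact Subtype.ext (hι (congrArg Subtype.val hab))

omit [CompleteSpace H] in
lemma onV_spec {T : H →ₗ[ℂ] H} (h : IsBoundedOn ι T) (v : V) : ι (onV ι T v) = T (ι v) := by
  unfold onV
  rw [dif_pos h]
  exact h.choose_spec v

omit [CompleteSpace H] in
lemma apply_filterOp (hR : ∀ k, IsBoundedOn ι (resolventOp A (z k)).toLinearMap) (v : V) :
    ι (filterOp ι A wN w z v) = hilbertFilter A wN w z (ι v) := by
  rw [hilbertFilter_apply]
  simp only [filterOp, add_apply, smul_apply, sum_apply, map_add, map_smul, map_sum,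
    one_apply_eq_self, onV_spec (hR _)]
  rfl

lemma energyIsometry_filterOp (hA : IsSelfAdjoint A) (hz : ∀ k, z k ∈ resolventPts A)
    (hJ : ∀ v, (ι v, J v) ∈ (absSqrt A).graph)
    (hR : ∀ k, IsBoundedOn ι (resolventOp A (z k)).toLinearMap) (v : V) :
    J (filterOp ι A wN w z v) = hilbertFilter A wN w z (J v) := by
  have h := hJ (filterOp ι A wN w z v)
  rw [apply_filterOp hR] at h
  exact eq_of_mem_graph h (hilbertFilter_mem_graph hA hz (hJ v))

/-- The Riesz projector of the exact filter is the orthogonal projection onto the cluster. -/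
lemma spectralProjector_filterOp [CompleteSpace V] (hA : IsSelfAdjoint A)
    (hLam : IsEigenCluster A Lam) (hι : Function.Injective ι)
    (hEV : clusterSpace A Lam ≤ LinearMap.range ι.toLinearMap)
    (hJ : ∀ v, (ι v, J v) ∈ (absSqrt A).graph)
    (hR : ∀ k, IsBoundedOn ι (resolventOp A (z k)).toLinearMap)
    [FiniteDimensional ℂ ((clusterSpace A Lam).comap ι.toLinearMap)]
    {y γ δ : ℝ} (hf : FilterSeparates A Lam wN w z y γ δ) {Θ : ℝ → ℂ}
    (hΘ : IsSeparatingContour (filterOp ι A wN w z)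
      ((fun lam : ℝ => ratFilter wN w z (lam : ℂ)) '' Lam) Θ) :
    (∀ t ∈ Icc (0 : ℝ) 1, Θ t ∈ resolventSet ℂ (filterOp ι A wN w z)) ∧
    (∀ μ ∈ spectrum ℂ (filterOp ι A wN w z), winding Θ μ = 0 ∨ winding Θ μ = 1) ∧
    spectralProjector (filterOp ι A wN w z) Θ =
      ((clusterSpace A Lam).comap ι.toLinearMap).starProjection := by
  obtain ⟨s, hs0, hswN, hsr, hsL⟩ := hf.exists_bound hLam
  have hz := hf.node_mem
  have horth := mem_orthogonal_comap_iff hA hLam hι hEV hJ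
  refine spectralProjector_eq_starProjection ?_ ?_ hs0 ?_ ?_ hΘ
  · have hle : clusterSpace A Lam ≤ (⨆ m : (fun lam : ℝ => ratFilter wN w z (lam : ℂ)) '' Lam,
        Module.End.eigenspace (filterOp ι A wN w z).toLinearMap m ⊓
          (clusterSpace A Lam).comap ι.toLinearMap).map ι.toLinearMap :=
      clusterSpace_le_iff.2 fun lam hlam e he => by
        have heC := eigSpace_le_clusterSpace hlam he
        obtain ⟨u, rfl⟩ := hEV heC
        refine ⟨u, ?_, rfl⟩
        refine Submodule.mem_iSup_of_mem ⟨_, mem_image_of_mem _ hlam⟩ ⟨?_, heC⟩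
        refine Module.End.mem_eigenspace_iff.2 (hι ?_)
        change ι (filterOp ι A wN w z u) = ι (ratFilter wN w z lam • u)
        rw [apply_filterOp hR, map_smul]
        exact hilbertFilter_eigSpace hz (hLam.eigenvalue lam hlam) he
    intro u hu
    obtain ⟨u', hu', heq⟩ := hle hu
    obtain rfl : u' = u := hι heq
    exact hu'
  · intro v hv
    rw [horth, clusterSpace_orthogonal_iff] at hv ⊢
    intro lam hlam e he
    rw [apply_filterOp hR]
    exact hilbertFilter_orthogonal hA hz (hLam.eigenvalue lam hlam) he (hv lam hlam e he)
  · intro v hv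
    rw [horth, clusterSpace_orthogonal_iff] at hv
    -- The isometry `J` intertwines the filters on `V` and `H`, and `J v` is again orthogonal to the
    -- cluster space, so the bound on `H` applies to it.
    rw [← J.norm_map, ← J.norm_map v, energyIsometry_filterOp hA hz hJ hR]
    refine norm_hilbertFilter_apply_le hA hLam hf hs0 hswN hsr ?_
    rw [clusterSpace_orthogonal_iff]
    intro lam hlam e he
    rw [← inner_eq_zero_symm, inner_energyIsometry_eigSpace hA hJ he,
      inner_eq_zero_symm.1 (hv lam hlam e he), mul_zero]
  · rintro _ ⟨lam, hlam, rfl⟩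
    exact hsL lam hlam

omit [CompleteSpace H] in
lemma tendsto_discFilterOp {Rh : ℝ → ℂ → H →ₗ[ℂ] V} {l : Filter ℝ}
    (hRlim : ∀ k, Tendsto
      (fun h => ‖onV ι (ι.toLinearMap ∘ₗ Rh h (z k)) - onV ι (resolventOp A (z k)).toLinearMap‖)
      l (𝓝 0)) :
    Tendsto (fun h => discFilterOp ι (Rh h) wN w z) l (𝓝 (filterOp ι A wN w z)) := by
  unfold discFilterOp filterOp
  refine tendsto_const_nhds.add (tendsto_finsetSum _ fun k _ => Tendsto.const_smul ?_ _)
  exact tendsto_iff_norm_sub_tendsto_zero.2 (hRlim k)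

-- The discrete filter is `w_N` plus an operator into `V_h`: the structure required by
-- `spectralProjector_idempotent`.
omit [CompleteSpace H] in
lemma discFilterOp_sub_mem {R : ℂ → H →ₗ[ℂ] V} (hι : Function.Injective ι) {F : Submodule ℂ V}
    (hRF : ∀ k x, R (z k) x ∈ F) (hR : ∀ k, IsBoundedOn ι (ι.toLinearMap ∘ₗ R (z k))) (v : V) :
    discFilterOp ι R wN w z v - wN • v ∈ F := by
  have h : discFilterOp ι R wN w z v - wN • v =
      ∑ k, w k • onV ι (ι.toLinearMap ∘ₗ R (z k)) v := by
    simp [discFilterOp, sum_apply]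
  rw [h]
  refine F.sum_mem fun k _ => F.smul_mem _ ?_
  have : onV ι (ι.toLinearMap ∘ₗ R (z k)) v = R (z k) (ι v) := hι (onV_spec (hR k) v)
  rw [this]
  exact hRF k _

end EnergySpace

/-! ### Subspaces close to a finite-dimensional one -/

section Close

variable {V : Type*} [NormedAddCommGroup V] [InnerProductSpace ℂ V]

/-- At distance less than one, each projection is injective on the range of the other, so the
dimensions agree; both one-sided distances are at most `‖P - Q‖`. `P` need not be self-adjoint. -/
lemma range_projection_close {M : Submodule ℂ V} [FiniteDimensional ℂ M] {P : V →L[ℂ] V}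
    (hP : ∀ x, P (P x) = P x) (hPM : ‖P - M.starProjection‖ < 1) :
    FiniteDimensional ℂ (LinearMap.range P.toLinearMap) ∧
    Module.finrank ℂ (LinearMap.range P.toLinearMap) = Module.finrank ℂ M ∧
    (∀ x ∈ LinearMap.range P.toLinearMap, M.starProjection x = 0 → x = 0) ∧
    gap M (LinearMap.range P.toLinearMap) < 1 := by
  set c := ‖P - M.starProjection‖
  have hPx : ∀ x ∈ LinearMap.range P.toLinearMap, P x = x := by
    rintro _ ⟨x, rfl⟩
    exact hP x
  have hQx : ∀ x ∈ M, M.starProjection x = x := fun x hx =>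
    Submodule.starProjection_eq_self_iff.2 hx
  have hb : ∀ x, ‖P x - M.starProjection x‖ ≤ c * ‖x‖ := fun x =>
    (P - M.starProjection).le_opNorm x
  have hz : ∀ x : V, ‖x‖ ≤ c * ‖x‖ → x = 0 := by
    intro x hx
    by_contra h0
    have := norm_pos_iff.2 h0
    nlinarith
  have h1 : ∀ x ∈ LinearMap.range P.toLinearMap, M.starProjection x = 0 → x = 0 := by
    intro x hx h0
    have := hb x
    rw [hPx x hx, h0, sub_zero] at this
    exact hz x this
  have h2 : ∀ x ∈ M, P x = 0 → x = 0 := by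
    intro x hx h0
    have := hb x
    rw [hQx x hx, h0, zero_sub, norm_neg] at this
    exact hz x this
  set f : LinearMap.range P.toLinearMap →ₗ[ℂ] M :=
    (M.starProjection.toLinearMap.restrict (p := LinearMap.range P.toLinearMap) (q := M)
      fun x _ => M.starProjection_apply_mem x)
  have hf : Function.Injective f := by
    rw [← LinearMap.ker_eq_bot, LinearMap.ker_eq_bot']
    intro x hx
    exact Subtype.ext (h1 x x.2 (congrArg Subtype.val hx))
  set g : M →ₗ[ℂ] LinearMap.range P.toLinearMap := P.toLinearMap.rangeRestrict ∘ₗ M.subtype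
  have hg : Function.Injective g := by
    rw [← LinearMap.ker_eq_bot, LinearMap.ker_eq_bot']
    intro x hx
    exact Subtype.ext (h2 x x.2 (congrArg Subtype.val hx))
  have hfin : FiniteDimensional ℂ (LinearMap.range P.toLinearMap) :=
    Module.Finite.of_injective f hf
  refine ⟨hfin, le_antisymm (LinearMap.finrank_le_finrank_of_injective hf)
    (LinearMap.finrank_le_finrank_of_injective hg), h1, ?_⟩
  refine (gap_le (norm_nonneg (P - M.starProjection)) ?_ ?_).trans_lt hPM
  · intro m hm hm1
    refine ⟨P m, ⟨m, rfl⟩, ?_⟩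
    have := hb m
    rwa [hQx m hm, hm1, mul_one, norm_sub_rev] at this
  · intro l hl hl1
    refine ⟨M.starProjection l, M.starProjection_apply_mem l, ?_⟩
    have := hb l
    rwa [hPx l hl, hl1, mul_one] at this

end Close

/-! ### Comparison of Ritz values with the cluster -/

section Ritz

variable {H : Type*} [NormedAddCommGroup H] [InnerProductSpace ℂ H] [CompleteSpace H]
  {V : Type*} [NormedAddCommGroup V] [InnerProductSpace ℂ V]
  {A : H →ₗ.[ℂ] H} {Lam : Set ℝ} {ι : V →L[ℂ] H} {J : V →ₗᵢ[ℂ] H}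

lemma assocForm_add_of_eq_zero (hA : IsSelfAdjoint A) {q r : (absSqrt A).domain}
    (h : assocForm A q r = 0) :
    assocForm A (q + r) (q + r) = assocForm A q q + assocForm A r r := by
  have h' : assocForm A r q = 0 := by rw [← assocForm_conj_symm hA, h, map_zero]
  unfold assocForm at h h' ⊢
  rw [LinearPMap.map_add, map_add, inner_add_left, inner_add_right, inner_add_right, h, h']
  ring

lemma map_le_domain_absSqrt (hJ : ∀ v, (ι v, J v) ∈ (absSqrt A).graph) (F : Submodule ℂ V) :
    F.map ι.toLinearMap ≤ (absSqrt A).domain := by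
  rintro _ ⟨v, -, rfl⟩
  exact LinearPMap.mem_domain_of_mem_graph (hJ v)

lemma norm_absSqrt_apply (hJ : ∀ v, (ι v, J v) ∈ (absSqrt A).graph) (v : V)
    (hv : ι v ∈ (absSqrt A).domain) : ‖absSqrt A ⟨ι v, hv⟩‖ = ‖v‖ := by
  obtain ⟨_, h⟩ := apply_eq_of_mem_graph (hJ v)
  rw [h, J.norm_map]

/-- The orthogonal projections onto the cluster space in `V` and in `H` agree. -/
lemma apply_starProjection_comap (hA : IsSelfAdjoint A) (hLam : IsEigenCluster A Lam)
    (hι : Function.Injective ι) (hEV : clusterSpace A Lam ≤ LinearMap.range ι.toLinearMap)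
    (hJ : ∀ v, (ι v, J v) ∈ (absSqrt A).graph)
    [(clusterSpace A Lam).HasOrthogonalProjection]
    [((clusterSpace A Lam).comap ι.toLinearMap).HasOrthogonalProjection] (v : V) :
    ι (((clusterSpace A Lam).comap ι.toLinearMap).starProjection v) =
      (clusterSpace A Lam).starProjection (ι v) := by
  have hmem : ι (((clusterSpace A Lam).comap ι.toLinearMap).starProjection v) ∈
      clusterSpace A Lam :=
    Submodule.starProjection_apply_mem ((clusterSpace A Lam).comap ι.toLinearMap) v
  refine (Submodule.eq_starProjection_of_mem_orthogonal hmem ?_).symm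
  rw [Submodule.mem_orthogonal, ← map_sub]
  exact (mem_orthogonal_comap_iff hA hLam hι hEV hJ _).1
    (Submodule.sub_starProjection_mem_orthogonal v)

section Bounds

variable [FiniteDimensional ℂ ((clusterSpace A Lam).comap ι.toLinearMap)] {Eh : Submodule ℂ V}

/-- The energy norm on `E_h` is bounded by the norm of `H`. -/
lemma norm_le_of_gap_lt_one (hA : IsSelfAdjoint A) (hLam : IsEigenCluster A Lam)
    (hι : Function.Injective ι) (hEV : clusterSpace A Lam ≤ LinearMap.range ι.toLinearMap)
    (hJ : ∀ v, (ι v, J v) ∈ (absSqrt A).graph)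
    (hgap : gap ((clusterSpace A Lam).comap ι.toLinearMap) Eh < 1) {v : V} (hv : v ∈ Eh) :
    ‖v‖ ≤ Real.sqrt ‖ritzOp A (clusterSpace A Lam)‖ /
      (1 - gap ((clusterSpace A Lam).comap ι.toLinearMap) Eh) * ‖ι v‖ := by
  have := hLam.finiteDimensional
  set g := gap ((clusterSpace A Lam).comap ι.toLinearMap) Eh
  set M := (clusterSpace A Lam).comap ι.toLinearMap
  set n := ‖ritzOp A (clusterSpace A Lam)‖
  have h1 : ‖v‖ - ‖M.starProjection v‖ ≤ g * ‖v‖ :=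
    (norm_sub_norm_le _ _).trans (norm_sub_starProjection_le_gap M Eh hv)
  have hdom := map_le_domain_absSqrt hJ ⊤ (Submodule.mem_map_of_mem (f := ι.toLinearMap)
    (Submodule.mem_top (x := M.starProjection v)))
  have h2 := norm_absSqrt_clusterSpace_le hA hLam
    ⟨ι (M.starProjection v), M.starProjection_apply_mem v⟩ hdom
  change ‖absSqrt A ⟨ι (M.starProjection v), hdom⟩‖ ^ 2 ≤
    n * ‖ι (M.starProjection v)‖ ^ 2 at h2
  rw [norm_absSqrt_apply hJ, apply_starProjection_comap hA hLam hι hEV hJ] at h2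
  have h3 : ‖(clusterSpace A Lam).starProjection (ι v)‖ ≤ ‖ι v‖ :=
    Submodule.norm_starProjection_apply_le _ _
  have h4 : ‖M.starProjection v‖ ≤ Real.sqrt n * ‖ι v‖ := by
    refine abs_le_of_sq_le_sq' ?_ (by positivity) |>.2
    rw [mul_pow, Real.sq_sqrt (show 0 ≤ n from norm_nonneg (ritzOp A (clusterSpace A Lam)))]
    refine h2.trans ?_
    gcongr
  rw [div_mul_eq_mul_div, le_div_iff₀ (sub_pos.2 hgap)]
  linarith

lemma maxRatio_nonneg (F : Submodule ℂ H) : 0 ≤ maxRatio A F := by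
  refine Real.sSup_nonneg ?_
  rintro _ ⟨e, -, -, he, rfl⟩
  positivity

lemma maxRatio_le (hJ : ∀ v, (ι v, J v) ∈ (absSqrt A).graph) {c : ℝ} (hc : 0 ≤ c)
    (h : ∀ v ∈ Eh, ‖v‖ ≤ c * ‖ι v‖) : maxRatio A (Eh.map ι.toLinearMap) ≤ c := by
  refine Real.sSup_le ?_ hc
  rintro _ ⟨_, ⟨v, hv, rfl⟩, hv0, hd, rfl⟩
  refine div_le_of_le_mul₀ (norm_nonneg _) hc ?_
  exact (norm_absSqrt_apply hJ v hd).trans_le (h v hv)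

/-- The a priori constant `c` only ensures that the set of ratios is bounded; it does not enter the
estimate. -/
lemma norm_le_maxRatio_mul (hι : Function.Injective ι)
    (hJ : ∀ v, (ι v, J v) ∈ (absSqrt A).graph) {c : ℝ}
    (h : ∀ v ∈ Eh, ‖v‖ ≤ c * ‖ι v‖) {v : V} (hv : v ∈ Eh) :
    ‖v‖ ≤ maxRatio A (Eh.map ι.toLinearMap) * ‖ι v‖ := by
  rcases eq_or_ne v 0 with rfl | hv0
  · simp
  have h0 : ι v ≠ 0 := fun h => hv0 (hι (h.trans (map_zero ι).symm))
  have hd := LinearPMap.mem_domain_of_mem_graph (hJ v)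
  rw [← div_le_iff₀ (norm_pos_iff.2 h0)]
  refine le_csSup ⟨c, ?_⟩ ⟨ι v, ⟨v, hv, rfl⟩, h0, hd, ?_⟩
  · rintro _ ⟨_, ⟨u, hu, rfl⟩, hu0, hud, rfl⟩
    rw [div_le_iff₀ (norm_pos_iff.2 hu0)]
    exact (norm_absSqrt_apply hJ u hud).trans_le (h u hu)
  · rw [norm_absSqrt_apply hJ]

/-- The form of `A` changes little under projection onto the cluster space. -/
lemma abs_form_sub_le (hA : IsSelfAdjoint A) (hLam : IsEigenCluster A Lam)
    (hι : Function.Injective ι) (hEV : clusterSpace A Lam ≤ LinearMap.range ι.toLinearMap)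
    (hJ : ∀ v, (ι v, J v) ∈ (absSqrt A).graph) [FiniteDimensional ℂ (clusterSpace A Lam)] {v : V}
    (hv : v ∈ Eh) (hd : ι v ∈ (absSqrt A).domain)
    (hd' : (clusterSpace A Lam).starProjection (ι v) ∈ (absSqrt A).domain) :
    ‖assocForm A ⟨ι v, hd⟩ ⟨ι v, hd⟩ -
        assocForm A ⟨(clusterSpace A Lam).starProjection (ι v), hd'⟩
          ⟨(clusterSpace A Lam).starProjection (ι v), hd'⟩‖ ≤
      (gap ((clusterSpace A Lam).comap ι.toLinearMap) Eh * ‖v‖) ^ 2 := by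
  set M := (clusterSpace A Lam).comap ι.toLinearMap
  set Q := (clusterSpace A Lam).starProjection
  have hr : ι v - Q (ι v) = ι (v - M.starProjection v) := by
    rw [map_sub, apply_starProjection_comap hA hLam hι hEV hJ]
  have hrd := LinearPMap.mem_domain_of_mem_graph (hJ (v - M.starProjection v))
  set q : (absSqrt A).domain := ⟨Q (ι v), hd'⟩
  set r : (absSqrt A).domain := ⟨ι (v - M.starProjection v), hrd⟩
  have hsum : (⟨ι v, hd⟩ : (absSqrt A).domain) = q + r := by
    apply Subtype.ext
    change ι v = Q (ι v) + ι (v - M.starProjection v)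
    rw [← hr]
    abel
  -- `q` lies in the cluster space, so `a(q, r)` is the `H`-inner product of `r` with `A_E q`; `r`
  -- is orthogonal to the cluster space in `H` as well as in `V`. Without cross terms the error is
  -- quadratic in the gap.
  have hqr : assocForm A q r = 0 := by
    have h1 := assocForm_clusterSpace hA hLam
      ⟨Q (ι v), Submodule.starProjection_apply_mem _ _⟩ hd' r
    refine h1.trans ?_
    exact inner_eq_zero_symm.1 ((mem_orthogonal_comap_iff hA hLam hι hEV hJ _).1
      (Submodule.sub_starProjection_mem_orthogonal v) _ (Subtype.property _))
  rw [hsum, assocForm_add_of_eq_zero hA hqr, add_sub_cancel_left]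
  refine (norm_assocForm_self_le hA r).trans ?_
  rw [norm_absSqrt_apply hJ]
  gcongr
  exact norm_sub_starProjection_le_gap M Eh hv

/-- The error bound for Ritz values on a subspace close to the cluster space. -/
theorem hausdorffEDist_ritzValues_le (hA : IsSelfAdjoint A) (hLam : IsEigenCluster A Lam)
    (hι : Function.Injective ι) (hEV : clusterSpace A Lam ≤ LinearMap.range ι.toLinearMap)
    (hJ : ∀ v, (ι v, J v) ∈ (absSqrt A).graph) [FiniteDimensional ℂ Eh]
    (hrank : Module.finrank ℂ Eh =
      Module.finrank ℂ ((clusterSpace A Lam).comap ι.toLinearMap))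
    (hinj : ∀ x ∈ Eh, ((clusterSpace A Lam).comap ι.toLinearMap).starProjection x = 0 → x = 0)
    (hgap : gap ((clusterSpace A Lam).comap ι.toLinearMap) Eh < 1) :
    Metric.hausdorffEDist Lam (ritzValues A (Eh.map ι.toLinearMap)) ≤ ENNReal.ofReal
      (maxRatio A (Eh.map ι.toLinearMap) ^ 2 *
          gap ((clusterSpace A Lam).comap ι.toLinearMap) Eh ^ 2
        + ‖ritzOp A (clusterSpace A Lam)‖ *
          gap (clusterSpace A Lam) (Eh.map ι.toLinearMap) ^ 2) := by
  have hfin := hLam.finiteDimensional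
  have hEdom := clusterSpace_le_domain_absSqrt (Lam := Lam) hA
  have hFdom := map_le_domain_absSqrt hJ Eh
  set E := clusterSpace A Lam with hE
  set F := Eh.map ι.toLinearMap
  set Q := E.starProjection
  have hιker : ∀ S : Submodule ℂ V, Module.finrank ℂ (S.map ι.toLinearMap) =
      Module.finrank ℂ S := fun S => (Submodule.equivMapOfInjective ι.toLinearMap hι S).finrank_eq.symm
  have hrank' : Module.finrank ℂ F = Module.finrank ℂ E := by
    rw [hιker, hrank, ← hιker, Submodule.map_comap_eq, inf_eq_right.2 hEV]
  -- The `H`-orthogonal projection identifies the image of `E_h` with `E`: injective by `hinj`,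
  -- bijective by equality of dimensions.
  set f : F →ₗ[ℂ] E := E.orthogonalProjectionOnto.toLinearMap ∘ₗ F.subtype with hf
  have hfQ : ∀ x : F, (f x : H) = Q x := fun x => rfl
  have hfinj : Function.Injective f := by
    rw [← LinearMap.ker_eq_bot, LinearMap.ker_eq_bot']
    rintro ⟨_, v, hv, rfl⟩ hx
    have h0 : Q (ι v) = 0 := congrArg Subtype.val hx
    have h1 : v = 0 := hinj v hv (hι (by
      rw [apply_starProjection_comap hA hLam hι hEV hJ, map_zero]
      exact h0))
    subst h1
    exact Subtype.ext (map_zero ι)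
  set T := LinearMap.linearEquivOfInjective f hfinj hrank'
  have hT : ∀ x : F, (T x : H) = Q x := fun x => rfl
  have hpyth : ∀ x : F, ‖x‖ ^ 2 - ‖T x‖ ^ 2 = ‖(x : H) - Q x‖ ^ 2 := by
    intro x
    have h := Submodule.norm_sq_eq_add_norm_sq_starProjection (x : H) E
    rw [Submodule.starProjection_orthogonal_val] at h
    change ‖(x : H)‖ ^ 2 - ‖Q x‖ ^ 2 = _
    linarith
  -- `D` measures the change of the form under projection, `G` the loss of squared `H`-norm, and
  -- `‖A_E‖` bounds the form on `E`. Their combination `D + N G` is the asserted error.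
  have hmain := eigenvalues_near T (K := (ritzOp A F).toLinearMap)
    (L := (ritzOp A E).toLinearMap) (N := ‖ritzOp A E‖)
    (D := maxRatio A F ^ 2 * gap (E.comap ι.toLinearMap) Eh ^ 2) (G := gap E F ^ 2)
    (isSymmetric_ritzOp hA hFdom) (isSymmetric_ritzOp hA hEdom) (norm_nonneg (ritzOp A E)) ?_ ?_ ?_ ?_
  · refine Metric.hausdorffEDist_le_of_mem_edist ?_ ?_
    · intro lam hlam
      obtain ⟨μ, hμ, h⟩ := hmain.2 lam ((hasEigenvalue_ritzOp_clusterSpace hA hLam).2 hlam)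
      refine ⟨μ, mem_ritzValues_iff.2 hμ, ?_⟩
      rw [edist_comm, edist_dist, Real.dist_eq]
      exact ENNReal.ofReal_le_ofReal h
    · intro μ hμ
      obtain ⟨lam, hlam, h⟩ := hmain.1 μ (mem_ritzValues_iff.1 hμ)
      refine ⟨lam, (hasEigenvalue_ritzOp_clusterSpace hA hLam).1 hlam, ?_⟩
      rw [edist_comm, edist_dist, Real.dist_eq]
      exact ENNReal.ofReal_le_ofReal h
  · intro x
    have h1 : inner ℂ (ritzOp A F x) x = (starRingEnd ℂ)
        (assocForm A ⟨x, hFdom x.2⟩ ⟨x, hFdom x.2⟩) := by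
      rw [← inner_ritzOp hFdom, inner_conj_symm]
      rfl
    have h2 : inner ℂ (ritzOp A E (T x)) (T x) = (starRingEnd ℂ)
        (assocForm A ⟨Q x, hEdom (T x).2⟩ ⟨Q x, hEdom (T x).2⟩) := by
      have := inner_ritzOp hEdom (T x) (T x)
      refine Eq.trans ?_ (congrArg (starRingEnd ℂ) this)
      rw [inner_conj_symm]
      rfl
    change |(inner ℂ (ritzOp A F x) x).re - (inner ℂ (ritzOp A E (T x)) (T x)).re| ≤ _
    rw [h1, h2, Complex.conj_re, Complex.conj_re, ← Complex.sub_re]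
    refine (Complex.abs_re_le_norm _).trans ?_
    obtain ⟨⟨_, v, hv, rfl⟩, rfl⟩ : ∃ y : F, y = x := ⟨x, rfl⟩
    refine (abs_form_sub_le hA hLam hι hEV hJ hv _ _).trans ?_
    change _ ≤ _ * ‖ι v‖ ^ 2
    have h3 := norm_le_maxRatio_mul hι hJ
      (fun u hu => norm_le_of_gap_lt_one hA hLam hι hEV hJ hgap hu) hv
    have h4 := gap_nonneg (E.comap ι.toLinearMap) Eh
    calc (gap (E.comap ι.toLinearMap) Eh * ‖v‖) ^ 2
        ≤ (gap (E.comap ι.toLinearMap) Eh * (maxRatio A F * ‖ι v‖)) ^ 2 := by gcongr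
      _ = _ := by ring
  · intro x
    have := hpyth x
    nlinarith [sq_nonneg ‖(x : H) - Q x‖]
  · intro x
    rw [hpyth, ← mul_pow]
    gcongr
    exact norm_sub_starProjection_le_gap E F x.2
  · intro e
    refine (Complex.abs_re_le_norm _).trans ((norm_inner_le_norm _ _).trans ?_)
    rw [sq, ← mul_assoc]
    gcongr
    exact (ritzOp A E).le_opNorm e

end Bounds

end Ritz

end FilteredSubspace

end

/-! ### Proof of the corollary -/

open FilteredSubspace in
theorem mainTheorem6
    {H : Type*} [NormedAddCommGroup H] [InnerProductSpace ℂ H] [CompleteSpace H]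
    {V : Type*} [NormedAddCommGroup V] [InnerProductSpace ℂ V] [CompleteSpace V]
    -- the self-adjoint operator, the eigenvalue cluster and the filter
    (A : H →ₗ.[ℂ] H) (hA : IsSelfAdjoint A)
    (Lam : Set ℝ) (hLam : IsEigenCluster A Lam)
    {N : ℕ} (wN : ℂ) (w z : Fin N → ℂ)
    (hfilter : ∃ y γ δ : ℝ, FilterSeparates A Lam wN w z y γ δ)
    -- the Hilbert space `V ⊆ H` with `‖u‖_V = ‖|A|^(1/2) u‖_H`
    (ι : V →L[ℂ] H) (hι : Function.Injective ι)
    (hEV : clusterSpace A Lam ≤ LinearMap.range ι.toLinearMap)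
    (hRV : ∀ ζ ∈ resolventPts A, ∀ v : V, ∃ u : V, ι u = resolventOp A ζ (ι v))
    (hnorm : ∀ v : V, ∃ hv : ι v ∈ (absSqrt A).domain, ‖v‖ = ‖absSqrt A ⟨ι v, hv⟩‖)
    -- the discretization, with mesh parameter `h` in `J`
    (J : Set ℝ) (hJ : J ⊆ Set.Ioi 0)
    (Vh : ℝ → Submodule ℂ V) (hVh : ∀ h ∈ J, FiniteDimensional ℂ (Vh h))
    (Rh : ℝ → ℂ → H →ₗ[ℂ] V) (hRh : ∀ h ∈ J, ∀ k x, Rh h (z k) x ∈ Vh h)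
    (hRbdd : ∀ k, IsBoundedOn ι (resolventOp A (z k)).toLinearMap)
    (hRhbdd : ∀ h ∈ J, ∀ k, IsBoundedOn ι (ι.toLinearMap ∘ₗ Rh h (z k)))
    (hRlim : ∀ k, Tendsto
      (fun h => ‖onV ι (ι.toLinearMap ∘ₗ Rh h (z k)) - onV ι (resolventOp A (z k)).toLinearMap‖)
      (𝓝[J] 0) (𝓝 0))
    -- the contour that defines the discrete eigenspace `E_h`
    (Θ : ℝ → ℂ)
    (hΘ : IsSeparatingContour (filterOp ι A wN w z)
      ((fun lam : ℝ => ratFilter wN w z (lam : ℂ)) '' Lam) Θ) :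
    ∃ C₀ > (0 : ℝ), ∃ h₀ > (0 : ℝ), ∀ h ∈ J, h < h₀ →
      ∀ Sh : V →L[ℂ] V, Sh = discFilterOp ι (Rh h) wN w z →
      ∀ Eh : Submodule ℂ V, Eh = LinearMap.range (spectralProjector Sh Θ).toLinearMap →
      ∀ E : Submodule ℂ H, E = clusterSpace A Lam →
      -- `E_h` is well defined and finite-dimensional
      (∀ t ∈ Set.Icc (0 : ℝ) 1, Θ t ∈ resolventSet ℂ Sh) ∧
      FiniteDimensional ℂ Eh ∧
      -- the three claims
      gap (E.comap ι.toLinearMap) Eh < 1 ∧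
      Metric.hausdorffEDist Lam (ritzValues A (Eh.map ι.toLinearMap)) ≤
        ENNReal.ofReal
          (maxRatio A (Eh.map ι.toLinearMap) ^ 2 * gap (E.comap ι.toLinearMap) Eh ^ 2
            + C₀ * ‖ritzOp A E‖ * gap E (Eh.map ι.toLinearMap) ^ 2) ∧
      maxRatio A (Eh.map ι.toLinearMap) ^ 2 ≤
        (1 / (1 - gap (E.comap ι.toLinearMap) Eh)) ^ 2 * ‖ritzOp A E‖ := by
  obtain ⟨y, γ, δ, hf⟩ := hfilter
  obtain ⟨I, hI⟩ := exists_energyIsometry hnorm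
  have hfinM := finiteDimensional_comap_clusterSpace hLam hι
  obtain ⟨hres, hwind, hproj⟩ := spectralProjector_filterOp hA hLam hι hEV hI hRbdd hf hΘ
  have hclose : ∀ᶠ T in 𝓝 (filterOp ι A wN w z), ‖spectralProjector T Θ -
      ((clusterSpace A Lam).comap ι.toLinearMap).starProjection‖ < 1 := by
    rw [← hproj]
    have h := tendsto_iff_norm_sub_tendsto_zero.1
      (tendsto_contourMean_resolvent hΘ.toIsSimpleContour hres)
    exact h.eventually_lt_const one_pos
  -- Resolvent set along `Θ`, winding numbers in `{0, 1}`, and distance of the projectors less than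
  -- one: each persists for operators near the exact filter, hence for the discrete filter when `h`
  -- is small.
  have hev := (tendsto_discFilterOp hRlim (wN := wN) (w := w)).eventually
    ((eventually_contour_mem_resolventSet hΘ.toIsSimpleContour hres).and
      ((eventually_winding_spectrum hΘ.toIsSimpleContour hres hwind).and hclose))
  obtain ⟨h₀, hh₀, hsub⟩ := Metric.mem_nhdsWithin_iff.1 hev
  -- The comparison of quadratic forms yields the constant `C₀ = 1`.
  refine ⟨1, one_pos, h₀, hh₀, ?_⟩
  rintro h hhJ hlt _ rfl _ rfl _ rfl
  have hpos : 0 < h := hJ hhJ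
  obtain ⟨h1, h2, h3⟩ := hsub
    ⟨mem_ball_zero_iff.2 (by rwa [Real.norm_of_nonneg hpos.le]), hhJ⟩
  have := hVh h hhJ
  have hidem := spectralProjector_idempotent hΘ.toIsSimpleContour h1 h2 (Vh h) wN
    (discFilterOp_sub_mem hι (hRh h hhJ) (hRhbdd h hhJ))
  obtain ⟨hfinE, hrank, hinj, hgap⟩ := range_projection_close hidem h3
  refine ⟨h1, hfinE, hgap, ?_, ?_⟩
  · rw [one_mul]
    exact hausdorffEDist_ritzValues_le hA hLam hι hEV hI hrank hinj hgap
  · have h4 := maxRatio_le hI (div_nonneg (Real.sqrt_nonneg _) (sub_pos.2 hgap).le)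
      fun v hv => norm_le_of_gap_lt_one hA hLam hι hEV hI hgap hv
    refine (pow_le_pow_left₀ (maxRatio_nonneg _) h4 2).trans_eq ?_
    rw [div_pow, Real.sq_sqrt (norm_nonneg (ritzOp A (clusterSpace A Lam))), div_pow, one_pow, one_div_mul_eq_div]
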